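/- **Setting.** Let $\mathbb{B}^d$ be the closed Euclidean unit ball of $\mathbb{R}^d$, $\operatorname{sgn}(t)=1$ if $t\ge 0$ and $-1$ otherwise, and $h_{\mathbf w}(\mathbf x)=\operatorname{sgn}\langle \mathbf w,\mathbf x\rangle$. For a distribution $\mathcal D$ on $\mathbb{B}^d\times\{\pm1\}$ let $\mathcal R_\gamma(h,\mathcal D)=\Pr_{(\mathbf x,y)\sim\mathcal D}[\exists \mathbf z\in\mathbb{B}^d:\ \|\mathbf z-\mathbf x\|_2\le\gamma,\ h(\mathbf z)\ne y]$. Call $\mathcal D$ $\gamma$-realizable if $\mathcal R_\gamma(h_{\mathbf w^*},\mathcal D)=0$ for some $\mathbf w^*\neq 0$. A randomized algorithm that maps finite datasets in $\mathbb{B}^d\times\{\pm1\}$ to a vector $\mathbf w\in\mathbb{R}^d$ or FAIL is * $(\epsilon,\delta)$-DP if $\Pr[\mathbb A(\mathbf X)\in S]\le e^\epsilon\Pr[\mathbb A(\mathbf X')\in S]+\delta$ for all measurable sets $S$ of outputs and all datasets $\mathbf X,\mathbf X'$ (of any size) that differ by adding or removing one data point; * a $(\gamma,\gamma')$-robust learner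 with $n$ samples, accuracy $\alpha$ and failure probability $\xi$ if, for every $\gamma$-realizable $\mathcal D$, on $n$ i.i.d. samples from $\mathcal D$ it outputs with probability at least $1-\xi$ a vector $\mathbf w$ with $\mathcal R_{\gamma'}(h_{\mathbf w},\mathcal D)\le\alpha$. **The algorithm.** The DP Batch Perceptron with accuracy $\alpha$, margin $\gamma'$, number of rounds $T\in\mathbb N$, sampling rate $p\in(0,1]$ and noise levels $b>0$, $\sigma\ge0$, on a dataset $(\mathbf x_j,y_j)_{j\in[n]}$: set $\mathbf w_0=\mathbf 0$. In round $i=1,\dots,T$, choose a random set $S_i\subseteq[n]$ containing each index independently with probability $p$, let $\mathbf v_i=\mathbf w_{i-1}/\|\mathbf w_{i-1}\|$ (with $\mathbf 0/\|\mathbf 0\|:=\mathbf 0$) and $M_i=\{j\in S_i:\operatorname{sgn}(\langle\mathbf v_i,\mathbf x_j\rangle-y_j\gamma')\ne y_j\}$, and draw $\nu_i\sim\mathrm{Lap}(b)$; if $|M_i|+\nu_i<0.3\,\alpha pn$, stop and return $\mathbf v_i$; otherwise set $\mathbf w_i=\mathbf w_{i-1}+\sum_{j\in M_i}y_j\mathbf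 x_j+\mathbf g_i$ with $\mathbf g_i\sim\mathcal N(0,\sigma^2I_{d\times d})$. After round $T$ return FAIL. All draws are independent. Running time is the expected number of steps of a unit-cost real RAM on which an arithmetic operation, a square root, a comparison, a memory write, and a draw of one geometric, Laplace or one-dimensional Gaussian variable each cost one step; the set $S_i$ is generated by drawing the successive gaps between its elements from the geometric distribution with success probability $p$. **Theorem.** There is an absolute constant $k\in\mathbb N$ such that for all $\xi\in(0,1)$ and $\epsilon_0>0$ there is a constant $C=C(\xi,\epsilon_0)$ with the following property. For all $d\ge1$, $\gamma,\alpha,\delta\in(0,1)$ and $\epsilon\in(0,\epsilon_0]$, put $\Lambda=C\,\alpha^{-k}\bigl(1+\log\tfrac1{\alpha\gamma\delta}\bigr)^k$. There are $n\in\mathbb N$ and parameters $T,p,b,\sigma$ with $$n\le\Lambda\cdot\frac1\epsilon\max\Bigl\{\frac{\sqrt d}{\gamma},\frac1{\gamma^2}\Bigr\},\qquad T\le \frac{C\alpha^{-k}}{\gamma^2},$$ such that the DP Batch Perceptron with accuracy $\alpha$, margin $\gamma'=0.95\gamma$ and these parameters is $(\epsilon,\delta)$-DP, is a $(\gamma,0.9\gamma)$-robust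 learner with $n$ samples, accuracy $\alpha$ and failure probability $\xi$, and on every dataset of size $n$ has expected running time at most $\Lambda\cdot nd/\gamma$. -/

import Mathlib

open MeasureTheory ProbabilityTheory
open scoped ENNReal NNReal

namespace PrivateHalfspaces

noncomputable section

/-! ### Robust learning of halfspaces -/

/-- Euclidean space `ℝ^d`. -/
abbrev Vec (d : ℕ) : Type := EuclideanSpace ℝ (Fin d)

/-- The instance space: the closed Euclidean unit ball of `ℝ^d`. -/
abbrev Ball (d : ℕ) : Type := Metric.closedBall (0 : Vec d) 1

/-- A labelled example; the labels `±1` are the units of `ℤ`. -/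
abbrev Sample (d : ℕ) : Type := Ball d × ℤˣ

/-- The `±1`-valued sign, with the convention `sgn 0 = 1`. -/
def sgn (t : ℝ) : ℤˣ := if 0 ≤ t then 1 else -1

/-- The halfspace `h_w(x) = sgn ⟨w, x⟩`. -/
def halfspace {d : ℕ} (w : Vec d) (x : Ball d) : ℤˣ := sgn (inner ℝ w (x : Vec d))

/-- The robust risk of `h` under `L₂` perturbations of size at most `γ`:
the probability that some `z` of the instance space with `‖z - x‖ ≤ γ` has `h z ≠ y`. -/
def robustRisk {d : ℕ} (γ : ℝ) (h : Ball d → ℤˣ) (D : Measure (Sample d)) : ℝ≥0∞ :=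
  D {e | ∃ z : Ball d, ‖(z : Vec d) - (e.1 : Vec d)‖ ≤ γ ∧ h z ≠ e.2}

/-- `D` is realizable with margin `γ`: some halfspace has robust risk zero.  The degenerate
weight `w = 0`, which defines no halfspace, is excluded. -/
def Realizable {d : ℕ} (γ : ℝ) (D : Measure (Sample d)) : Prop :=
  ∃ w : Vec d, w ≠ 0 ∧ robustRisk γ (halfspace w) D = 0

/-! ### Step counting -/

/-- The result of a computation together with the number of elementary steps it took. -/
structure Timed (α : Type) where
  /-- the value that is computed -/
  val : α
  /-- the number of elementary steps -/
  steps : ℕ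

/-- Steps add up under sequential composition. -/
instance : Monad Timed where
  pure a := ⟨a, 0⟩
  bind m f := ⟨(f m.val).val, m.steps + (f m.val).steps⟩

/-- One elementary step of the unit-cost real RAM with result `a`: an arithmetic operation, a
square root or a comparison of numbers, a write to memory, or one draw of a scalar random
variable. -/
def step {α : Type} (a : α) : Timed α := ⟨a, 1⟩

/-- A loop over the `d` coordinates that fills a vector; the steps of all passes are added. -/
def forCoords {d : ℕ} (f : Fin d → Timed ℝ) : Timed (Vec d) :=
  ⟨WithLp.toLp 2 fun k => (f k).val, ∑ k, (f k).steps⟩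

/-! ### Randomized learners -/

/-- A randomized learner of halfspaces: for each size `n` of the dataset it draws coins `ω` from a
probability space and then computes, in a number of steps, from the dataset and the coins either a
weight vector `some w` or `none` (FAIL). -/
structure Learner (d : ℕ) where
  /-- the outcomes of the coins on datasets of size `n` -/
  Coins : ℕ → Type
  [meas : ∀ n, MeasurableSpace (Coins n)]
  /-- the law of the coins -/
  law : ∀ n, Measure (Coins n)
  [prob : ∀ n, IsProbabilityMeasure (law n)]
  /-- the computation -/
  run : ∀ {n : ℕ}, (Fin n → Sample d) → Coins n → Timed (Option (Vec d))

attribute [instance] Learner.meas Learner.prob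

/-- The probability that the output on the dataset `X` lies in `S`. -/
def Learner.outputProb {d : ℕ} (A : Learner d) {n : ℕ} (X : Fin n → Sample d)
    (S : Set (Option (Vec d))) : ℝ≥0∞ :=
  A.law n {ω | (A.run X ω).val ∈ S}

/-- The expected number of steps on the dataset `X`. -/
def Learner.expectedTime {d : ℕ} (A : Learner d) {n : ℕ} (X : Fin n → Sample d) : ℝ≥0∞ :=
  ∫⁻ ω, ((A.run X ω).steps : ℝ≥0∞) ∂(A.law n)

/-- `(ε, δ)`-differential privacy, where neighbouring datasets (of any size) arise by adding or
removing one data point.  The sets `S` of outputs are the measurable ones of the disjoint union of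
`ℝ^d` and `{FAIL}`. -/
def Learner.IsDP {d : ℕ} (A : Learner d) (ε δ : ℝ) : Prop :=
  ∀ (n : ℕ) (X : Fin (n + 1) → Sample d) (i : Fin (n + 1)) (S : Set (Option (Vec d))),
    MeasurableSet {w : Vec d | some w ∈ S} →
      A.outputProb X S
          ≤ ENNReal.ofReal (Real.exp ε) * A.outputProb (i.removeNth X) S + ENNReal.ofReal δ ∧
      A.outputProb (i.removeNth X) S
          ≤ ENNReal.ofReal (Real.exp ε) * A.outputProb X S + ENNReal.ofReal δ

/-- `A` is a `(γ, γ')`-robust learner with `n` samples, accuracy `α` and failure probability `ξ`: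
on `n` i.i.d. samples from any `D` that is realizable with margin `γ`, it fails to output a
halfspace with `γ'`-robust risk at most `α` with probability at most `ξ`. -/
def Learner.IsRobustLearner {d : ℕ} (A : Learner d) (γ γ' α ξ : ℝ) (n : ℕ) : Prop :=
  ∀ D : Measure (Sample d), IsProbabilityMeasure D → Realizable γ D →
    ((Measure.pi fun _ : Fin n => D).prod (A.law n))
        {q | ¬ ∃ w : Vec d, (A.run q.1 q.2).val = some w ∧
          robustRisk γ' (halfspace w) D ≤ ENNReal.ofReal α}
      ≤ ENNReal.ofReal ξ

/-! ### The DP Batch Perceptron -/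

/-- The Laplace distribution with scale `b`. -/
def laplace (b : ℝ) : Measure ℝ :=
  volume.withDensity fun x => ENNReal.ofReal (Real.exp (-|x| / b) / (2 * b))

theorem isProbabilityMeasure_laplace {b : ℝ} (hb : 0 < b) :
    IsProbabilityMeasure (laplace b) := by
  have hI : ∫ x : ℝ, Real.exp (-|x| / b) / (2 * b) = 1 := by
    rw [integral_comp_abs (f := fun x => Real.exp (-x / b) / (2 * b)), integral_div]
    have h := integral_exp_mul_Ioi (a := -b⁻¹) (by simpa using hb) 0
    have e : (fun x : ℝ => Real.exp (-x / b)) = fun x => Real.exp (-b⁻¹ * x) := by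
      funext x; congr 1; ring
    rw [e, h]
    simp
    field_simp
  constructor
  rw [laplace, withDensity_apply _ MeasurableSet.univ, Measure.restrict_univ,
    ← ofReal_integral_eq_lintegral_ofReal, hI, ENNReal.ofReal_one]
  · by_contra hc
    rw [integral_undef hc] at hI
    exact zero_ne_one hI
  · exact Filter.Eventually.of_forall fun x => by positivity

/-- The parameters: the number `T` of rounds, the sampling rate `p ∈ (0, 1]`, the scale `b` of the
Laplace noise and the standard deviation `σ` of each coordinate of the Gaussian noise. -/
structure Params where
  /-- number of rounds -/
  T : ℕ
  /-- sampling rate -/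
  p : unitInterval
  p_pos : 0 < p
  /-- scale of the Laplace noise -/
  b : ℝ
  b_pos : 0 < b
  /-- standard deviation of the Gaussian noise -/
  σ : ℝ≥0

/-- The coins of one round on a dataset of size `n`: the geometric gaps from which the batch is
built, the Laplace noise `ν` and the coordinates of the Gaussian noise `g`. -/
abbrev RoundCoins (d n : ℕ) : Type := (Fin (n + 1) → ℕ) × ℝ × (Fin d → ℝ)

/-- The coins of one round are independent: gaps `Geom(p)` (the number of failures before the
first success), `ν ∼ Lap(b)`, and `g ∼ N(0, σ² I)`, i.e. i.i.d. coordinates `N(0, σ²)`. -/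
def roundLaw (d n : ℕ) (θ : Params) : Measure (RoundCoins d n) :=
  (Measure.pi fun _ => geometricMeasure θ.p).prod
    ((laplace θ.b).prod (Measure.pi fun _ => gaussianReal 0 (θ.σ ^ 2)))

instance (d n : ℕ) (θ : Params) : IsProbabilityMeasure (roundLaw d n θ) := by
  have := isProbabilityMeasure_laplace θ.b_pos
  unfold roundLaw
  infer_instance

/-- Draws a batch that contains each of the indices `0, …, n - 1` independently with probability
`p`, by jumping from each chosen index to the next one over a gap drawn from `Geom(p)`: `pos` is
the first index that has not been decided.  At most `n + 1` gaps are ever drawn. -/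
def drawBatch (n : ℕ) : List ℕ → ℕ → Timed (List (Fin n))
  | [], _ => pure []
  | gap :: gaps, pos => do
      -- the draw
      let g ← step gap
      let j ← step (pos + g)
      let _ ← step (decide (j < n))
      if h : j < n then do
        let pos' ← step (j + 1)
        let batch ← drawBatch n gaps pos'
        step (⟨j, h⟩ :: batch)
      else
        pure []

/-- The inner product of two vectors. -/
def innerProd {d : ℕ} (u v : Vec d) : Timed ℝ :=
  (List.finRange d).foldlM (fun s k => do
    let t ← step (u k * v k)
    step (s + t)) 0

/-- The normalized vector `w / ‖w‖`, where `0 / ‖0‖` is read as `0`. -/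
def normalize {d : ℕ} (w : Vec d) : Timed (Vec d) := do
  let s ← innerProd w w
  let r ← step (Real.sqrt s)
  forCoords fun k => step (w k / r)

/-- The test `sgn (⟨v, x⟩ - y γ') ≠ y`: the sample `(x, y)` is not correctly classified by `v` with
margin `γ'`. -/
def marginMistake {d : ℕ} (γ' : ℝ) (v : Vec d) (e : Sample d) : Timed Bool := do
  let s ← innerProd v (e.1 : Vec d)
  let t ← step (((e.2 : ℤ) : ℝ) * γ')
  let r ← step (s - t)
  step (decide (sgn r ≠ e.2))

/-- The list `M` of the members of the batch that are not correctly classified with margin `γ'`. -/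
def mistakes {d n : ℕ} (γ' : ℝ) (X : Fin n → Sample d) (v : Vec d) :
    List (Fin n) → Timed (List (Fin n))
  | [] => pure []
  | j :: batch => do
      let bad ← marginMistake γ' v (X j)
      let M ← mistakes γ' X v batch
      if bad then step (j :: M) else pure M

/-- The number `|M|`. -/
def count {n : ℕ} (M : List (Fin n)) : Timed ℝ :=
  M.foldlM (fun c _ => step (c + 1)) 0

/-- The zero vector. -/
def zeroVec (d : ℕ) : Timed (Vec d) := forCoords fun _ => step 0

/-- The sum of two vectors. -/
def addVec {d : ℕ} (u v : Vec d) : Timed (Vec d) := forCoords fun k => step (u k + v k)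

/-- The update `u = ∑_{(x, y) ∈ M} y x`. -/
def update {d n : ℕ} (X : Fin n → Sample d) (M : List (Fin n)) : Timed (Vec d) := do
  let u₀ ← zeroVec d
  M.foldlM (fun u j => do
    let v ← forCoords fun k => step ((((X j).2 : ℤ) : ℝ) * ((X j).1 : Vec d) k)
    addVec u v) u₀

/-- The rounds, one for each entry of the list of coins, from the current weight vector `w`.
The threshold of the stopping rule is `0.3 α p n`, where `n` is the size of the dataset. -/
def rounds {d n : ℕ} (α γ' : ℝ) (θ : Params) (X : Fin n → Sample d) :
    List (RoundCoins d n) → Vec d → Timed (Option (Vec d))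
  | [], _ => pure none
  | ω :: ωs, w => do
      let S ← drawBatch n (List.ofFn ω.1) 0
      let v ← normalize w
      let M ← mistakes γ' X v S
      let m ← count M
      -- the draw of the Laplace noise
      let ν ← step ω.2.1
      let a ← step (m + ν)
      let t₁ ← step ((3 / 10 : ℝ) * α)
      let t₂ ← step (t₁ * (θ.p : ℝ))
      let t₃ ← step (t₂ * (n : ℝ))
      let stopNow ← step (decide (a < t₃))
      if stopNow then
        pure (some v)
      else do
        let u ← update X M
        -- the draw of the Gaussian noise
        let g ← forCoords fun k => step (ω.2.2 k)
        let w₁ ← addVec w u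
        let w₂ ← addVec w₁ g
        rounds α γ' θ X ωs w₂

/-- The DP Batch Perceptron with target accuracy `α` and margin `γ'`. -/
def dpBatchPerceptron (d : ℕ) (α γ' : ℝ) (θ : Params) : Learner d where
  Coins n := Fin θ.T → RoundCoins d n
  law n := Measure.pi fun _ => roundLaw d n θ
  run X ω := do
    let w₀ ← zeroVec d
    rounds α γ' θ X (List.ofFn ω) w₀

end

end PrivateHalfspaces

namespace PrivateHalfspaces

noncomputable section

/-! ### Values and step counts of the program -/

namespace Timed

variable {α β : Type}

/-! Privacy. Fix an output event and regard its probability as a function of the current weight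
vector and the number of remaining rounds (`acceptProb`); conditioning on the coins of one round
gives a backward recursion (`pi_roundLaw_rounds`). Two runs are compared through the Rényi-type
inequality P ≤ c · Q^(1 - 1/r). If the noise of one run has density ρ with respect to that of the
other, Hölder's inequality multiplies c by (∫ ρ^r)^(1/r) in each round, and Jensen's inequality
averages over the common part of the batch. An additional data point enters the batch with
probability p and then translates the pair (Laplace noise, Gaussian noise) by a vector with
components of norm at most 1. Hence ρ = 1 + p (R - 1), where R is the likelihood ratio of a
translation. Since ∫ R = 1, terms linear in R - 1 vanish, and the moments of ρ and 1/ρ are at most 1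
+ p² when both noise levels are at least 4r (`Params.Noisy.lintegral_mixture`). With T p² ≤ 1 all
rounds together cost a factor e^(1/r), and an order r of size log(1/(αγδ))/ε turns this into
differential privacy (`le_exp_mul_add_of_renyi`). The stopping threshold depends on the dataset
size; its change is at most p and is absorbed by an intermediate run on the smaller dataset with the
threshold of the larger one.

Utility. Three bad events get probability ξ/3 each. (1) No round stops: along the unit vector w*
with margin γ, the potential √(‖w‖² + A²) - ⟨w*, w⟩ is nonnegative and starts at A. A mistake at
margin 0.95 γ lowers it by 0.05 γ to first order, while second-order terms are damped by 1/A, so T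
of order 1/(αγ)² rounds exhaust it (`acceptProb_none_le`). (2) Some round stops at a vector with at
least αn/2 mistakes on the dataset: a Chernoff bound over the batch and the Laplace noise, and a
union bound over the rounds (`acceptProb_bad_le`). (3) Some vector of the unit ball makes few
mistakes on the sample at margin 0.95 γ, although its margin is at most 0.9 γ with probability above
α: symmetrization and contraction for a (20/γ)-Lipschitz ramp loss bound this without reference to
the dimension (`measure_generalization_le`).

Sizes. With p = 1/√T, of order αγ, the expected batch size pn must dominate √d σ and b ·
log(1/(αγδ))/α. This gives the term √d/γ in n, and generalization gives 1/γ². The work is dominated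
by T · pn · d = √T · n d. -/

@[simp] lemma val_pure (a : α) : (pure a : Timed α).val = a := rfl

@[simp] lemma steps_pure (a : α) : (pure a : Timed α).steps = 0 := rfl

@[simp] lemma val_bind (m : Timed α) (f : α → Timed β) : (m >>= f).val = (f m.val).val := rfl

@[simp] lemma steps_bind (m : Timed α) (f : α → Timed β) :
    (m >>= f).steps = m.steps + (f m.val).steps := rfl

@[simp] lemma val_step (a : α) : (step a).val = a := rfl

@[simp] lemma steps_step (a : α) : (step a).steps = 1 := rfl

lemma val_foldlM (f : β → α → Timed β) (l : List α) (b : β) :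
    (l.foldlM f b).val = l.foldl (fun b a => (f b a).val) b := by
  induction l generalizing b with
  | nil => rfl
  | cons a l ih => simp [List.foldlM_cons, ih]

lemma steps_foldlM (f : β → α → Timed β) (c : ℕ) (hf : ∀ b a, (f b a).steps = c) (l : List α)
    (b : β) : (l.foldlM f b).steps = l.length * c := by
  induction l generalizing b with
  | nil => simp
  | cons a l ih => simp [List.foldlM_cons, ih, hf]; ring

end Timed

variable {d n : ℕ}

@[simp] lemma forCoords_val (f : Fin d → Timed ℝ) :
    (forCoords f).val = WithLp.toLp 2 fun k => (f k).val := rfl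

@[simp] lemma forCoords_steps (f : Fin d → Timed ℝ) :
    (forCoords f).steps = ∑ k, (f k).steps := rfl

/-- The unit vector `w / ‖w‖`, or `0` if `w = 0`. -/
def normalized (w : Vec d) : Vec d := ‖w‖⁻¹ • w

lemma norm_normalized_le (w : Vec d) : ‖normalized w‖ ≤ 1 := by
  rw [normalized, norm_smul, norm_inv, norm_norm]
  exact inv_mul_le_one

lemma norm_smul_normalized (w : Vec d) : ‖w‖ • normalized w = w := by
  rcases eq_or_ne w 0 with rfl | h
  · simp
  · rw [normalized, smul_smul, mul_inv_cancel₀ (norm_ne_zero_iff.2 h), one_smul]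

/-- The sample `e` is not correctly classified by `v` with margin `γ'`. -/
def IsMistake (γ' : ℝ) (v : Vec d) (e : Sample d) : Prop :=
  sgn (inner ℝ v (e.1 : Vec d) - ((e.2 : ℤ) : ℝ) * γ') ≠ e.2

instance (γ' : ℝ) (v : Vec d) (e : Sample d) : Decidable (IsMistake γ' v e) := by
  unfold IsMistake; infer_instance

/-- The members of `L` that are not correctly classified by `v` with margin `γ'`. -/
def mistakeList (γ' : ℝ) (X : Fin n → Sample d) (v : Vec d) (L : List (Fin n)) : List (Fin n) :=
  L.filter fun j => IsMistake γ' v (X j)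

/-- The point `y x` of the labelled example `(x, y)`. -/
def signed (e : Sample d) : Vec d := ((e.2 : ℤ) : ℝ) • (e.1 : Vec d)

/-- The number of mistakes in the batch `L`. -/
def mistakeCount (γ' : ℝ) (X : Fin n → Sample d) (v : Vec d) (L : List (Fin n)) : ℝ :=
  (mistakeList γ' X v L).length

/-- The sum of `y x` over the mistakes in the batch `L`. -/
def mistakeSum (γ' : ℝ) (X : Fin n → Sample d) (v : Vec d) (L : List (Fin n)) : Vec d :=
  ((mistakeList γ' X v L).map fun j => signed (X j)).sum

lemma innerProd_val (u v : Vec d) : (innerProd u v).val = inner ℝ u v := by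
  have key : ∀ (l : List (Fin d)) (s : ℝ),
      l.foldl (fun s k => s + u k * v k) s = s + (l.map fun k => u k * v k).sum := by
    intro l
    induction l with
    | nil => simp
    | cons a l ih => intro s; simp [ih, add_assoc]
  rw [innerProd, Timed.val_foldlM]
  simp only [Timed.val_bind, Timed.val_step]
  rw [key, zero_add, PiLp.inner_apply, ← List.ofFn_eq_map, List.sum_ofFn]
  exact Finset.sum_congr rfl fun k _ => by simp [mul_comm]

lemma innerProd_steps (u v : Vec d) : (innerProd u v).steps = d * 2 := by
  rw [innerProd, Timed.steps_foldlM (c := 2)]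
  · simp
  · intros; simp

/-- Division by zero and the inverse of zero are both 0, so the convention 0/‖0‖ = 0 needs no
separate case. -/
lemma normalize_val (w : Vec d) : (normalize w).val = normalized w := by
  ext k
  simp only [normalize, Timed.val_bind, Timed.val_step, forCoords_val, innerProd_val, normalized,
    PiLp.smul_apply, smul_eq_mul]
  rw [real_inner_self_eq_norm_sq, Real.sqrt_sq (norm_nonneg _), div_eq_inv_mul]

lemma normalize_steps (w : Vec d) : (normalize w).steps = d * 3 + 1 := by
  simp [normalize, innerProd_steps]; ring

lemma marginMistake_val (γ' : ℝ) (v : Vec d) (e : Sample d) :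
    (marginMistake γ' v e).val = decide (IsMistake γ' v e) := by
  have h : (marginMistake γ' v e).val =
      decide (sgn ((innerProd v (e.1 : Vec d)).val - ((e.2 : ℤ) : ℝ) * γ') ≠ e.2) := rfl
  rw [h, decide_eq_decide, innerProd_val, IsMistake]

lemma marginMistake_steps (γ' : ℝ) (v : Vec d) (e : Sample d) :
    (marginMistake γ' v e).steps = d * 2 + 3 := by
  simp [marginMistake, innerProd_steps]

lemma mistakes_val (γ' : ℝ) (X : Fin n → Sample d) (v : Vec d) (L : List (Fin n)) :
    (mistakes γ' X v L).val = mistakeList γ' X v L := by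
  induction L with
  | nil => simp [mistakes, mistakeList]
  | cons j L ih =>
    rw [mistakes]
    simp only [Timed.val_bind, marginMistake_val, mistakeList, List.filter_cons] at ih ⊢
    split_ifs <;> simp [ih]

lemma mistakes_steps_le (γ' : ℝ) (X : Fin n → Sample d) (v : Vec d) (L : List (Fin n)) :
    (mistakes γ' X v L).steps ≤ L.length * (d * 2 + 4) := by
  induction L with
  | nil => simp [mistakes]
  | cons j L ih =>
    rw [mistakes]
    simp only [Timed.steps_bind, marginMistake_steps, List.length_cons]
    split_ifs <;> simp only [Timed.steps_step, Timed.steps_pure] <;> linarith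

lemma length_mistakeList_le (γ' : ℝ) (X : Fin n → Sample d) (v : Vec d) (L : List (Fin n)) :
    (mistakeList γ' X v L).length ≤ L.length := List.length_filter_le _ _

lemma count_val (M : List (Fin n)) : (count M).val = M.length := by
  have key : ∀ (l : List (Fin n)) (s : ℝ), l.foldl (fun s _ => s + 1) s = s + l.length := by
    intro l
    induction l with
    | nil => simp
    | cons a l ih => intro s; simp only [List.foldl_cons, ih, List.length_cons]; push_cast; ring
  rw [count, Timed.val_foldlM]
  simp only [Timed.val_step]
  rw [key, zero_add]

lemma count_steps (M : List (Fin n)) : (count M).steps = M.length := by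
  rw [count, Timed.steps_foldlM (c := 1) (hf := fun _ _ => rfl), mul_one]

lemma addVec_val (u v : Vec d) : (addVec u v).val = u + v := by
  ext k; simp [addVec]

lemma addVec_steps (u v : Vec d) : (addVec u v).steps = d := by simp [addVec]

lemma zeroVec_val : (zeroVec d).val = 0 := by
  ext k; simp [zeroVec]

lemma zeroVec_steps : (zeroVec d).steps = d := by simp [zeroVec]

lemma update_val (X : Fin n → Sample d) (M : List (Fin n)) :
    (update X M).val = (M.map fun j => signed (X j)).sum := by
  have key : ∀ (l : List (Fin n)) (s : Vec d),
      l.foldl (fun u j => u + signed (X j)) s = s + (l.map fun j => signed (X j)).sum := by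
    intro l
    induction l with
    | nil => simp
    | cons a l ih => intro s; simp [ih, add_assoc]
  rw [update, Timed.val_bind, Timed.val_foldlM, zeroVec_val, ← zero_add (List.sum _), ← key]
  simp only [Timed.val_bind, addVec_val, forCoords_val, Timed.val_step]
  rfl

lemma update_steps (X : Fin n → Sample d) (M : List (Fin n)) :
    (update X M).steps = d + M.length * (2 * d) := by
  rw [update, Timed.steps_bind, Timed.steps_foldlM (c := 2 * d), zeroVec_steps]
  intro u j
  simp [addVec_steps]; ring

/-! ### Batches from gaps, and one round of the program -/

/-- The batch that is drawn from the given gaps. -/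
def batch (n : ℕ) (gaps : List ℕ) (pos : ℕ) : List (Fin n) := (drawBatch n gaps pos).val

lemma batch_cons (n g : ℕ) (gaps : List ℕ) (pos : ℕ) :
    batch n (g :: gaps) pos =
      if h : pos + g < n then ⟨pos + g, h⟩ :: batch n gaps (pos + g + 1) else [] := by
  change (if h : pos + g < n then (do
    let pos' ← step (pos + g + 1)
    let batch ← drawBatch n gaps pos'
    step (⟨pos + g, h⟩ :: batch)) else pure [] : Timed (List (Fin n))).val = _
  split_ifs <;> rfl

/-- A chosen index costs five steps: the draw, the addition, the comparison, the new position and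
the list cell. The final gap that jumps past the end costs the first three only. -/
lemma drawBatch_steps_le (n : ℕ) (gaps : List ℕ) (pos : ℕ) :
    (drawBatch n gaps pos).steps ≤ (batch n gaps pos).length * 5 + 3 := by
  induction gaps generalizing pos with
  | nil => simp [drawBatch]
  | cons g gaps ih =>
    rw [batch_cons]
    change 1 + (1 + (1 + (if h : pos + g < n then (do
      let pos' ← step (pos + g + 1)
      let batch ← drawBatch n gaps pos'
      step (⟨pos + g, h⟩ :: batch)) else pure [] : Timed (List (Fin n))).steps)) ≤ _
    split_ifs with h
    · have := ih (pos + g + 1)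
      simp only [Timed.steps_bind, Timed.val_step, Timed.steps_step, List.length_cons]
      omega
    · simp

/-- The batch of a round with the given gaps. -/
def roundBatch (gaps : Fin (n + 1) → ℕ) : List (Fin n) := batch n (List.ofFn gaps) 0

lemma rounds_nil_val (α γ' : ℝ) (θ : Params) (X : Fin n → Sample d) (w : Vec d) :
    (rounds α γ' θ X [] w).val = none := rfl

lemma rounds_cons_val (α γ' : ℝ) (θ : Params) (X : Fin n → Sample d) (ω : RoundCoins d n)
    (ωs : List (RoundCoins d n)) (w : Vec d) :
    (rounds α γ' θ X (ω :: ωs) w).val =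
      if mistakeCount γ' X (normalized w) (roundBatch ω.1) + ω.2.1 < 3 / 10 * α * θ.p * n then
        some (normalized w)
      else
        (rounds α γ' θ X ωs (w + mistakeSum γ' X (normalized w) (roundBatch ω.1) +
          WithLp.toLp 2 ω.2.2)).val := by
  rw [rounds]
  simp only [Timed.val_bind]
  have e : (step (decide ((step ((count (mistakes γ' X (normalize w).val
      (drawBatch n (List.ofFn ω.1) 0).val).val).val + (step ω.2.1).val)).val <
      (step ((step ((step ((3 / 10 : ℝ) * α)).val * (θ.p : ℝ))).val * (n : ℝ))).val))).val = true ↔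
      mistakeCount γ' X (normalized w) (roundBatch ω.1) + ω.2.1 < 3 / 10 * α * θ.p * n := by
    simp only [Timed.val_step, decide_eq_true_eq, normalize_val, mistakes_val, count_val]
    rfl
  by_cases h : mistakeCount γ' X (normalized w) (roundBatch ω.1) + ω.2.1 < 3 / 10 * α * θ.p * n
  · rw [if_pos h, if_pos (e.2 h), Timed.val_pure, normalize_val]
  · rw [if_neg h, if_neg (mt e.1 h)]
    simp only [Timed.val_bind, update_val, addVec_val, forCoords_val, Timed.val_step,
      normalize_val, mistakes_val]
    rfl

/-- Apart from the batch a round costs at most 7d + 10 steps, and each batch element at most 4d +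
10. For d ≥ 1 both are below 20d. -/
lemma rounds_cons_steps_le (α γ' : ℝ) (θ : Params) (X : Fin n → Sample d) (hd : 1 ≤ d)
    (ωs : List (RoundCoins d n)) (w : Vec d) :
    (rounds α γ' θ X ωs w).steps ≤
      (ωs.map fun ω => 20 * d * (1 + (roundBatch ω.1).length)).sum := by
  induction ωs generalizing w with
  | nil => simp [rounds]
  | cons ω ωs ih =>
    rw [rounds]
    simp only [Timed.steps_bind, Timed.steps_step, normalize_steps, count_steps, List.map_cons,
      List.sum_cons]
    have h1 := drawBatch_steps_le n (List.ofFn ω.1) 0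
    have h2 := mistakes_steps_le γ' X (normalize w).val (roundBatch ω.1)
    have h3 := length_mistakeList_le γ' X (normalize w).val (roundBatch ω.1)
    rw [← mistakes_val] at h3
    change (drawBatch n (List.ofFn ω.1) 0).steps ≤ (roundBatch ω.1).length * 5 + 3 at h1
    change (mistakes γ' X (normalize w).val (drawBatch n (List.ofFn ω.1) 0).val).steps ≤ _ at h2
    change (mistakes γ' X (normalize w).val (drawBatch n (List.ofFn ω.1) 0).val).val.length ≤ _
      at h3
    set ℓ := (roundBatch ω.1).length
    set M := (mistakes γ' X (normalize w).val (drawBatch n (List.ofFn ω.1) 0).val).val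
    have h4 : M.length * (2 * d) ≤ ℓ * (2 * d) := Nat.mul_le_mul_right _ h3
    have h5 : ℓ ≤ ℓ * d := Nat.le_mul_of_pos_right _ hd
    split_ifs with hs
    · simp only [Timed.steps_pure]
      refine le_trans ?_ (Nat.le_add_right _ _)
      nlinarith
    · simp only [Timed.steps_bind, update_steps, addVec_steps, forCoords_steps, Timed.steps_step,
        Finset.sum_const, Finset.card_univ, Fintype.card_fin, smul_eq_mul, mul_one]
      have h6 := ih (addVec (addVec w (update X M).val).val
        (forCoords fun k => step (ω.2.2 k)).val).val
      nlinarith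

/-! ### Random sublists -/

section Sublist

variable {ι κ : Type*}

/-- The expectation of `F L` for the random sublist `L` of `l` that contains each entry
independently with probability `p`. -/
def sublistE (p : ℝ≥0∞) : List ι → (List ι → ℝ≥0∞) → ℝ≥0∞
  | [], F => F []
  | a :: l, F => p * sublistE p l (fun L => F (a :: L)) + (1 - p) * sublistE p l F

variable {p : ℝ≥0∞}

lemma sublistE_mono (l : List ι) {F G : List ι → ℝ≥0∞} (h : ∀ L, F L ≤ G L) :
    sublistE p l F ≤ sublistE p l G := by
  induction l generalizing F G with
  | nil => exact h []
  | cons a l ih => exact add_le_add (mul_le_mul_right (ih fun L => h _) _) (mul_le_mul_right (ih h) _)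

lemma sublistE_add (l : List ι) (F G : List ι → ℝ≥0∞) :
    sublistE p l (fun L => F L + G L) = sublistE p l F + sublistE p l G := by
  induction l generalizing F G with
  | nil => rfl
  | cons a l ih => simp only [sublistE, ih]; ring

lemma sublistE_const_mul (l : List ι) (c : ℝ≥0∞) (F : List ι → ℝ≥0∞) :
    sublistE p l (fun L => c * F L) = c * sublistE p l F := by
  induction l generalizing F with
  | nil => rfl
  | cons a l ih => simp only [sublistE, ih]; ring

lemma sublistE_const (hp : p ≤ 1) (l : List ι) (c : ℝ≥0∞) : sublistE p l (fun _ => c) = c := by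
  induction l with
  | nil => rfl
  | cons a l ih => simp only [sublistE, ih]; rw [← add_mul, add_tsub_cancel_of_le hp, one_mul]

lemma sublistE_map (f : ι → κ) (l : List ι) (F : List κ → ℝ≥0∞) :
    sublistE p (l.map f) F = sublistE p l fun L => F (L.map f) := by
  induction l generalizing F with
  | nil => rfl
  | cons a l ih => simp only [List.map_cons, sublistE, ih]

/-- Entries are decided independently, so only the order inside the sublist could depend on the
order of the list, and F does not see it. This allows a chosen data point to be decided first. -/
lemma sublistE_perm {l l' : List ι} (h : l.Perm l') (F : List ι → ℝ≥0∞)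
    (hF : ∀ L L' : List ι, L.Perm L' → F L = F L') : sublistE p l F = sublistE p l' F := by
  induction h generalizing F with
  | nil => rfl
  | cons a h ih =>
    simp only [sublistE]
    rw [ih F hF, ih _ fun L L' hL => hF _ _ (hL.cons a)]
  | swap a b l =>
    simp only [sublistE]
    have : (fun L => F (b :: a :: L)) = fun L => F (a :: b :: L) :=
      funext fun L => hF _ _ (.swap a b L)
    rw [this]
    ring
  | trans _ _ ih₁ ih₂ => rw [ih₁ F hF, ih₂ F hF]

/-- Jensen's inequality for the concave function x ↦ x^s, applied to one coin at a time. -/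
lemma sublistE_rpow_le (hp : p ≤ 1) {s : ℝ} (hs0 : 0 < s) (hs1 : s ≤ 1) (l : List ι)
    (F : List ι → ℝ≥0∞) : sublistE p l (fun L => F L ^ s) ≤ sublistE p l F ^ s := by
  induction l generalizing F with
  | nil => rfl
  | cons a l ih =>
    have key : ∀ x y : ℝ≥0∞, p * x ^ s + (1 - p) * y ^ s ≤ (p * x + (1 - p) * y) ^ s := by
      intro x y
      -- The two-point case is the power mean inequality with exponent 1/s ≥ 1 for the numbers x^s
      -- and y^s.
      have h := ENNReal.rpow_arith_mean_le_arith_mean2_rpow p (1 - p) (x ^ s) (y ^ s)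
        (add_tsub_cancel_of_le hp) (p := s⁻¹) ((one_le_inv₀ hs0).2 hs1)
      rw [← ENNReal.rpow_mul, ← ENNReal.rpow_mul, mul_inv_cancel₀ hs0.ne', ENNReal.rpow_one,
        ENNReal.rpow_one] at h
      have h' := ENNReal.rpow_le_rpow h hs0.le
      rwa [← ENNReal.rpow_mul, inv_mul_cancel₀ hs0.ne', ENNReal.rpow_one] at h'
    exact (add_le_add (mul_le_mul_right (ih _) _) (mul_le_mul_right (ih _) _)).trans (key _ _)

lemma measurable_sublistE {α : Type*} [MeasurableSpace α] (l : List ι) (F : α → List ι → ℝ≥0∞)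
    (hF : ∀ L, Measurable fun a => F a L) : Measurable fun a => sublistE p l (F a) := by
  induction l generalizing F with
  | nil => exact hF []
  | cons b l ih =>
    exact ((ih (fun a L => F a (b :: L)) fun L => hF _).const_mul _).add ((ih F hF).const_mul _)

lemma sublistE_length (hp : p ≤ 1) (l : List ι) :
    sublistE p l (fun L => (L.length : ℝ≥0∞)) = p * l.length := by
  induction l with
  | nil => simp [sublistE]
  | cons a l ih =>
    simp only [sublistE, List.length_cons, Nat.cast_add, Nat.cast_one, sublistE_add, ih,
      sublistE_const hp]
    calc p * (p * l.length + 1) + (1 - p) * (p * l.length)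
        = (p + (1 - p)) * (p * l.length) + p := by ring
      _ = p * (l.length + 1) := by rw [add_tsub_cancel_of_le hp]; ring

lemma sublistE_length_sq_le (hp : p ≤ 1) (l : List ι) :
    sublistE p l (fun L => (L.length : ℝ≥0∞) ^ 2) ≤ p * l.length + (p * l.length) ^ 2 := by
  induction l with
  | nil => simp [sublistE]
  | cons a l ih =>
    have e : (fun L : List ι => ((a :: L).length : ℝ≥0∞) ^ 2) =
        fun L => (L.length : ℝ≥0∞) ^ 2 + (2 * L.length + 1) := by
      funext L; simp only [List.length_cons, Nat.cast_add, Nat.cast_one]; ring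
    simp only [sublistE]
    rw [e, sublistE_add, sublistE_add, sublistE_const_mul, sublistE_length hp, sublistE_const hp]
    set Z := sublistE p l fun L => (L.length : ℝ≥0∞) ^ 2
    calc p * (Z + (2 * (p * l.length) + 1)) + (1 - p) * Z
        = (p + (1 - p)) * Z + p * (2 * (p * l.length) + 1) := by ring
      _ ≤ (p * l.length + (p * l.length) ^ 2) + p * (2 * (p * l.length) + 1) := by
          rw [add_tsub_cancel_of_le hp, one_mul]; gcongr
      -- The added p² completes the square; this gives away the correction -p² of the binomial
      -- variance.
      _ ≤ (p * l.length + (p * l.length) ^ 2) + p * (2 * (p * l.length) + 1) + p ^ 2 := le_self_add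
      _ = p * (a :: l).length + (p * (a :: l).length) ^ 2 := by
          simp only [List.length_cons, Nat.cast_add, Nat.cast_one]; ring

/-- The generating function of a binomial variable: each entry satisfying q contributes an
independent factor px + 1 - p. It is the input of the Chernoff bound. -/
lemma sublistE_pow_countP (hp : p ≤ 1) (q : ι → Bool) (x : ℝ≥0∞) (l : List ι) :
    sublistE p l (fun L => x ^ L.countP q) = (p * x + (1 - p)) ^ l.countP q := by
  induction l with
  | nil => simp [sublistE]
  | cons a l ih =>
    simp only [sublistE, List.countP_cons]
    cases q a
    · simp only [Bool.false_eq_true, if_false, add_zero, ih]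
      rw [← add_mul, add_tsub_cancel_of_le hp, one_mul]
    · simp only [if_true, pow_succ, mul_comm _ x, sublistE_const_mul, ih]
      ring

/-- A batch from n + 1 points is a batch from the points other than i together with an independent
coin for i. This is where neighbouring datasets are coupled. -/
lemma sublistE_finRange_succ (n : ℕ) (i : Fin (n + 1)) (F : List (Fin (n + 1)) → ℝ≥0∞)
    (hF : ∀ L L' : List (Fin (n + 1)), L.Perm L' → F L = F L') :
    sublistE p (List.finRange (n + 1)) F =
      sublistE p (List.finRange n) fun L =>
        p * F (i :: L.map i.succAbove) + (1 - p) * F (L.map i.succAbove) := by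
  have h : (List.finRange (n + 1)).Perm (i :: (List.finRange n).map i.succAbove) := by
    rw [List.perm_ext_iff_of_nodup (List.nodup_finRange _)]
    · intro j
      simp only [List.mem_finRange, List.mem_cons, List.mem_map, true_and, true_iff]
      rcases Fin.eq_self_or_eq_succAbove i j with h | ⟨k, h⟩
      · exact .inl h
      · exact .inr ⟨k, h.symm⟩
    · refine List.nodup_cons.2 ⟨?_, (List.nodup_finRange n).map i.succAbove_right_injective⟩
      simp [Fin.succAbove_ne]
  rw [sublistE_perm h F hF, sublistE_add, sublistE_const_mul, sublistE_const_mul]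
  simp only [sublistE, sublistE_map]

end Sublist

/-! ### The law of the batch -/

lemma lintegral_pi_cons {α : Type*} [MeasurableSpace α] (μ : Measure α) [IsProbabilityMeasure μ]
    (m : ℕ) (F : (Fin (m + 1) → α) → ℝ≥0∞) (hF : Measurable F) :
    ∫⁻ ω, F ω ∂(Measure.pi fun _ : Fin (m + 1) => μ) =
      ∫⁻ a, ∫⁻ ω, F (Fin.cons a ω) ∂(Measure.pi fun _ : Fin m => μ) ∂μ := by
  have h := (measurePreserving_piFinSuccAbove (fun _ : Fin (m + 1) => μ) 0).symm
  rw [← h.lintegral_comp hF, lintegral_prod]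
  swap
  · exact (hF.comp h.measurable).aemeasurable
  simp only [MeasurableEquiv.piFinSuccAbove_symm_apply, Fin.insertNthEquiv, Equiv.coe_fn_mk,
    Fin.insertNth_zero']

lemma measurable_fin_cons {α : Type*} [MeasurableSpace α] (m : ℕ) :
    Measurable fun q : α × (Fin m → α) => (Fin.cons q.1 q.2 : Fin (m + 1) → α) := by
  refine measurable_pi_lambda _ fun i => ?_
  refine Fin.cases ?_ (fun j => ?_) i
  · simpa using measurable_fst
  · simp only [Fin.cons_succ]
    fun_prop

/-- Memorylessness: a geometric variable is 0 with probability p and otherwise exceeds a fresh copy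
of itself by one. -/
lemma lintegral_geometric_succ (p : unitInterval) (hp : 0 < p) (f : ℕ → ℝ≥0∞) :
    ∫⁻ g, f g ∂geometricMeasure p =
      ENNReal.ofReal p * f 0 + (1 - ENNReal.ofReal p) * ∫⁻ g, f (g + 1) ∂geometricMeasure p := by
  have hw : ∀ k : ℕ, ENNReal.ofReal ((1 - p) ^ k * p) =
      (1 - ENNReal.ofReal p) ^ k * ENNReal.ofReal p := by
    intro k
    have h1 : (0 : ℝ) ≤ 1 - p := sub_nonneg.2 p.2.2
    rw [ENNReal.ofReal_mul (by positivity), ENNReal.ofReal_pow h1, ENNReal.ofReal_sub _ p.2.1,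
      ENNReal.ofReal_one]
  have hs : ∀ h : ℕ → ℝ≥0∞, ∫⁻ g, h g ∂geometricMeasure p =
      ∑' k, (1 - ENNReal.ofReal p) ^ k * ENNReal.ofReal p * h k := by
    intro h
    rw [geometricMeasure_eq hp.ne', lintegral_sum_measure]
    refine tsum_congr fun k => ?_
    rw [lintegral_smul_measure, lintegral_dirac, hw, smul_eq_mul]
  rw [hs, hs, tsum_eq_zero_add' ENNReal.summable, ← ENNReal.tsum_mul_left]
  congr 1
  · simp
  · exact tsum_congr fun k => by ring

lemma batch_eq_nil_of_le {n : ℕ} (gaps : List ℕ) {pos : ℕ} (h : n ≤ pos) :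
    batch n gaps pos = [] := by
  cases gaps with
  | nil => rfl
  | cons g gaps => rw [batch_cons, dif_neg (by omega)]

lemma batch_succ_cons (n g : ℕ) (gaps : List ℕ) (pos : ℕ) :
    batch n ((g + 1) :: gaps) pos = batch n (g :: gaps) (pos + 1) := by
  simp only [batch_cons, show pos + (g + 1) = pos + 1 + g by ring]

/-- Induction on the number k of undecided indices. A first gap 0 chooses `pos` and uses up one gap;
a positive first gap rejects `pos` and, by memorylessness, is again geometric after it. Hence k gaps
are always enough. -/
lemma lintegral_batch (p : unitInterval) (hp : 0 < p) (n k : ℕ) :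
    ∀ (m pos : ℕ) (F : List (Fin n) → ℝ≥0∞), pos + k = n → k ≤ m →
      ∫⁻ ω, F (batch n (List.ofFn ω) pos) ∂(Measure.pi fun _ : Fin m => geometricMeasure p) =
        sublistE (ENNReal.ofReal p) ((List.finRange n).drop pos) F := by
  induction k with
  | zero =>
    intro m pos F hpos _
    rw [List.drop_of_length_le (by simp; omega)]
    simp only [batch_eq_nil_of_le _ (show n ≤ pos by omega), lintegral_const, measure_univ, mul_one]
    rfl
  | succ k ih =>
    intro m pos F hpos hm
    obtain ⟨m, rfl⟩ : ∃ m', m = m' + 1 := ⟨m - 1, by omega⟩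
    have hlt : pos < n := by omega
    have hmeas : ∀ (l pos : ℕ), Measurable fun ω : Fin l → ℕ => F (batch n (List.ofFn ω) pos) :=
      fun l pos => measurable_of_countable _
    have hfirst : ∀ q : ℕ, ∫⁻ ω, F (batch n (List.ofFn ω) q)
          ∂(Measure.pi fun _ : Fin (m + 1) => geometricMeasure p) =
        ∫⁻ g, ∫⁻ ω, F (batch n (g :: List.ofFn ω) q)
          ∂(Measure.pi fun _ : Fin m => geometricMeasure p) ∂geometricMeasure p := by
      intro q
      rw [lintegral_pi_cons _ _ _ (hmeas _ _)]
      simp only [List.ofFn_cons]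
    rw [hfirst, lintegral_geometric_succ p hp]
    simp only [batch_succ_cons]
    have hdrop : (List.finRange n).drop pos = ⟨pos, hlt⟩ :: (List.finRange n).drop (pos + 1) := by
      rw [List.drop_eq_getElem_cons (by simpa using hlt)]
      simp
    -- After a rejection no gap has been used up, so the induction hypothesis applies with all m + 1
    -- gaps.
    rw [← hfirst, ih (m + 1) (pos + 1) F (by omega) (by omega), hdrop]
    simp only [batch_cons, add_zero, dif_pos hlt, sublistE]
    rw [ih m (pos + 1) (fun L => F (_ :: L)) (by omega) (by omega)]

lemma lintegral_roundBatch (p : unitInterval) (hp : 0 < p) (n : ℕ) (F : List (Fin n) → ℝ≥0∞) :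
    ∫⁻ ω, F (roundBatch ω) ∂(Measure.pi fun _ : Fin (n + 1) => geometricMeasure p) =
      sublistE (ENNReal.ofReal p) (List.finRange n) F :=
  lintegral_batch p hp n n (n + 1) 0 F (zero_add n) n.le_succ

/-! ### The output distribution as a recursion over the rounds -/

instance (θ : Params) : IsProbabilityMeasure (laplace θ.b) := isProbabilityMeasure_laplace θ.b_pos

/-- The joint law of the Laplace and the Gaussian noise of one round. -/
def noiseLaw (d : ℕ) (θ : Params) : Measure (ℝ × (Fin d → ℝ)) :=
  (laplace θ.b).prod (Measure.pi fun _ => gaussianReal 0 (θ.σ ^ 2))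

instance (d : ℕ) (θ : Params) : IsProbabilityMeasure (noiseLaw d θ) := by
  unfold noiseLaw; infer_instance

variable {d n : ℕ}

/-- What happens at the end of a round that starts at `w` and has the mistake count `m`, the
update `u` and the noise `z`: the value is `a` if the round stops, and otherwise `V` at the new
weight vector. -/
def roundValue (t : ℝ) (a : ℝ≥0∞) (V : Vec d → ℝ≥0∞) (w : Vec d) (m : ℝ) (u : Vec d)
    (z : ℝ × (Fin d → ℝ)) : ℝ≥0∞ :=
  if m + z.1 < t then a else V (w + u + WithLp.toLp 2 z.2)

/-- The probability that the output lies in `S` if `j` rounds remain, the weight vector is `w` and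
`t` is the threshold of the stopping rule. -/
def acceptProb (γ' t : ℝ) (θ : Params) (X : Fin n → Sample d) (S : Set (Option (Vec d))) :
    ℕ → Vec d → ℝ≥0∞
  | 0, _ => S.indicator 1 none
  | j + 1, w => sublistE (ENNReal.ofReal θ.p) (List.finRange n) fun L =>
      ∫⁻ z, roundValue t (S.indicator 1 (some (normalized w))) (acceptProb γ' t θ X S j) w
        (mistakeCount γ' X (normalized w) L) (mistakeSum γ' X (normalized w) L) z ∂noiseLaw d θ

lemma ofReal_p_le_one (θ : Params) : ENNReal.ofReal θ.p ≤ 1 :=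
  ENNReal.ofReal_le_one.2 θ.p.2.2

lemma indicator_one_le_one {α : Type*} (S : Set α) (a : α) : S.indicator (1 : α → ℝ≥0∞) a ≤ 1 :=
  Set.indicator_le_self' (fun _ _ => zero_le_one) a

lemma indicator_one_congr {α β : Type*} {A : Set α} {B : Set β} {a : α} {b : β}
    (h : a ∈ A ↔ b ∈ B) : A.indicator (1 : α → ℝ≥0∞) a = B.indicator (1 : β → ℝ≥0∞) b := by
  classical
  simp only [Set.indicator_apply, h, Pi.one_apply]

lemma acceptProb_le_one (γ' t : ℝ) (θ : Params) (X : Fin n → Sample d) (S : Set (Option (Vec d)))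
    (j : ℕ) (w : Vec d) : acceptProb γ' t θ X S j w ≤ 1 := by
  induction j generalizing w with
  | zero => exact indicator_one_le_one _ _
  | succ j ih =>
    refine (sublistE_mono _ fun L => ?_).trans
      (sublistE_const (ofReal_p_le_one θ) (List.finRange n) 1).le
    refine (lintegral_mono (g := fun _ => 1) fun z => ?_).trans (by simp)
    unfold roundValue
    split_ifs
    · exact indicator_one_le_one _ _
    · exact ih _

/-! ### Measurability -/

@[fun_prop] lemma measurable_normalized : Measurable (normalized : Vec d → Vec d) := by
  unfold normalized; fun_prop

lemma int_units_cases (y : ℤˣ) : y = 1 ∨ y = -1 := Int.units_eq_one_or y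

/-- Since sgn 0 = 1, a tie is treated asymmetrically: a point with signed margin exactly γ' is a
mistake only if its label is -1. -/
lemma isMistake_iff (γ' : ℝ) (v : Vec d) (e : Sample d) :
    IsMistake γ' v e ↔
      (e.2 = 1 ∧ inner ℝ v (e.1 : Vec d) < γ') ∨ (e.2 = -1 ∧ -γ' ≤ inner ℝ v (e.1 : Vec d)) := by
  unfold IsMistake sgn
  rcases int_units_cases e.2 with h | h <;> rw [h]
  · simp only [Units.val_one, Int.cast_one, one_mul, sub_nonneg, true_and]
    split_ifs with h' <;> simp [h', not_le.1, not_lt.2]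
  · simp only [Units.val_neg, Units.val_one, Int.cast_neg, Int.cast_one, neg_mul, one_mul,
      sub_neg_eq_add]
    split_ifs with h' <;> simp <;> linarith

lemma measurableSet_isMistake (γ' : ℝ) :
    MeasurableSet {q : Vec d × Sample d | IsMistake γ' q.1 q.2} := by
  have hy : Measurable fun q : Vec d × Sample d => ((q.2.2 : ℤˣ) : ℤ) :=
    (comap_measurable (Units.val : ℤˣ → ℤ)).comp (measurable_snd.comp measurable_snd)
  have hi : Measurable fun q : Vec d × Sample d => inner ℝ q.1 (q.2.1 : Vec d) :=
    measurable_fst.inner (measurable_subtype_coe.comp (measurable_fst.comp measurable_snd))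
  simp only [isMistake_iff, Units.ext_iff]
  exact ((measurableSet_eq_fun hy measurable_const).inter
    (measurableSet_lt hi measurable_const)).union
    ((measurableSet_eq_fun hy measurable_const).inter (measurableSet_le measurable_const hi))

@[fun_prop] lemma measurable_signed : Measurable (signed : Sample d → Vec d) := by
  have hy : Measurable fun q : Sample d => ((q.2 : ℤˣ) : ℤ) :=
    (comap_measurable (Units.val : ℤˣ → ℤ)).comp measurable_snd
  exact ((measurable_from_top (f := fun k : ℤ => (k : ℝ))).comp hy).smul
    (measurable_subtype_coe.comp measurable_fst)

lemma mistakeCount_cons (γ' : ℝ) (X : Fin n → Sample d) (v : Vec d) (j : Fin n)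
    (L : List (Fin n)) : mistakeCount γ' X v (j :: L) =
      (if IsMistake γ' v (X j) then 1 else 0) + mistakeCount γ' X v L := by
  unfold mistakeCount mistakeList
  rw [List.filter_cons]
  split_ifs <;> simp_all [add_comm]

lemma mistakeSum_cons (γ' : ℝ) (X : Fin n → Sample d) (v : Vec d) (j : Fin n)
    (L : List (Fin n)) : mistakeSum γ' X v (j :: L) =
      (if IsMistake γ' v (X j) then signed (X j) else 0) + mistakeSum γ' X v L := by
  unfold mistakeSum mistakeList
  rw [List.filter_cons]
  split_ifs <;> simp_all

lemma measurableSet_isMistake_apply (γ' : ℝ) (j : Fin n) :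
    MeasurableSet {q : (Fin n → Sample d) × Vec d | IsMistake γ' q.2 (q.1 j)} :=
  (measurableSet_isMistake γ').preimage (f := fun q : (Fin n → Sample d) × Vec d => (q.2, q.1 j))
    (measurable_snd.prodMk ((measurable_pi_apply j).comp measurable_fst))

lemma measurable_mistakeCount (γ' : ℝ) (L : List (Fin n)) :
    Measurable fun q : (Fin n → Sample d) × Vec d => mistakeCount γ' q.1 q.2 L := by
  induction L with
  | nil => exact measurable_const (a := ((0 : ℕ) : ℝ))
  | cons j L ih =>
    simp only [mistakeCount_cons]
    exact (Measurable.ite (measurableSet_isMistake_apply γ' j) measurable_const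
      measurable_const).add ih

lemma measurable_mistakeSum (γ' : ℝ) (L : List (Fin n)) :
    Measurable fun q : (Fin n → Sample d) × Vec d => mistakeSum γ' q.1 q.2 L := by
  induction L with
  | nil => exact measurable_const
  | cons j L ih =>
    simp only [mistakeSum_cons]
    refine (Measurable.ite (measurableSet_isMistake_apply γ' j) ?_ measurable_const).add ih
    exact measurable_signed.comp ((measurable_pi_apply j).comp measurable_fst)

lemma measurable_toLp : Measurable (WithLp.toLp 2 : (Fin d → ℝ) → Vec d) :=
  WithLp.measurable_toLp 2 _

lemma measurable_roundValue (γ' t : ℝ) (X : Fin n → Sample d) (L : List (Fin n))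
    {a V : Vec d → ℝ≥0∞} (ha : Measurable a) (hV : Measurable V) :
    Measurable fun q : Vec d × (ℝ × (Fin d → ℝ)) =>
      roundValue t (a q.1) V q.1 (mistakeCount γ' X (normalized q.1) L)
        (mistakeSum γ' X (normalized q.1) L) q.2 := by
  have h1 : Measurable fun q : Vec d × (ℝ × (Fin d → ℝ)) => (X, normalized q.1) :=
    measurable_const.prodMk (measurable_normalized.comp measurable_fst)
  refine Measurable.ite ?_ (ha.comp measurable_fst) (hV.comp ?_)
  · exact measurableSet_lt (((measurable_mistakeCount γ' L).comp h1).add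
      (measurable_fst.comp measurable_snd)) measurable_const
  · exact (measurable_fst.add ((measurable_mistakeSum γ' L).comp h1)).add
      (measurable_toLp.comp (measurable_snd.comp measurable_snd))

lemma measurable_indicator_some {S : Set (Option (Vec d))}
    (hS : MeasurableSet {w : Vec d | some w ∈ S}) :
    Measurable fun w : Vec d => S.indicator (1 : Option (Vec d) → ℝ≥0∞) (some (normalized w)) :=
  (measurable_const.indicator hS (f := fun _ => (1 : ℝ≥0∞))).comp measurable_normalized

lemma measurable_acceptProb (γ' t : ℝ) (θ : Params) (X : Fin n → Sample d)
    {S : Set (Option (Vec d))} (hS : MeasurableSet {w : Vec d | some w ∈ S}) (j : ℕ) :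
    Measurable (acceptProb γ' t θ X S j) := by
  induction j with
  | zero => exact measurable_const
  | succ j ih =>
    refine measurable_sublistE _ _ fun L => ?_
    exact (measurable_roundValue γ' t X L (measurable_indicator_some hS) ih).lintegral_prod_right'

/-- There are only countably many gap vectors, so joint measurability can be checked with the gaps
fixed. -/
lemma measurable_roundBatch_prod {β : Type*} [MeasurableSpace β] {E : Type*} [MeasurableSpace E]
    {f : β → List (Fin n) → E} (hf : ∀ L, Measurable fun b => f b L) :
    Measurable fun q : (Fin (n + 1) → ℕ) × β => f q.2 (roundBatch q.1) :=
  measurable_from_prod_countable_right fun gaps => hf (roundBatch gaps)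

/-- The dataset is included among the variables because learning integrates over the samples as well
as over the coins, which requires joint measurability for Fubini. -/
lemma measurableSet_rounds (α γ' : ℝ) (θ : Params) {S : Set (Option (Vec d))}
    (hS : MeasurableSet {w : Vec d | some w ∈ S}) (j : ℕ) :
    MeasurableSet {q : ((Fin n → Sample d) × Vec d) × (Fin j → RoundCoins d n) |
      (rounds α γ' θ q.1.1 (List.ofFn q.2) q.1.2).val ∈ S} := by
  induction j with
  | zero => simp [rounds]
  | succ j ih =>
    simp only [List.ofFn_succ, rounds_cons_val]
    have hgap : Measurable fun q : ((Fin n → Sample d) × Vec d) × (Fin (j + 1) → RoundCoins d n) =>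
        ((q.2 0).1, (q.1.1, normalized q.1.2)) := by fun_prop
    have hm := (measurable_roundBatch_prod (n := n) (measurable_mistakeCount (d := d) γ')).comp hgap
    have hu := (measurable_roundBatch_prod (n := n) (measurable_mistakeSum (d := d) γ')).comp hgap
    have hA : MeasurableSet {q : ((Fin n → Sample d) × Vec d) × (Fin (j + 1) → RoundCoins d n) |
        mistakeCount γ' q.1.1 (normalized q.1.2) (roundBatch (q.2 0).1) + (q.2 0).2.1 <
          3 / 10 * α * θ.p * n} :=
      measurableSet_lt (hm.add (by fun_prop)) measurable_const
    have hB : MeasurableSet {q : ((Fin n → Sample d) × Vec d) × (Fin (j + 1) → RoundCoins d n) |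
        some (normalized q.1.2) ∈ S} :=
      hS.preimage (f := fun q : ((Fin n → Sample d) × Vec d) × (Fin (j + 1) → RoundCoins d n) =>
        normalized q.1.2) (by fun_prop)
    have hC := ih.preimage (f := fun q : ((Fin n → Sample d) × Vec d) ×
        (Fin (j + 1) → RoundCoins d n) => ((q.1.1, q.1.2 +
          mistakeSum γ' q.1.1 (normalized q.1.2) (roundBatch (q.2 0).1) +
          WithLp.toLp 2 (q.2 0).2.2), fun i : Fin j => q.2 i.succ)) (by
      refine Measurable.prodMk (Measurable.prodMk (by fun_prop) ?_) (by fun_prop)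
      exact ((measurable_snd.comp measurable_fst).add hu).add (measurable_toLp.comp (by fun_prop)))
    convert (hA.inter hB).union (hA.compl.inter hC) using 1
    ext q
    simp only [Set.mem_ofPred_eq, Set.mem_union, Set.mem_inter_iff, Set.mem_compl_iff,
      Set.mem_preimage]
    split_ifs with h <;> simp [h]

/-- The coins of the first round are split off by Fubini. Given them the round either stops with a
known output or restarts from a known vector, and the gaps enter only through the batch, whose law
is `sublistE`. -/
lemma pi_roundLaw_rounds (α γ' : ℝ) (θ : Params) (X : Fin n → Sample d)
    {S : Set (Option (Vec d))} (hS : MeasurableSet {w : Vec d | some w ∈ S}) (j : ℕ) (w : Vec d) :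
    (Measure.pi fun _ : Fin j => roundLaw d n θ)
        {ω | (rounds α γ' θ X (List.ofFn ω) w).val ∈ S} =
      acceptProb γ' (3 / 10 * α * θ.p * n) θ X S j w := by
  have hmeas : ∀ (j : ℕ) (w : Vec d), MeasurableSet {ω : Fin j → RoundCoins d n |
      (rounds α γ' θ X (List.ofFn ω) w).val ∈ S} := fun j w =>
    (measurableSet_rounds α γ' θ hS j).preimage
      (f := fun ω : Fin j → RoundCoins d n => ((X, w), ω)) (by fun_prop)
  induction j generalizing w with
  | zero =>
    simp only [List.ofFn_zero, rounds_nil_val, acceptProb]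
    by_cases h : none ∈ S <;> simp [h]
  | succ j ih =>
    rw [← lintegral_indicator_one (hmeas _ _), lintegral_pi_cons _ _ _
      (measurable_one.indicator (hmeas _ _))]
    have hin : ∀ ω₀ : RoundCoins d n, ∫⁻ ω, {ω : Fin (j + 1) → RoundCoins d n |
          (rounds α γ' θ X (List.ofFn ω) w).val ∈ S}.indicator 1 (Fin.cons ω₀ ω)
            ∂(Measure.pi fun _ : Fin j => roundLaw d n θ) =
        roundValue (3 / 10 * α * θ.p * n) (S.indicator 1 (some (normalized w)))
          (acceptProb γ' (3 / 10 * α * θ.p * n) θ X S j) w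
          (mistakeCount γ' X (normalized w) (roundBatch ω₀.1))
          (mistakeSum γ' X (normalized w) (roundBatch ω₀.1)) ω₀.2 := by
      intro ω₀
      unfold roundValue
      split_ifs with h
      · have : ∀ ω : Fin j → RoundCoins d n, {ω : Fin (j + 1) → RoundCoins d n |
            (rounds α γ' θ X (List.ofFn ω) w).val ∈ S}.indicator (fun _ => (1 : ℝ≥0∞))
              (Fin.cons ω₀ ω) = S.indicator 1 (some (normalized w)) := by
          intro ω
          refine indicator_one_congr ?_
          rw [Set.mem_ofPred_eq, List.ofFn_cons, rounds_cons_val, if_pos h]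
        exact (lintegral_congr this).trans (by simp)
      · rw [← ih, ← lintegral_indicator_one (hmeas _ _)]
        refine lintegral_congr fun ω => ?_
        refine indicator_one_congr ?_
        rw [Set.mem_ofPred_eq, List.ofFn_cons, rounds_cons_val, if_neg h, Set.mem_ofPred_eq]
    simp only [hin]
    have hround := fun L => (measurable_roundValue γ' (3 / 10 * α * θ.p * n) X L
      (measurable_indicator_some hS) (measurable_acceptProb γ' (3 / 10 * α * θ.p * n) θ X hS j))
    rw [acceptProb, ← lintegral_roundBatch θ.p θ.p_pos]
    change ∫⁻ ω₀, _ ∂((Measure.pi fun _ => geometricMeasure θ.p).prod (noiseLaw d θ)) = _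
    rw [lintegral_prod]
    exact (measurable_roundBatch_prod fun L =>
      (hround L).comp (measurable_const.prodMk measurable_id)).aemeasurable

lemma outputProb_dpBatchPerceptron (α γ' : ℝ) (θ : Params) (X : Fin n → Sample d)
    {S : Set (Option (Vec d))} (hS : MeasurableSet {w : Vec d | some w ∈ S}) :
    (dpBatchPerceptron d α γ' θ).outputProb X S =
      acceptProb γ' (3 / 10 * α * θ.p * n) θ X S θ.T 0 := by
  rw [← pi_roundLaw_rounds α γ' θ X hS]
  simp only [Learner.outputProb, dpBatchPerceptron, Timed.val_bind, zeroVec_val]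
  rfl

lemma measurableSet_dpBatchPerceptron (α γ' : ℝ) (θ : Params) {S : Set (Option (Vec d))}
    (hS : MeasurableSet {w : Vec d | some w ∈ S}) :
    MeasurableSet {q : (Fin n → Sample d) × (Fin θ.T → RoundCoins d n) |
      ((dpBatchPerceptron d α γ' θ).run q.1 q.2).val ∈ S} := by
  simp only [dpBatchPerceptron, Timed.val_bind, zeroVec_val]
  exact (measurableSet_rounds α γ' θ hS θ.T).preimage
    (f := fun q : (Fin n → Sample d) × (Fin θ.T → RoundCoins d n) => ((q.1, 0), q.2)) (by fun_prop)

/-! ### Powers of a subsampled likelihood ratio -/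

/-- The remainder of (1 + y)^r after its linear term contains only powers of y of order at least two
with nonnegative coefficients, so replacing y by py gains p². -/
lemma one_add_mul_pow_le_of_nonneg {p y : ℝ} (hp0 : 0 ≤ p) (hp1 : p ≤ 1) (hy : 0 ≤ y) (r : ℕ) :
    (1 + p * y) ^ r - 1 - r * (p * y) ≤ p ^ 2 * ((1 + y) ^ r - 1 - r * y) := by
  induction r with
  | zero => simp
  | succ r ih =>
    have hpos : 0 ≤ (1 + y) ^ r - 1 - r * y := by
      have := one_add_mul_le_pow (show (-2 : ℝ) ≤ y by linarith) r
      linarith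
    have h1 : (1 + p * y) * ((1 + p * y) ^ r - 1 - r * (p * y)) ≤
        (1 + y) * (p ^ 2 * ((1 + y) ^ r - 1 - r * y)) := by
      refine (mul_le_mul_of_nonneg_left ih (by positivity)).trans ?_
      refine mul_le_mul_of_nonneg_right ?_ (by positivity)
      nlinarith
    have e1 : (1 + p * y) ^ (r + 1) - 1 - ((r + 1 : ℕ) : ℝ) * (p * y) =
        (1 + p * y) * ((1 + p * y) ^ r - 1 - r * (p * y)) + r * (p * y) ^ 2 := by
      push_cast; ring
    have e2 : p ^ 2 * ((1 + y) ^ (r + 1) - 1 - ((r + 1 : ℕ) : ℝ) * y) =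
        (1 + y) * (p ^ 2 * ((1 + y) ^ r - 1 - r * y)) + r * (p * y) ^ 2 := by
      push_cast; ring
    rw [e1, e2]
    linarith

/-- Multiplying the quadratic bound by 1 - x ≥ 0 leaves a nonpositive cubic term, which can be
dropped. -/
lemma one_add_mul_pow_le_of_nonpos {x : ℝ} (hx0 : 0 ≤ x) (hx1 : x ≤ 1) (r : ℕ) :
    (1 - x) ^ r ≤ 1 - r * x + r * (r - 1) / 2 * x ^ 2 := by
  induction r with
  | zero => simp
  | succ r ih =>
    have hr : (0 : ℝ) ≤ r * (r - 1) / 2 := by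
      rcases r with _ | r
      · simp
      · push_cast; rw [add_sub_cancel_right]; positivity
    have h1 := mul_le_mul_of_nonneg_right ih (sub_nonneg.2 hx1)
    have h2 : 0 ≤ (r : ℝ) * (r - 1) / 2 * x ^ 3 := by positivity
    rw [pow_succ]
    push_cast
    nlinarith

/-- An upper bound for the `r`-th power of the likelihood ratio `1 - p + p R`, quadratic in `p` up
to a term that is linear in `R - 1`. -/
lemma mixture_pow_le {p R : ℝ} (hp0 : 0 ≤ p) (hp1 : p ≤ 1) (hR : 0 ≤ R) (r : ℕ) :
    (1 + p * (R - 1)) ^ r ≤ 1 + r * p * (R - 1) +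
      p ^ 2 * ((R ^ r - 1 - r * (R - 1)) + r * (r - 1) / 2 * (R - 1) ^ 2) := by
  have hr : (0 : ℝ) ≤ r * (r - 1) / 2 := by
    rcases r with _ | r
    · simp
    · push_cast; rw [add_sub_cancel_right]; positivity
  rcases le_total 1 R with h | h
  · have h1 := one_add_mul_pow_le_of_nonneg hp0 hp1 (sub_nonneg.2 h) r
    rw [add_sub_cancel] at h1
    -- For R ≥ 1 only the Taylor remainder is needed, for R ≤ 1 only the square; the other term is
    -- nonnegative. Their sum is a bound that needs no case distinction under the integral.
    have : 0 ≤ p ^ 2 * (r * (r - 1) / 2 * (R - 1) ^ 2) := by positivity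
    linarith
  · have h1 := one_add_mul_pow_le_of_nonpos (x := p * (1 - R))
      (mul_nonneg hp0 (by linarith)) (by nlinarith) r
    have h2 : 0 ≤ p ^ 2 * (R ^ r - 1 - r * (R - 1)) := by
      have := one_add_mul_le_pow (show (-2 : ℝ) ≤ R - 1 by linarith) r
      rw [add_sub_cancel] at this
      exact mul_nonneg (by positivity) (by linarith)
    have e : 1 + p * (R - 1) = 1 - p * (1 - R) := by ring
    rw [e]
    nlinarith

lemma inv_one_add_mul_pow_le_of_nonneg {x : ℝ} (hx : 0 ≤ x) (r : ℕ) :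
    (1 + x)⁻¹ ^ r ≤ 1 - r * x + r * (r + 1) / 2 * x ^ 2 := by
  induction r with
  | zero => simp
  | succ r ih =>
    have hx1 : 0 < 1 + x := by linarith
    rw [pow_succ, ← div_eq_mul_inv, div_le_iff₀ hx1]
    refine ih.trans ?_
    push_cast
    have : 0 ≤ ((r : ℝ) + 1) * (r + 2) / 2 * x ^ 3 := by positivity
    nlinarith

/-- `key` is a recursion in r for the remainder of (1 + x)^(-r) after its linear term. Passing from
y to py scales its quadratic source by p², and its factor (1 + py)⁻¹ is at most (1 + y)⁻¹ because py
≥ y. -/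
lemma inv_one_add_mul_pow_le_of_nonpos {p y : ℝ} (hp1 : p ≤ 1) (hy0 : y ≤ 0)
    (hy1 : -1 < y) (r : ℕ) :
    (1 + p * y)⁻¹ ^ r - 1 + r * (p * y) ≤ p ^ 2 * ((1 + y)⁻¹ ^ r - 1 + r * y) := by
  have key : ∀ (x : ℝ), 0 < 1 + x → ∀ r : ℕ, (1 + x)⁻¹ ^ (r + 1) - 1 + ((r + 1 : ℕ) : ℝ) * x =
      (1 + x)⁻¹ * (((1 + x)⁻¹ ^ r - 1 + r * x) + (r + 1) * x ^ 2) := by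
    intro x hx r
    have h1 : (1 + x)⁻¹ * (1 + x) = 1 := inv_mul_cancel₀ hx.ne'
    have h2 : (1 + x)⁻¹ * (((1 + x)⁻¹ ^ r - 1 + r * x) + (r + 1) * x ^ 2) =
        (1 + x)⁻¹ ^ (r + 1) + (1 + x)⁻¹ * (1 + x) * ((r + 1) * x - 1) := by ring
    rw [h2, h1]
    push_cast
    ring
  have hx : 0 < 1 + p * y := by nlinarith
  have hy : 0 < 1 + y := by linarith
  have hinv : (1 + p * y)⁻¹ ≤ (1 + y)⁻¹ := inv_anti₀ hy (by nlinarith)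
  have hpos : ∀ r : ℕ, 0 ≤ (1 + y)⁻¹ ^ r - 1 + r * y := by
    intro r
    induction r with
    | zero => simp
    | succ r ih => rw [key y hy]; positivity
  induction r with
  | zero => simp
  | succ r ih =>
    rw [key _ hx, key y hy]
    have h1 : (1 + p * y)⁻¹ ^ r - 1 + r * (p * y) + (r + 1) * (p * y) ^ 2 ≤
        p ^ 2 * (((1 + y)⁻¹ ^ r - 1 + r * y) + (r + 1) * y ^ 2) := by
      nlinarith
    have h2 := hpos r
    calc _ ≤ (1 + p * y)⁻¹ * (p ^ 2 * (((1 + y)⁻¹ ^ r - 1 + r * y) + (r + 1) * y ^ 2)) :=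
          mul_le_mul_of_nonneg_left h1 (by positivity)
      _ ≤ (1 + y)⁻¹ * (p ^ 2 * (((1 + y)⁻¹ ^ r - 1 + r * y) + (r + 1) * y ^ 2)) :=
          mul_le_mul_of_nonneg_right hinv (by positivity)
      _ = _ := by ring

/-- The counterpart of `mixture_pow_le` for the inverse ratio, needed because privacy is claimed in
both directions. -/
lemma mixture_inv_pow_le {p R : ℝ} (hp0 : 0 ≤ p) (hp1 : p ≤ 1) (hR : 0 < R) (r : ℕ) :
    (1 + p * (R - 1))⁻¹ ^ r ≤ 1 - r * p * (R - 1) +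
      p ^ 2 * ((R⁻¹ ^ r - 1 + r * (R - 1)) + r * (r + 1) / 2 * (R - 1) ^ 2) := by
  rcases le_total 1 R with h | h
  · have h1 := inv_one_add_mul_pow_le_of_nonneg (x := p * (R - 1))
      (mul_nonneg hp0 (by linarith)) r
    have h2 : 0 ≤ R⁻¹ ^ r - 1 + r * (R - 1) := by
      have h3 := one_add_mul_le_pow (a := R⁻¹ - 1)
        (by have := inv_pos.2 hR; linarith) r
      rw [add_sub_cancel] at h3
      have h4 : -(R - 1) ≤ R⁻¹ - 1 := by
        have h5 : R⁻¹ * R = 1 := inv_mul_cancel₀ hR.ne'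
        nlinarith [inv_pos.2 hR]
      nlinarith [mul_le_mul_of_nonneg_left h4 (Nat.cast_nonneg (α := ℝ) r)]
    have h3 := mul_nonneg (sq_nonneg p) h2
    nlinarith
  · have h1 := inv_one_add_mul_pow_le_of_nonpos hp1 (sub_nonpos.2 h) (by linarith) r
    rw [add_sub_cancel] at h1
    have : 0 ≤ p ^ 2 * (r * (r + 1) / 2 * (R - 1) ^ 2) := by positivity
    nlinarith

/-! ### Translation of the noise -/

/-- The factor is the ratio of the Laplace densities at x - e and at x. -/
lemma lintegral_laplace_add {b : ℝ} (e : ℝ) {F : ℝ → ℝ≥0∞} (hF : Measurable F) :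
    ∫⁻ x, F (x + e) ∂laplace b =
      ∫⁻ x, ENNReal.ofReal (Real.exp ((|x| - |x - e|) / b)) * F x ∂laplace b := by
  unfold laplace
  rw [lintegral_withDensity_eq_lintegral_mul _ (by fun_prop) (by fun_prop),
    lintegral_withDensity_eq_lintegral_mul _ (by fun_prop) (by fun_prop),
    ← lintegral_sub_right_eq_self _ e]
  refine lintegral_congr fun x => ?_
  simp only [Pi.mul_apply, sub_add_cancel]
  rw [← mul_assoc, ← ENNReal.ofReal_mul' (Real.exp_nonneg _), div_mul_eq_mul_div, ← Real.exp_add]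
  congr 4
  ring

lemma lintegral_gaussianReal_add {v : ℝ≥0} (hv : v ≠ 0) (e : ℝ) {F : ℝ → ℝ≥0∞}
    (hF : Measurable F) :
    ∫⁻ x, F (x + e) ∂gaussianReal 0 v =
      ∫⁻ x, ENNReal.ofReal (Real.exp (e * x / v - e ^ 2 / (2 * v))) * F x ∂gaussianReal 0 v := by
  have h := gaussianReal_map_add_const (μ := 0) (v := v) e
  rw [zero_add] at h
  refine (lintegral_map hF (measurable_id.add_const e)).symm.trans ?_
  change ∫⁻ x, F x ∂((gaussianReal 0 v).map (· + e)) = _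
  rw [h, gaussianReal_of_var_ne_zero _ hv, gaussianReal_of_var_ne_zero _ hv,
    lintegral_withDensity_eq_lintegral_mul _ (measurable_gaussianPDF _ _) hF,
    lintegral_withDensity_eq_lintegral_mul _ (measurable_gaussianPDF _ _) (by fun_prop)]
  refine lintegral_congr fun x => ?_
  have hv' : (v : ℝ) ≠ 0 := by exact_mod_cast hv
  simp only [Pi.mul_apply, gaussianPDF, gaussianPDFReal]
  rw [← mul_assoc, ← ENNReal.ofReal_mul' (Real.exp_nonneg _), mul_assoc (_⁻¹), ← Real.exp_add]
  congr 4
  field_simp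
  ring

/-- The coordinates are independent, so the translation is performed one coordinate at a time and
the exponents add. -/
lemma lintegral_pi_gaussianReal_add {v : ℝ≥0} (hv : v ≠ 0) {d : ℕ} (f : Fin d → ℝ)
    {F : (Fin d → ℝ) → ℝ≥0∞} (hF : Measurable F) :
    ∫⁻ g, F (g + f) ∂(Measure.pi fun _ : Fin d => gaussianReal 0 v) =
      ∫⁻ g, ENNReal.ofReal (Real.exp (∑ k, (f k * g k / v - f k ^ 2 / (2 * v)))) * F g
        ∂(Measure.pi fun _ : Fin d => gaussianReal 0 v) := by
  induction d with
  | zero =>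
    refine lintegral_congr fun g => ?_
    simp [Subsingleton.elim (g + f) g]
  | succ d ih =>
    have hcons := measurable_fin_cons (α := ℝ) d
    rw [lintegral_pi_cons _ _ _ (by fun_prop), lintegral_pi_cons _ _ _ (by fun_prop)]
    have h1 : ∀ a : ℝ, ∫⁻ g, F ((Fin.cons a g : Fin (d + 1) → ℝ) + f)
          ∂(Measure.pi fun _ : Fin d => gaussianReal 0 v) =
        (fun b => ∫⁻ g, ENNReal.ofReal (Real.exp (∑ k : Fin d,
          (f k.succ * g k / v - f k.succ ^ 2 / (2 * v)))) * F (Fin.cons b g)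
            ∂(Measure.pi fun _ : Fin d => gaussianReal 0 v)) (a + f 0) := by
      intro a
      have hm : Measurable fun g : Fin d → ℝ => F (Fin.cons (a + f 0) g) :=
        hF.comp (hcons.comp (measurable_const.prodMk measurable_id))
      refine Eq.trans ?_ (ih (fun k => f k.succ) hm)
      refine lintegral_congr fun g => ?_
      congr 1
      ext k
      refine Fin.cases ?_ (fun k => ?_) k <;> simp
    have hm2 : Measurable fun q : ℝ × (Fin d → ℝ) => ENNReal.ofReal (Real.exp (∑ k : Fin d,
        (f k.succ * q.2 k / v - f k.succ ^ 2 / (2 * v)))) * F (Fin.cons q.1 q.2) :=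
      (by fun_prop : Measurable fun q : ℝ × (Fin d → ℝ) => ENNReal.ofReal (Real.exp (∑ k : Fin d,
        (f k.succ * q.2 k / v - f k.succ ^ 2 / (2 * v))))).mul (hF.comp hcons)
    simp only [h1]
    rw [lintegral_gaussianReal_add hv (f 0) hm2.lintegral_prod_right']
    refine lintegral_congr fun a => ?_
    refine (lintegral_const_mul _ (hm2.comp (measurable_const.prodMk measurable_id))).symm.trans ?_
    refine lintegral_congr fun g => ?_
    simp only [Function.comp_apply, id]
    rw [← mul_assoc, ← ENNReal.ofReal_mul (Real.exp_nonneg _), ← Real.exp_add, Fin.sum_univ_succ]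
    simp

/-- The exponent of the likelihood ratio of the noise translated by `(e, f)`. -/
def noiseExponent {d : ℕ} (θ : Params) (e : ℝ) (f : Fin d → ℝ) (z : ℝ × (Fin d → ℝ)) : ℝ :=
  (|z.1| - |z.1 - e|) / θ.b +
    ∑ k, (f k * z.2 k / (θ.σ : ℝ) ^ 2 - f k ^ 2 / (2 * (θ.σ : ℝ) ^ 2))

@[fun_prop] lemma measurable_noiseExponent {d : ℕ} (θ : Params) (e : ℝ) (f : Fin d → ℝ) :
    Measurable (noiseExponent θ e f) := by
  unfold noiseExponent; fun_prop

lemma lintegral_noiseLaw_add {d : ℕ} (θ : Params) (hσ : θ.σ ≠ 0) (e : ℝ) (f : Fin d → ℝ)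
    {F : ℝ × (Fin d → ℝ) → ℝ≥0∞} (hF : Measurable F) :
    ∫⁻ z, F (z.1 + e, z.2 + f) ∂noiseLaw d θ =
      ∫⁻ z, ENNReal.ofReal (Real.exp (noiseExponent θ e f z)) * F z ∂noiseLaw d θ := by
  have hm : Measurable fun q : ℝ × (Fin d → ℝ) => ENNReal.ofReal (Real.exp (∑ k,
      (f k * q.2 k / ((θ.σ ^ 2 : ℝ≥0) : ℝ) - f k ^ 2 / (2 * ((θ.σ ^ 2 : ℝ≥0) : ℝ))))) * F q := by
    fun_prop
  unfold noiseLaw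
  rw [lintegral_prod _ (by fun_prop), lintegral_prod _ (by fun_prop)]
  have h1 : ∀ x : ℝ, ∫⁻ g, F (x + e, g + f)
        ∂(Measure.pi fun _ : Fin d => gaussianReal 0 (θ.σ ^ 2)) =
      (fun y => ∫⁻ g, ENNReal.ofReal (Real.exp (∑ k,
        (f k * g k / ((θ.σ ^ 2 : ℝ≥0) : ℝ) - f k ^ 2 / (2 * ((θ.σ ^ 2 : ℝ≥0) : ℝ))))) * F (y, g)
          ∂(Measure.pi fun _ : Fin d => gaussianReal 0 (θ.σ ^ 2))) (x + e) := fun x =>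
    lintegral_pi_gaussianReal_add (pow_ne_zero 2 hσ) f (F := fun g => F (x + e, g)) (by fun_prop)
  simp only [h1]
  rw [lintegral_laplace_add e hm.lintegral_prod_right']
  refine lintegral_congr fun x => ?_
  refine (lintegral_const_mul _ (hm.comp (measurable_const.prodMk measurable_id))).symm.trans ?_
  refine lintegral_congr fun g => ?_
  simp only [Function.comp_apply, id, noiseExponent, Real.exp_add, ENNReal.ofReal_mul (Real.exp_nonneg _), NNReal.coe_pow,
    mul_assoc]

/-! ### Moments of the likelihood ratio -/

/-- Here u is a bounded log-likelihood ratio. From ∫ e^u = 1 and e^u = 1 + u + O(u²) it follows that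
-a² ≤ ∫ u ≤ 0. Expanding e^(su) to second order then gives at most 1 + |s| a² + s² a², and |s| ≤ s².
Negative s is allowed, which requires the lower bound on ∫ u. -/
lemma integral_exp_mul_le {Ω : Type*} [MeasurableSpace Ω] {μ : Measure Ω} [IsProbabilityMeasure μ]
    {u : Ω → ℝ} (hu : Measurable u) {a : ℝ} (ha : a ≤ 1) (hua : ∀ x, |u x| ≤ a)
    (h1 : ∫ x, Real.exp (u x) ∂μ = 1) {s : ℝ} (hs : 1 ≤ |s|) (hsa : |s| * a ≤ 1) :
    Integrable (fun x => Real.exp (s * u x)) μ ∧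
      ∫ x, Real.exp (s * u x) ∂μ ≤ 1 + 2 * (s * a) ^ 2 := by
  have hint : ∀ c : ℝ, Integrable (fun x => Real.exp (c * u x)) μ := fun c =>
    Integrable.of_bound (by fun_prop) (Real.exp (|c| * a)) (Filter.Eventually.of_forall fun x => by
      rw [Real.norm_eq_abs, Real.abs_exp, Real.exp_le_exp]
      calc c * u x ≤ |c * u x| := le_abs_self _
        _ = |c| * |u x| := abs_mul _ _
        _ ≤ |c| * a := mul_le_mul_of_nonneg_left (hua x) (abs_nonneg _))
  have huint : Integrable u μ :=
    Integrable.of_bound (by fun_prop) a (Filter.Eventually.of_forall hua)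
  have ha0 : ∀ x, u x ^ 2 ≤ a ^ 2 := fun x => sq_le_sq' (by linarith [(abs_le.1 (hua x)).1])
    (abs_le.1 (hua x)).2
  have hlow : ∫ x, u x ∂μ ≤ 0 := by
    have : ∫ x, (u x + 1) ∂μ ≤ ∫ x, Real.exp (u x) ∂μ :=
      integral_mono (huint.add (integrable_const _)) (by simpa using hint 1)
        fun x => Real.add_one_le_exp _
    rw [integral_add huint (integrable_const _), h1] at this
    simpa using this
  have hup : -a ^ 2 ≤ ∫ x, u x ∂μ := by
    have : ∫ x, Real.exp (u x) ∂μ ≤ ∫ x, (u x + (1 + a ^ 2)) ∂μ :=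
      integral_mono (by simpa using hint 1) (huint.add (integrable_const _)) fun x => by
        have h := (abs_le.1 (Real.abs_exp_sub_one_sub_id_le ((hua x).trans ha))).2
        have := ha0 x
        simp only
        linarith
    rw [integral_add huint (integrable_const _), h1] at this
    simp at this
    linarith
  refine ⟨hint s, ?_⟩
  have : ∫ x, Real.exp (s * u x) ∂μ ≤ ∫ x, (s * u x + (1 + s ^ 2 * a ^ 2)) ∂μ :=
    integral_mono (hint s) ((huint.const_mul s).add (integrable_const _)) fun x => by
      have hb : |s * u x| ≤ 1 := by
        rw [abs_mul]
        exact (mul_le_mul_of_nonneg_left (hua x) (abs_nonneg _)).trans hsa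
      have h := (abs_le.1 (Real.abs_exp_sub_one_sub_id_le hb)).2
      have := mul_le_mul_of_nonneg_left (ha0 x) (sq_nonneg s)
      simp only
      nlinarith
  rw [integral_add (huint.const_mul s) (integrable_const _), integral_const_mul] at this
  simp only [integral_const, probReal_univ, one_smul] at this
  have h2 : s * ∫ x, u x ∂μ ≤ |s| * a ^ 2 := by
    calc s * ∫ x, u x ∂μ ≤ |s * ∫ x, u x ∂μ| := le_abs_self _
      _ = |s| * |∫ x, u x ∂μ| := abs_mul _ _
      _ ≤ |s| * a ^ 2 := mul_le_mul_of_nonneg_left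
          (abs_le.2 ⟨by linarith, by nlinarith⟩) (abs_nonneg _)
  have h3 : |s| * a ^ 2 ≤ s ^ 2 * a ^ 2 := by
    rw [← sq_abs s]
    exact mul_le_mul_of_nonneg_right (by nlinarith) (sq_nonneg a)
  nlinarith

lemma integral_exp_laplaceRatio_le (θ : Params) {e a : ℝ} (ha1 : a ≤ 1) (he : |e| / θ.b ≤ a)
    {s : ℝ} (hs : 1 ≤ |s|) (hsa : |s| * a ≤ 1) :
    Integrable (fun x => Real.exp (s * ((|x| - |x - e|) / θ.b))) (laplace θ.b) ∧
      ∫ x, Real.exp (s * ((|x| - |x - e|) / θ.b)) ∂laplace θ.b ≤ 1 + 2 * (s * a) ^ 2 := by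
  refine integral_exp_mul_le (by fun_prop) ha1 (fun x => ?_) ?_ hs hsa
  · rw [abs_div, abs_of_pos θ.b_pos]
    refine le_trans ?_ he
    refine div_le_div_of_nonneg_right ?_ θ.b_pos.le
    have := abs_abs_sub_abs_le_abs_sub x (x - e)
    simpa using this
  · have h := lintegral_laplace_add (b := θ.b) e (F := fun _ => 1) measurable_const
    simp only [lintegral_const, measure_univ, mul_one] at h
    rw [integral_eq_lintegral_of_nonneg_ae (Filter.Eventually.of_forall fun x => Real.exp_nonneg _)
      (by fun_prop), ← h, ENNReal.toReal_one]

lemma integral_exp_gaussianRatio {d : ℕ} (v : ℝ≥0) (hv : v ≠ 0) (f : Fin d → ℝ) (s : ℝ) :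
    Integrable (fun g : Fin d → ℝ => Real.exp (s * ∑ k, (f k * g k / v - f k ^ 2 / (2 * v))))
        (Measure.pi fun _ : Fin d => gaussianReal 0 v) ∧
      ∫ g : Fin d → ℝ, Real.exp (s * ∑ k, (f k * g k / v - f k ^ 2 / (2 * v)))
        ∂(Measure.pi fun _ : Fin d => gaussianReal 0 v) =
      Real.exp ((s ^ 2 - s) * (∑ k, f k ^ 2) / (2 * v)) := by
  have hv' : (v : ℝ) ≠ 0 := by exact_mod_cast hv
  have e1 : (fun g : Fin d → ℝ => Real.exp (s * ∑ k, (f k * g k / v - f k ^ 2 / (2 * v)))) =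
      fun g => ∏ k, (Real.exp (-(s * f k ^ 2 / (2 * v))) * Real.exp (s * f k / v * g k)) := by
    funext g
    simp only [← Real.exp_add]
    rw [← Real.exp_sum, Finset.mul_sum]
    congr 1
    refine Finset.sum_congr rfl fun k _ => ?_
    ring
  have hint : ∀ k : Fin d, Integrable (fun x => Real.exp (-(s * f k ^ 2 / (2 * v))) *
      Real.exp (s * f k / v * x)) (gaussianReal 0 v) := fun k =>
    (integrable_exp_mul_gaussianReal _).const_mul _
  rw [e1]
  refine ⟨Integrable.fintype_prod (f := fun (k : Fin d) (x : ℝ) =>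
    Real.exp (-(s * f k ^ 2 / (2 * v))) * Real.exp (s * f k / v * x)) hint, ?_⟩
  rw [integral_fintype_prod_eq_prod (fun (k : Fin d) (x : ℝ) =>
    Real.exp (-(s * f k ^ 2 / (2 * v))) * Real.exp (s * f k / v * x)), Finset.mul_sum,
    Finset.sum_div, Real.exp_sum]
  refine Finset.prod_congr rfl fun k _ => ?_
  rw [integral_const_mul]
  have := congrFun (mgf_fun_id_gaussianReal (μ := 0) (v := v)) (s * f k / v)
  rw [mgf] at this
  rw [this, ← Real.exp_add]
  congr 1
  field_simp
  ring

lemma integral_exp_noiseExponent_le {d : ℕ} (θ : Params) (hσ : θ.σ ≠ 0) {e a : ℝ} {f : Fin d → ℝ}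
    (ha1 : a ≤ 1) (he : |e| / θ.b ≤ a) {s : ℝ} (hs : 1 ≤ |s|) (hsa : |s| * a ≤ 1) :
    Integrable (fun z => Real.exp (s * noiseExponent θ e f z)) (noiseLaw d θ) ∧
      ∫ z, Real.exp (s * noiseExponent θ e f z) ∂noiseLaw d θ ≤
        (1 + 2 * (s * a) ^ 2) * Real.exp ((s ^ 2 - s) * (∑ k, f k ^ 2) / (2 * (θ.σ : ℝ) ^ 2)) := by
  obtain ⟨hl, hl'⟩ := integral_exp_laplaceRatio_le θ ha1 he hs hsa
  obtain ⟨hg, hg'⟩ := integral_exp_gaussianRatio (θ.σ ^ 2) (pow_ne_zero 2 hσ) f s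
  rw [NNReal.coe_pow] at hg hg'
  have e1 : (fun z : ℝ × (Fin d → ℝ) => Real.exp (s * noiseExponent θ e f z)) =
      fun z => Real.exp (s * ((|z.1| - |z.1 - e|) / θ.b)) *
        Real.exp (s * ∑ k, (f k * z.2 k / (θ.σ : ℝ) ^ 2 - f k ^ 2 / (2 * (θ.σ : ℝ) ^ 2))) := by
    funext z
    rw [noiseExponent, mul_add, Real.exp_add]
  rw [e1]
  unfold noiseLaw
  refine ⟨hl.mul_prod hg, ?_⟩
  rw [integral_prod_mul (fun x => Real.exp (s * ((|x| - |x - e|) / θ.b))) (fun g : Fin d → ℝ =>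
    Real.exp (s * ∑ k, (f k * g k / (θ.σ : ℝ) ^ 2 - f k ^ 2 / (2 * (θ.σ : ℝ) ^ 2)))), hg']
  exact mul_le_mul_of_nonneg_right hl' (Real.exp_nonneg _)

/-! ### Moments of the subsampled likelihood ratio -/

section Mixture

variable {Ω : Type*} [MeasurableSpace Ω] {μ : Measure Ω} [IsProbabilityMeasure μ] {R : Ω → ℝ}
  {p : ℝ} {r : ℕ}

lemma one_add_mul_sub_one_pos {p x : ℝ} (hp0 : 0 ≤ p) (hp1 : p ≤ 1) (hx : 0 < x) :
    0 < 1 + p * (x - 1) := by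
  rcases hp0.eq_or_lt with rfl | h
  · simp
  · nlinarith [mul_pos h hx]

/-- As R has mean 1, everything linear in R - 1 integrates to zero and ∫ (R - 1)² = ∫ R² - 1. What
remains beyond 1 is at most p² (1/4 + 1/2). -/
lemma lintegral_ofReal_le_of_quadratic {F G : Ω → ℝ} {k l c : ℝ} (hF : ∀ x, 0 ≤ F x)
    (h : ∀ x, F x ≤ 1 + k * (R x - 1) + p ^ 2 * ((G x - 1 + l * (R x - 1)) + c * (R x - 1) ^ 2))
    (h1 : Integrable R μ) (h2 : Integrable (fun x => R x ^ 2) μ) (hG : Integrable G μ)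
    (i1 : ∫ x, R x ∂μ = 1) (i2 : c * (∫ x, R x ^ 2 ∂μ - 1) ≤ 1 / 2) (iG : ∫ x, G x ∂μ ≤ 5 / 4) :
    ∫⁻ x, ENNReal.ofReal (F x) ∂μ ≤ ENNReal.ofReal (1 + p ^ 2) := by
  set a₀ : ℝ := 1 - k - p ^ 2 - p ^ 2 * l + p ^ 2 * c
  set a₁ : ℝ := k + p ^ 2 * l - 2 * p ^ 2 * c
  have e : ∀ x, 1 + k * (R x - 1) + p ^ 2 * ((G x - 1 + l * (R x - 1)) + c * (R x - 1) ^ 2) =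
      a₀ + a₁ * R x + p ^ 2 * G x + p ^ 2 * c * R x ^ 2 := fun x => by
    simp only [a₀, a₁]; ring
  have j1 : Integrable (fun x => a₀ + a₁ * R x) μ := (integrable_const _).add (h1.const_mul _)
  have j2 : Integrable (fun x => a₀ + a₁ * R x + p ^ 2 * G x) μ := j1.add (hG.const_mul _)
  have j3 : Integrable (fun x => a₀ + a₁ * R x + p ^ 2 * G x + p ^ 2 * c * R x ^ 2) μ :=
    j2.add (h2.const_mul _)
  calc ∫⁻ x, ENNReal.ofReal (F x) ∂μ
      ≤ ∫⁻ x, ENNReal.ofReal (a₀ + a₁ * R x + p ^ 2 * G x + p ^ 2 * c * R x ^ 2) ∂μ :=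
        lintegral_mono fun x => ENNReal.ofReal_le_ofReal ((h x).trans (e x).le)
    _ = ENNReal.ofReal (∫ x, (a₀ + a₁ * R x + p ^ 2 * G x + p ^ 2 * c * R x ^ 2) ∂μ) := by
        rw [ofReal_integral_eq_lintegral_ofReal j3]
        exact Filter.Eventually.of_forall fun x => (hF x).trans ((h x).trans (e x).le)
    _ ≤ ENNReal.ofReal (1 + p ^ 2) := by
        refine ENNReal.ofReal_le_ofReal ?_
        rw [integral_add j2 (h2.const_mul _), integral_add j1 (hG.const_mul _),
          integral_add (integrable_const _) (h1.const_mul _), integral_const_mul,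
          integral_const_mul, integral_const_mul, i1]
        simp only [integral_const, probReal_univ, one_smul, a₀, a₁]
        nlinarith [mul_le_mul_of_nonneg_left i2 (sq_nonneg p),
          mul_le_mul_of_nonneg_left iG (sq_nonneg p), sq_nonneg p]

lemma lintegral_mixture_pow_le (hR : ∀ x, 0 < R x) (hp0 : 0 ≤ p) (hp1 : p ≤ 1)
    (h1 : Integrable R μ) (h2 : Integrable (fun x => R x ^ 2) μ)
    (hr : Integrable (fun x => R x ^ r) μ) (i1 : ∫ x, R x ∂μ = 1)
    (i2 : (r : ℝ) * (r - 1) / 2 * (∫ x, R x ^ 2 ∂μ - 1) ≤ 1 / 2)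
    (ir : ∫ x, R x ^ r ∂μ ≤ 5 / 4) :
    ∫⁻ x, ENNReal.ofReal (1 + p * (R x - 1)) ^ r ∂μ ≤ ENNReal.ofReal (1 + p ^ 2) := by
  have hpos := fun x => one_add_mul_sub_one_pos hp0 hp1 (hR x)
  simp only [← ENNReal.ofReal_pow (hpos _).le]
  refine lintegral_ofReal_le_of_quadratic (k := r * p) (l := -r) (c := r * (r - 1) / 2)
    (fun x => pow_nonneg (hpos x).le r) (fun x => ?_) h1 h2 hr i1 i2 ir
  exact (mixture_pow_le hp0 hp1 (hR x).le r).trans (le_of_eq (by ring))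

lemma lintegral_mixture_inv_pow_le (hR : ∀ x, 0 < R x) (hp0 : 0 ≤ p)
    (hp1 : p ≤ 1) (h1 : Integrable R μ) (h2 : Integrable (fun x => R x ^ 2) μ)
    (hr : Integrable (fun x => (R x)⁻¹ ^ r) μ) (i1 : ∫ x, R x ∂μ = 1)
    (i2 : (r : ℝ) * (r + 1) / 2 * (∫ x, R x ^ 2 ∂μ - 1) ≤ 1 / 2)
    (ir : ∫ x, (R x)⁻¹ ^ r ∂μ ≤ 5 / 4) :
    ∫⁻ x, ENNReal.ofReal (1 + p * (R x - 1))⁻¹ ^ r ∂μ ≤ ENNReal.ofReal (1 + p ^ 2) := by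
  have hpos := fun x => one_add_mul_sub_one_pos hp0 hp1 (hR x)
  simp only [← ENNReal.ofReal_pow (inv_pos.2 (hpos _)).le]
  refine lintegral_ofReal_le_of_quadratic (k := -(r * p)) (l := r) (c := r * (r + 1) / 2)
    (fun x => pow_nonneg (inv_pos.2 (hpos x)).le r) (fun x => ?_) h1 h2 hr i1 i2 ir
  exact (mixture_inv_pow_le hp0 hp1 (hR x) r).trans (le_of_eq (by ring))

end Mixture

/-- The noise levels are large enough for Rényi divergences of order `r`. -/
structure Params.Noisy (θ : Params) (r : ℕ) : Prop where
  two_le : 2 ≤ r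
  le_b : 4 * (r : ℝ) ≤ θ.b
  le_σ : 4 * (r : ℝ) ≤ θ.σ

section Ratio

variable {d : ℕ} {θ : Params} {r : ℕ}

lemma Params.Noisy.two_le_cast (hθ : θ.Noisy r) : (2 : ℝ) ≤ r := by exact_mod_cast hθ.two_le

lemma Params.Noisy.σ_ne_zero (hθ : θ.Noisy r) : θ.σ ≠ 0 := by
  have h1 := hθ.le_σ
  have h2 := hθ.two_le_cast
  intro h
  rw [h, NNReal.coe_zero] at h1
  linarith

lemma integral_exp_noiseExponent (hσ : θ.σ ≠ 0) (e : ℝ) (f : Fin d → ℝ) :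
    ∫ z, Real.exp (noiseExponent θ e f z) ∂noiseLaw d θ = 1 := by
  have h := lintegral_noiseLaw_add θ hσ e f (F := fun _ => 1) measurable_const
  simp only [lintegral_const, measure_univ, mul_one] at h
  rw [integral_eq_lintegral_of_nonneg_ae (Filter.Eventually.of_forall fun x => Real.exp_nonneg _)
    (by fun_prop), ← h, ENNReal.toReal_one]

/-- The moment bounds for the likelihood ratio of a translation by `(e, f)` with `|e| ≤ 1` and
`‖f‖ ≤ 1`. -/
lemma Params.Noisy.integral_exp_mul_le (hθ : θ.Noisy r) {e : ℝ} {f : Fin d → ℝ} (he : |e| ≤ 1)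
    (hf : ∑ k, f k ^ 2 ≤ 1) {s : ℝ} (hs : 1 ≤ |s|) (hsr : |s| ≤ r) (hsr' : s ^ 2 - s ≤ r ^ 2) :
    Integrable (fun z => Real.exp (s * noiseExponent θ e f z)) (noiseLaw d θ) ∧
      ∫ z, Real.exp (s * noiseExponent θ e f z) ∂noiseLaw d θ ≤ 5 / 4 := by
  have hr := hθ.two_le_cast
  have hr0 : (0 : ℝ) < 4 * r := by linarith
  have hs2 : 0 ≤ s ^ 2 - s := by
    rw [← sq_abs]; nlinarith [le_abs_self s]
  obtain ⟨h1, h2⟩ := integral_exp_noiseExponent_le θ hθ.σ_ne_zero (e := e) (f := f)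
    (a := 1 / (4 * r)) (by rw [div_le_one hr0]; linarith)
    (div_le_div₀ zero_le_one he hr0 hθ.le_b) hs (by rw [mul_one_div, div_le_one hr0]; linarith)
  refine ⟨h1, h2.trans ?_⟩
  -- At noise level 4r the Laplace factor is at most 1 + 2/16 = 9/8 and the Gaussian factor at most
  -- e^(1/32) ≤ 10/9; their product is 5/4.
  have h3 : (s * (1 / (4 * r))) ^ 2 ≤ 1 / 16 := by
    rw [mul_pow, div_pow, one_pow, mul_one_div, div_le_iff₀ (by positivity), ← sq_abs]
    nlinarith [abs_nonneg s]
  have h4 : (s ^ 2 - s) * (∑ k, f k ^ 2) / (2 * (θ.σ : ℝ) ^ 2) ≤ 1 / 32 := by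
    have hσ : (4 * (r : ℝ)) ^ 2 ≤ (θ.σ : ℝ) ^ 2 := pow_le_pow_left₀ hr0.le hθ.le_σ 2
    rw [div_le_iff₀ (by nlinarith)]
    nlinarith [mul_le_mul_of_nonneg_left hf hs2]
  have h5 : Real.exp ((s ^ 2 - s) * (∑ k, f k ^ 2) / (2 * (θ.σ : ℝ) ^ 2)) ≤ 10 / 9 := by
    refine (Real.exp_le_exp.2 h4).trans ?_
    have := (abs_le.1 (Real.abs_exp_sub_one_sub_id_le (x := 1 / 32) (by norm_num [abs_le]))).2
    norm_num at this ⊢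
    linarith
  calc _ ≤ (1 + 2 * (1 / 16)) * (10 / 9 : ℝ) := by gcongr
    _ = 5 / 4 := by norm_num

/-- The second moment is needed more sharply than the others: in the quadratic bounds (R - 1)² has a
coefficient of order r², so the variance of R must be at most 1/r². -/
lemma Params.Noisy.integral_exp_two_mul_le (hθ : θ.Noisy r) {e : ℝ} {f : Fin d → ℝ}
    (he : |e| ≤ 1) (hf : ∑ k, f k ^ 2 ≤ 1) :
    Integrable (fun z => Real.exp (2 * noiseExponent θ e f z)) (noiseLaw d θ) ∧
      (r : ℝ) ^ 2 * (∫ z, Real.exp (2 * noiseExponent θ e f z) ∂noiseLaw d θ - 1) ≤ 1 := by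
  have hr := hθ.two_le_cast
  have hr0 : (0 : ℝ) < 4 * r := by linarith
  obtain ⟨h1, h2⟩ := integral_exp_noiseExponent_le θ hθ.σ_ne_zero (e := e) (f := f)
    (a := 1 / (4 * r)) (s := 2) (by rw [div_le_one hr0]; linarith)
    (div_le_div₀ zero_le_one he hr0 hθ.le_b) (by norm_num)
    (by rw [mul_one_div, div_le_one hr0]; norm_num; linarith)
  refine ⟨h1, ?_⟩
  set x : ℝ := 1 / (r : ℝ) ^ 2 with hx
  have hxr : (r : ℝ) ^ 2 * x = 1 := mul_one_div_cancel (by positivity)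
  have hx0 : 0 ≤ x := by positivity
  have hx1 : x ≤ 1 := by
    rw [hx, div_le_one (by positivity)]; nlinarith
  have h3 : 2 * (2 * (1 / (4 * (r : ℝ)))) ^ 2 = x / 2 := by
    rw [hx]; field_simp; norm_num
  have h4 : ((2 : ℝ) ^ 2 - 2) * (∑ k, f k ^ 2) / (2 * (θ.σ : ℝ) ^ 2) ≤ x / 16 := by
    have hσ : (4 * (r : ℝ)) ^ 2 ≤ (θ.σ : ℝ) ^ 2 := pow_le_pow_left₀ hr0.le hθ.le_σ 2
    rw [div_le_iff₀ (by nlinarith)]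
    nlinarith [mul_le_mul_of_nonneg_left hσ hx0]
  have h5 : Real.exp (((2 : ℝ) ^ 2 - 2) * (∑ k, f k ^ 2) / (2 * (θ.σ : ℝ) ^ 2)) ≤ 1 + x / 8 := by
    refine (Real.exp_le_exp.2 h4).trans ?_
    have := (abs_le.1 (Real.abs_exp_sub_one_sub_id_le (x := x / 16)
      (by rw [abs_of_nonneg (by positivity)]; linarith))).2
    nlinarith
  rw [h3] at h2
  have h6 : ∫ z, Real.exp (2 * noiseExponent θ e f z) ∂noiseLaw d θ - 1 ≤ x := by
    have : (1 + x / 2) * Real.exp (((2 : ℝ) ^ 2 - 2) * (∑ k, f k ^ 2) / (2 * (θ.σ : ℝ) ^ 2)) ≤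
        (1 + x / 2) * (1 + x / 8) := by gcongr
    nlinarith
  calc _ ≤ (r : ℝ) ^ 2 * x := by gcongr
    _ = 1 := hxr

lemma exp_natCast_mul (x : ℝ) (k : ℕ) : Real.exp x ^ k = Real.exp (k * x) := (Real.exp_nat_mul x k).symm

lemma exp_inv_pow (x : ℝ) (k : ℕ) : (Real.exp x)⁻¹ ^ k = Real.exp (-k * x) := by
  rw [← Real.exp_neg, ← Real.exp_nat_mul]; congr 1; ring

/-- The moments of the likelihood ratio of the noise subsampled with rate `p`. -/
lemma Params.Noisy.lintegral_mixture (hθ : θ.Noisy r) {e : ℝ} {f : Fin d → ℝ} (he : |e| ≤ 1)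
    (hf : ∑ k, f k ^ 2 ≤ 1) {p : ℝ} (hp0 : 0 ≤ p) (hp1 : p ≤ 1) :
    ∫⁻ z, ENNReal.ofReal (1 + p * (Real.exp (noiseExponent θ e f z) - 1)) ^ r ∂noiseLaw d θ ≤
        ENNReal.ofReal (1 + p ^ 2) ∧
      ∫⁻ z, ENNReal.ofReal (1 + p * (Real.exp (noiseExponent θ e f z) - 1))⁻¹ ^ (r - 1)
        ∂noiseLaw d θ ≤ ENNReal.ofReal (1 + p ^ 2) := by
  have hr := hθ.two_le_cast
  have hcast : ((r - 1 : ℕ) : ℝ) = r - 1 := by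
    rw [Nat.cast_sub (by have := hθ.two_le; omega), Nat.cast_one]
  have i1 := integral_exp_noiseExponent (θ := θ) hθ.σ_ne_zero e f
  have h1 : Integrable (fun z => Real.exp (noiseExponent θ e f z)) (noiseLaw d θ) := by
    by_contra hc
    rw [integral_undef hc] at i1
    exact zero_ne_one i1
  obtain ⟨h2, i2⟩ := hθ.integral_exp_two_mul_le he hf
  -- The variance is nonnegative, which allows the coefficient r (r - 1)/2 to be enlarged to r²/2.
  have i2' : 1 ≤ ∫ z, Real.exp (2 * noiseExponent θ e f z) ∂noiseLaw d θ := by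
    have : 0 ≤ ∫ z, (Real.exp (noiseExponent θ e f z) - 1) ^ 2 ∂noiseLaw d θ :=
      integral_nonneg fun z => sq_nonneg _
    have e1 : (fun z => (Real.exp (noiseExponent θ e f z) - 1) ^ 2) = fun z =>
        Real.exp (2 * noiseExponent θ e f z) - (2 * Real.exp (noiseExponent θ e f z) - 1) := by
      funext z
      rw [two_mul, Real.exp_add]; ring
    have j : Integrable (fun z => 2 * Real.exp (noiseExponent θ e f z) - 1) (noiseLaw d θ) :=
      (h1.const_mul 2).sub (integrable_const _)
    rw [e1, integral_sub h2 j,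
      integral_sub (h1.const_mul 2) (integrable_const _), integral_const_mul, i1] at this
    simp at this
    linarith
  have e2 : (fun z => Real.exp (noiseExponent θ e f z) ^ 2) = fun z =>
      Real.exp (2 * noiseExponent θ e f z) := by
    funext z; rw [exp_natCast_mul]; norm_num
  constructor
  · obtain ⟨h3, i3⟩ := hθ.integral_exp_mul_le he hf (s := r) (by rw [abs_of_nonneg] <;> linarith)
      (by rw [abs_of_nonneg]; linarith) (by nlinarith)
    refine lintegral_mixture_pow_le (fun z => Real.exp_pos _) hp0 hp1 h1 (by rwa [e2])
      (by simpa only [exp_natCast_mul] using h3) i1 (by rw [e2]; nlinarith)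
      (by simpa only [exp_natCast_mul] using i3)
  -- For s = -(r - 1) one has s² - s = r (r - 1), which is still at most r².
  · obtain ⟨h3, i3⟩ := hθ.integral_exp_mul_le he hf (s := -((r - 1 : ℕ) : ℝ))
      (by rw [abs_neg, hcast, abs_of_nonneg] <;> linarith)
      (by rw [abs_neg, hcast, abs_of_nonneg] <;> linarith) (by rw [hcast]; nlinarith)
    refine lintegral_mixture_inv_pow_le (fun z => Real.exp_pos _) hp0 hp1 h1 (by rwa [e2])
      (by simpa only [exp_inv_pow] using h3) i1 (by rw [e2, hcast]; nlinarith)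
      (by simpa only [exp_inv_pow] using i3)

/-- A change of the threshold acts in every round, without subsampling. The factor p² comes instead
from the size of the shift, since the log-ratio is bounded by p/(4r). -/
lemma Params.Noisy.lintegral_shift (hθ : θ.Noisy r) {e p : ℝ} (he : |e| ≤ p) (hp1 : p ≤ 1) :
    ∫⁻ z, ENNReal.ofReal (Real.exp (noiseExponent θ e (0 : Fin d → ℝ) z)) ^ r ∂noiseLaw d θ ≤
      ENNReal.ofReal (1 + p ^ 2) := by
  have hr := hθ.two_le_cast
  have hr0 : (0 : ℝ) < 4 * r := by linarith
  have hp0 : 0 ≤ p := (abs_nonneg e).trans he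
  obtain ⟨h1, h2⟩ := integral_exp_noiseExponent_le θ hθ.σ_ne_zero (e := e) (f := (0 : Fin d → ℝ))
    (a := p / (4 * r)) (s := r) (by rw [div_le_one hr0]; linarith)
    (div_le_div₀ hp0 he hr0 hθ.le_b) (by rw [abs_of_nonneg] <;> linarith)
    (by rw [abs_of_nonneg (by linarith), mul_div_assoc', div_le_one hr0]; nlinarith)
  simp only [← ENNReal.ofReal_pow (Real.exp_nonneg _), exp_natCast_mul]
  rw [← ofReal_integral_eq_lintegral_ofReal h1
    (Filter.Eventually.of_forall fun z => Real.exp_nonneg _)]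
  refine ENNReal.ofReal_le_ofReal (h2.trans ?_)
  have e1 : (r : ℝ) * (p / (4 * r)) = p / 4 := by field_simp
  rw [e1]
  simp
  nlinarith

end Ratio

/-! ### Privacy -/

section Holder

variable {Ω : Type*} [MeasurableSpace Ω] {μ : Measure Ω} {r : ℕ}

/-- Hölder's inequality with exponents r and r/(r - 1): changing the measure by the density ρ costs
the r-th moment of ρ. -/
lemma lintegral_mul_rpow_le (hr : 2 ≤ r) {ρ F : Ω → ℝ≥0∞} (hρ : Measurable ρ)
    (hF : Measurable F) :
    ∫⁻ x, ρ x * F x ^ (1 - 1 / (r : ℝ)) ∂μ ≤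
      (∫⁻ x, ρ x ^ r ∂μ) ^ (1 / (r : ℝ)) * (∫⁻ x, F x ∂μ) ^ (1 - 1 / (r : ℝ)) := by
  have hr' : (2 : ℝ) ≤ r := by exact_mod_cast hr
  have hs : 0 < 1 - 1 / (r : ℝ) := by
    rw [sub_pos, div_lt_one (by linarith)]; linarith
  have hpq : (r : ℝ).HolderConjugate (1 - 1 / (r : ℝ))⁻¹ :=
    Real.holderConjugate_iff.2 ⟨by linarith, by rw [inv_inv]; ring⟩
  have h := ENNReal.lintegral_mul_le_Lp_mul_Lq μ hpq (f := ρ)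
    (g := fun x => F x ^ (1 - 1 / (r : ℝ))) hρ.aemeasurable (by fun_prop)
  simp only [← ENNReal.rpow_mul, mul_inv_cancel₀ hs.ne', ENNReal.rpow_one, ENNReal.rpow_natCast,
    one_div (1 - 1 / (r : ℝ))⁻¹, inv_inv] at h
  exact h

/-- The same with the measures exchanged: split F^(1 - 1/r) as (1/ρ)^(1 - 1/r) (ρF)^(1 - 1/r). Since
r (1 - 1/r) = r - 1, the moment of 1/ρ that enters has order r - 1. -/
lemma lintegral_rpow_le_of_density (hr : 2 ≤ r) {ρ : Ω → ℝ} (hρ : Measurable ρ)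
    (hpos : ∀ x, 0 < ρ x) {F : Ω → ℝ≥0∞} (hF : Measurable F) :
    ∫⁻ x, F x ^ (1 - 1 / (r : ℝ)) ∂μ ≤
      (∫⁻ x, ENNReal.ofReal (ρ x)⁻¹ ^ (r - 1) ∂μ) ^ (1 / (r : ℝ)) *
        (∫⁻ x, ENNReal.ofReal (ρ x) * F x ∂μ) ^ (1 - 1 / (r : ℝ)) := by
  have hr' : (2 : ℝ) ≤ r := by exact_mod_cast hr
  have hs : 0 < 1 - 1 / (r : ℝ) := by
    rw [sub_pos, div_lt_one (by linarith)]; linarith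
  have h := lintegral_mul_rpow_le (μ := μ) hr
    (ρ := fun x => ENNReal.ofReal (ρ x)⁻¹ ^ (1 - 1 / (r : ℝ)))
    (F := fun x => ENNReal.ofReal (ρ x) * F x) (by fun_prop) (by fun_prop)
  have e1 : ∀ x, ENNReal.ofReal (ρ x)⁻¹ ^ (1 - 1 / (r : ℝ)) *
      (ENNReal.ofReal (ρ x) * F x) ^ (1 - 1 / (r : ℝ)) = F x ^ (1 - 1 / (r : ℝ)) := by
    intro x
    rw [← ENNReal.mul_rpow_of_nonneg _ _ hs.le, ← mul_assoc,
      ← ENNReal.ofReal_mul (inv_pos.2 (hpos x)).le, inv_mul_cancel₀ (hpos x).ne',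
      ENNReal.ofReal_one, one_mul]
  have e2 : ∀ x, (ENNReal.ofReal (ρ x)⁻¹ ^ (1 - 1 / (r : ℝ))) ^ r =
      ENNReal.ofReal (ρ x)⁻¹ ^ (r - 1) := by
    intro x
    rw [← ENNReal.rpow_natCast, ← ENNReal.rpow_mul, ← ENNReal.rpow_natCast,
      Nat.cast_sub (by omega), Nat.cast_one]
    congr 1
    field_simp
  simp only [e1, e2] at h
  exact h

end Holder

/-- Closeness in the Rényi sense of order `r` implies closeness in the sense of differential
privacy. -/
lemma le_exp_mul_add_of_renyi {r : ℕ} (hr : 2 ≤ r) {x y : ℝ≥0∞} (hx1 : x ≤ 1) (hy1 : y ≤ 1)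
    {ε δ : ℝ} (hδ : 0 < δ) (hε : 1 + Real.log (1 / δ) ≤ (r - 1) * ε)
    (h : x ≤ ENNReal.ofReal (Real.exp 1) ^ (1 / (r : ℝ)) * y ^ (1 - 1 / (r : ℝ))) :
    x ≤ ENNReal.ofReal (Real.exp ε) * y + ENNReal.ofReal δ := by
  lift x to ℝ≥0 using (hx1.trans_lt ENNReal.one_lt_top).ne
  lift y to ℝ≥0 using (hy1.trans_lt ENNReal.one_lt_top).ne
  have hr' : (2 : ℝ) ≤ r := by exact_mod_cast hr
  have hcast : ((r - 1 : ℕ) : ℝ) = r - 1 := by rw [Nat.cast_sub (by omega), Nat.cast_one]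
  have hs : 0 < 1 - 1 / (r : ℝ) := by
    rw [sub_pos, div_lt_one (by linarith)]; linarith
  have h1 : ((x : ℝ≥0∞)) ^ r ≤ ENNReal.ofReal (Real.exp 1) * (y : ℝ≥0∞) ^ (r - 1) := by
    have h2 := pow_le_pow_left' h r
    rw [mul_pow, ← ENNReal.rpow_natCast (_ ^ (1 / (r : ℝ))), ← ENNReal.rpow_mul,
      one_div_mul_cancel (by positivity), ENNReal.rpow_one, ← ENNReal.rpow_natCast (_ ^ (1 - _)),
      ← ENNReal.rpow_mul] at h2
    have e : (1 - 1 / (r : ℝ)) * r = ((r - 1 : ℕ) : ℝ) := by rw [hcast]; field_simp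
    rwa [e, ENNReal.rpow_natCast] at h2
  have h2 : (x : ℝ) ^ r ≤ Real.exp 1 * (y : ℝ) ^ (r - 1) := by
    have e1 : (x : ℝ≥0∞) = ENNReal.ofReal x := (ENNReal.ofReal_coe_nnreal).symm
    have e2 : (y : ℝ≥0∞) = ENNReal.ofReal y := (ENNReal.ofReal_coe_nnreal).symm
    rw [e1, e2, ← ENNReal.ofReal_pow x.coe_nonneg, ← ENNReal.ofReal_pow y.coe_nonneg,
      ← ENNReal.ofReal_mul (Real.exp_nonneg _)] at h1
    exact (ENNReal.ofReal_le_ofReal_iff (by positivity)).1 h1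
  have h3 : (x : ℝ) ≤ Real.exp ε * y + δ := by
    -- If x ≤ δ there is nothing to show. Otherwise δ x^(r-1) ≤ x^r ≤ e y^(r-1), and an (r-1)-st
    -- root can be taken because the hypothesis on ε says e/δ ≤ e^((r-1)ε).
    rcases le_or_gt (x : ℝ) δ with hx | hx
    · have : 0 ≤ Real.exp ε * (y : ℝ) := by positivity
      linarith
    · suffices (x : ℝ) ≤ Real.exp ε * y by linarith
      have hk : r - 1 ≠ 0 := by omega
      refine le_of_pow_le_pow_left₀ hk (by positivity) ?_
      have h4 : δ * (x : ℝ) ^ (r - 1) ≤ Real.exp 1 * (y : ℝ) ^ (r - 1) := by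
        refine le_trans ?_ h2
        calc δ * (x : ℝ) ^ (r - 1) ≤ x * (x : ℝ) ^ (r - 1) := by gcongr
          _ = (x : ℝ) ^ r := by rw [← pow_succ']; congr 1; omega
      have h5 : Real.exp 1 ≤ δ * Real.exp ε ^ (r - 1) := by
        rw [← Real.exp_nat_mul, hcast]
        calc Real.exp 1 = δ * Real.exp (1 + Real.log (1 / δ)) := by
              rw [Real.exp_add, Real.exp_log (by positivity)]; field_simp
          _ ≤ δ * Real.exp ((r - 1) * ε) := by gcongr
      rw [mul_pow]
      have h6 : δ * (x : ℝ) ^ (r - 1) ≤ δ * (Real.exp ε ^ (r - 1) * (y : ℝ) ^ (r - 1)) := by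
        refine h4.trans ?_
        rw [← mul_assoc]
        gcongr
      exact le_of_mul_le_mul_left h6 hδ
  rw [← ENNReal.ofReal_coe_nnreal (p := x), ← ENNReal.ofReal_coe_nnreal (p := y),
    ← ENNReal.ofReal_mul (Real.exp_nonneg _), ← ENNReal.ofReal_add (by positivity) hδ.le]
  exact ENNReal.ofReal_le_ofReal h3

/-! ### Composition of the Rényi bounds over the rounds -/

section Rounds

variable {d n : ℕ} {θ : Params} {r : ℕ} {S : Set (Option (Vec d))}

/-- The factor by which the Rényi bound of order `r` grows in one round. -/
def roundFactor (θ : Params) (r : ℕ) : ℝ≥0∞ :=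
  ENNReal.ofReal (1 + (θ.p : ℝ) ^ 2) ^ (1 / (r : ℝ))

lemma one_le_roundFactor (θ : Params) (r : ℕ) : 1 ≤ roundFactor θ r := by
  rcases Nat.eq_zero_or_pos r with rfl | hr
  · simp [roundFactor]
  · refine ENNReal.one_le_rpow (ENNReal.one_le_ofReal.2 ?_) (by positivity)
    linarith [sq_nonneg (θ.p : ℝ)]

lemma roundFactor_pow_le (hr : 2 ≤ r) (hT : (θ.T : ℝ) * (θ.p : ℝ) ^ 2 ≤ 1) :
    roundFactor θ r ^ θ.T ≤ ENNReal.ofReal (Real.exp 1) ^ (1 / (r : ℝ)) := by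
  rw [roundFactor, ← ENNReal.rpow_natCast, ← ENNReal.rpow_mul, mul_comm, ENNReal.rpow_mul,
    ENNReal.rpow_natCast]
  refine ENNReal.rpow_le_rpow ?_ (by positivity)
  rw [← ENNReal.ofReal_pow (by positivity)]
  refine ENNReal.ofReal_le_ofReal ?_
  calc (1 + (θ.p : ℝ) ^ 2) ^ θ.T ≤ Real.exp ((θ.p : ℝ) ^ 2) ^ θ.T :=
        pow_le_pow_left₀ (by positivity) (by linarith [Real.add_one_le_exp ((θ.p : ℝ) ^ 2)]) _
    _ = Real.exp (θ.T * (θ.p : ℝ) ^ 2) := (Real.exp_nat_mul _ _).symm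
    _ ≤ Real.exp 1 := Real.exp_le_exp.2 hT

lemma indicator_le_mul_rpow {α : Type*} (A : Set α) (a : α) {c : ℝ≥0∞} (hc : 1 ≤ c) {s : ℝ} :
    A.indicator (1 : α → ℝ≥0∞) a ≤ c * A.indicator (1 : α → ℝ≥0∞) a ^ s := by
  by_cases h : a ∈ A
  · simp [h, hc]
  · simp [h]

lemma roundValue_le {t : ℝ} {a c : ℝ≥0∞} {s : ℝ} {V V' : Vec d → ℝ≥0∞} (ha : a ≤ c * a ^ s)
    (hV : ∀ w, V w ≤ c * V' w ^ s) (w : Vec d) (m : ℝ) (u : Vec d) (z : ℝ × (Fin d → ℝ)) :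
    roundValue t a V w m u z ≤ c * roundValue t a V' w m u z ^ s := by
  unfold roundValue
  split_ifs
  · exact ha
  · exact hV _

/-- The mistake count and the update enter only through their sums with the noise, so a contribution
of one data point is a translation of the noise. -/
lemma roundValue_add (t : ℝ) (a : ℝ≥0∞) (V : Vec d → ℝ≥0∞) (w : Vec d) (m e : ℝ) (u f : Vec d)
    (z : ℝ × (Fin d → ℝ)) :
    roundValue t a V w (e + m) (f + u) z = roundValue t a V w m u (z.1 + e, z.2 + f.ofLp) := by
  unfold roundValue
  have h1 : e + m + z.1 = m + (z.1 + e) := by ring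
  have h2 : w + (f + u) + WithLp.toLp 2 z.2 = w + u + WithLp.toLp 2 (z.2 + f.ofLp) := by
    rw [WithLp.toLp_add, WithLp.toLp_ofLp]; abel
  rw [h1, h2]

lemma measurable_roundValue_right (t : ℝ) (a : ℝ≥0∞) {V : Vec d → ℝ≥0∞} (hV : Measurable V)
    (w : Vec d) (m : ℝ) (u : Vec d) : Measurable (roundValue t a V w m u) := by
  refine Measurable.ite ?_ measurable_const (hV.comp ?_)
  · exact measurableSet_lt (measurable_const.add measurable_fst) measurable_const
  · exact measurable_const.add (measurable_toLp.comp measurable_snd)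

lemma mistakeCount_perm (γ' : ℝ) (X : Fin n → Sample d) (v : Vec d) {L L' : List (Fin n)}
    (h : L.Perm L') : mistakeCount γ' X v L = mistakeCount γ' X v L' := by
  unfold mistakeCount mistakeList
  rw [(h.filter _).length_eq]

lemma mistakeSum_perm (γ' : ℝ) (X : Fin n → Sample d) (v : Vec d) {L L' : List (Fin n)}
    (h : L.Perm L') : mistakeSum γ' X v L = mistakeSum γ' X v L' :=
  ((h.filter _).map _).sum_eq

lemma mistakeList_map (γ' : ℝ) (X : Fin (n + 1) → Sample d) (i : Fin (n + 1)) (v : Vec d)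
    (L : List (Fin n)) : mistakeList γ' X v (L.map i.succAbove) =
      (mistakeList γ' (i.removeNth X) v L).map i.succAbove := by
  unfold mistakeList
  rw [List.filter_map]
  rfl

lemma mistakeCount_map (γ' : ℝ) (X : Fin (n + 1) → Sample d) (i : Fin (n + 1)) (v : Vec d)
    (L : List (Fin n)) :
    mistakeCount γ' X v (L.map i.succAbove) = mistakeCount γ' (i.removeNth X) v L := by
  rw [mistakeCount, mistakeList_map, List.length_map, mistakeCount]

lemma mistakeSum_map (γ' : ℝ) (X : Fin (n + 1) → Sample d) (i : Fin (n + 1)) (v : Vec d)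
    (L : List (Fin n)) :
    mistakeSum γ' X v (L.map i.succAbove) = mistakeSum γ' (i.removeNth X) v L := by
  rw [mistakeSum, mistakeList_map, List.map_map, mistakeSum]
  rfl

lemma norm_signed_le (e : Sample d) : ‖signed e‖ ≤ 1 := by
  have h : ‖(e.1 : Vec d)‖ ≤ 1 := mem_closedBall_zero_iff.1 e.1.2
  rw [signed, norm_smul]
  rcases int_units_cases e.2 with h' | h' <;> simpa [h'] using h

lemma sum_sq_ofLp_le {f : Vec d} (hf : ‖f‖ ≤ 1) : ∑ k, f.ofLp k ^ 2 ≤ 1 := by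
  have h := EuclideanSpace.norm_sq_eq f
  simp only [Real.norm_eq_abs, sq_abs] at h
  rw [← h]
  exact pow_le_one₀ (norm_nonneg _) hf

/-- One round on a dataset, expressed through the noise of the dataset without the point `i`. -/
lemma acceptProb_succ_eq_removeNth (hσ : θ.σ ≠ 0) (γ' t : ℝ) (X : Fin (n + 1) → Sample d)
    (i : Fin (n + 1)) (hS : MeasurableSet {w : Vec d | some w ∈ S}) (j : ℕ) (w : Vec d) :
    ∃ (e : ℝ) (f : Fin d → ℝ), |e| ≤ 1 ∧ ∑ k, f k ^ 2 ≤ 1 ∧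
      acceptProb γ' t θ X S (j + 1) w =
        sublistE (ENNReal.ofReal θ.p) (List.finRange n) fun L =>
          ∫⁻ z, ENNReal.ofReal (1 + θ.p * (Real.exp (noiseExponent θ e f z) - 1)) *
            roundValue t (S.indicator 1 (some (normalized w))) (acceptProb γ' t θ X S j) w
              (mistakeCount γ' (i.removeNth X) (normalized w) L)
              (mistakeSum γ' (i.removeNth X) (normalized w) L) z ∂noiseLaw d θ := by
  set v := normalized w
  -- The translation is the contribution of point i to the count and to the update. It depends on
  -- the weight vector but not on the rest of the batch, so one density serves all L.
  refine ⟨if IsMistake γ' v (X i) then 1 else 0,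
    (if IsMistake γ' v (X i) then signed (X i) else 0 : Vec d).ofLp, ?_, ?_, ?_⟩
  · split_ifs <;> simp
  · refine sum_sq_ofLp_le ?_
    split_ifs
    · exact norm_signed_le _
    · simp
  set e : ℝ := if IsMistake γ' v (X i) then 1 else 0
  set f : Vec d := if IsMistake γ' v (X i) then signed (X i) else 0
  rw [acceptProb, sublistE_finRange_succ n i]
  · congr 1
    funext L
    rw [mistakeCount_cons, mistakeSum_cons, mistakeCount_map, mistakeSum_map]
    set m := mistakeCount γ' (i.removeNth X) v L
    set u := mistakeSum γ' (i.removeNth X) v L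
    set H := roundValue t (S.indicator 1 (some v)) (acceptProb γ' t θ X S j) w m u with hH
    have hHm : Measurable H := measurable_roundValue_right _ _ (measurable_acceptProb γ' t θ X hS j) _ _ _
    have h1 : ∫⁻ z, roundValue t (S.indicator 1 (some v)) (acceptProb γ' t θ X S j) w
        (e + m) (f + u) z ∂noiseLaw d θ =
        ∫⁻ z, ENNReal.ofReal (Real.exp (noiseExponent θ e f.ofLp z)) * H z ∂noiseLaw d θ := by
      rw [← lintegral_noiseLaw_add θ hσ e f.ofLp hHm]
      exact lintegral_congr fun z => roundValue_add _ _ _ _ _ _ _ _ _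
    change ENNReal.ofReal θ.p * ∫⁻ z, roundValue t (S.indicator 1 (some v))
      (acceptProb γ' t θ X S j) w (e + m) (f + u) z ∂noiseLaw d θ +
        (1 - ENNReal.ofReal θ.p) * ∫⁻ z, H z ∂noiseLaw d θ = _
    rw [h1, ← lintegral_const_mul _ (by fun_prop), ← lintegral_const_mul _ hHm,
      ← lintegral_add_left (by fun_prop)]
    refine lintegral_congr fun z => ?_
    -- The coin of point i mixes the translated noise with weight p and the original noise with
    -- weight 1 - p, which gives the density 1 + p (R - 1).
    rw [← mul_assoc, ← add_mul, ← ENNReal.ofReal_mul θ.p.2.1, ← ENNReal.ofReal_one,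
      ← ENNReal.ofReal_sub _ θ.p.2.1, ← ENNReal.ofReal_add (mul_nonneg θ.p.2.1 (Real.exp_nonneg _))
      (sub_nonneg.2 θ.p.2.2)]
    congr 2
    ring
  · intro L L' h
    rw [mistakeCount_perm γ' X _ h, mistakeSum_perm γ' X _ h]

lemma Params.Noisy.order_pos (hθ : θ.Noisy r) : 0 < 1 - 1 / (r : ℝ) := by
  have := hθ.two_le_cast
  rw [sub_pos, div_lt_one (by linarith)]; linarith

lemma Params.Noisy.order_le_one (_ : θ.Noisy r) : 1 - 1 / (r : ℝ) ≤ 1 := by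
  have : (0 : ℝ) ≤ 1 / r := by positivity
  linarith

/-- Both runs draw the common points with the same law, so a bound for each fixed batch passes to
the average by concavity. -/
lemma sublistE_le_mul_rpow (θ : Params) (hθ : θ.Noisy r) (l : List (Fin n)) (c : ℝ≥0∞)
    {F G : List (Fin n) → ℝ≥0∞} (h : ∀ L, F L ≤ c * G L ^ (1 - 1 / (r : ℝ))) :
    sublistE (ENNReal.ofReal θ.p) l F ≤
      c * sublistE (ENNReal.ofReal θ.p) l G ^ (1 - 1 / (r : ℝ)) := by
  refine (sublistE_mono l h).trans ?_
  rw [sublistE_const_mul]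
  gcongr
  exact sublistE_rpow_le (ofReal_p_le_one θ) hθ.order_pos hθ.order_le_one l G

/-- The induction hypothesis holds at every weight vector, so it applies inside the round at the
adaptively chosen next vector. Hölder's inequality then removes the density of the current round at
the cost of one factor `roundFactor`. -/
lemma acceptProb_le_removeNth (hθ : θ.Noisy r) (γ' t : ℝ) (X : Fin (n + 1) → Sample d)
    (i : Fin (n + 1)) (hS : MeasurableSet {w : Vec d | some w ∈ S}) (j : ℕ) (w : Vec d) :
    acceptProb γ' t θ X S j w ≤
      roundFactor θ r ^ j * acceptProb γ' t θ (i.removeNth X) S j w ^ (1 - 1 / (r : ℝ)) := by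
  induction j generalizing w with
  | zero => exact indicator_le_mul_rpow _ _ (by simp)
  | succ j ih =>
    obtain ⟨e, f, he, hf, heq⟩ := acceptProb_succ_eq_removeNth (θ := θ) hθ.σ_ne_zero γ' t X i hS j w
    rw [heq, acceptProb]
    refine sublistE_le_mul_rpow θ hθ _ _ fun L => ?_
    have hV := measurable_acceptProb γ' t θ (i.removeNth X) hS j
    have hc : 1 ≤ roundFactor θ r ^ j := one_le_pow₀ (one_le_roundFactor θ r)
    refine (lintegral_mono fun z => mul_le_mul_right
      (roundValue_le (indicator_le_mul_rpow _ _ hc) ih _ _ _ z) _).trans ?_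
    have hm := measurable_roundValue_right t (S.indicator 1 (some (normalized w))) hV w
      (mistakeCount γ' (i.removeNth X) (normalized w) L)
      (mistakeSum γ' (i.removeNth X) (normalized w) L)
    simp only [mul_left_comm _ (roundFactor θ r ^ j)]
    rw [lintegral_const_mul _ (by fun_prop), pow_succ, mul_assoc]
    gcongr
    refine (lintegral_mul_rpow_le hθ.two_le (by fun_prop) hm).trans ?_
    gcongr
    exact ENNReal.rpow_le_rpow (hθ.lintegral_mixture he hf θ.p.2.1 θ.p.2.2).1 (by positivity)

/-- Now the run carrying the density is on the right-hand side, so the inverse moments of the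
density are used. -/
lemma acceptProb_removeNth_le (hθ : θ.Noisy r) (γ' t : ℝ) (X : Fin (n + 1) → Sample d)
    (i : Fin (n + 1)) (hS : MeasurableSet {w : Vec d | some w ∈ S}) (j : ℕ) (w : Vec d) :
    acceptProb γ' t θ (i.removeNth X) S j w ≤
      roundFactor θ r ^ j * acceptProb γ' t θ X S j w ^ (1 - 1 / (r : ℝ)) := by
  induction j generalizing w with
  | zero => exact indicator_le_mul_rpow _ _ (by simp)
  | succ j ih =>
    obtain ⟨e, f, he, hf, heq⟩ := acceptProb_succ_eq_removeNth (θ := θ) hθ.σ_ne_zero γ' t X i hS j w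
    rw [heq, acceptProb]
    refine sublistE_le_mul_rpow θ hθ _ _ fun L => ?_
    have hV := measurable_acceptProb γ' t θ X hS j
    have hc : 1 ≤ roundFactor θ r ^ j := one_le_pow₀ (one_le_roundFactor θ r)
    refine (lintegral_mono fun z =>
      roundValue_le (indicator_le_mul_rpow _ _ hc) ih _ _ _ z).trans ?_
    have hm := measurable_roundValue_right t (S.indicator 1 (some (normalized w))) hV w
      (mistakeCount γ' (i.removeNth X) (normalized w) L)
      (mistakeSum γ' (i.removeNth X) (normalized w) L)
    rw [lintegral_const_mul _ (by fun_prop), pow_succ, mul_assoc]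
    gcongr
    refine (lintegral_rpow_le_of_density hθ.two_le (ρ := fun z =>
      1 + θ.p * (Real.exp (noiseExponent θ e f z) - 1)) (by fun_prop)
      (fun z => one_add_mul_sub_one_pos θ.p.2.1 θ.p.2.2 (Real.exp_pos _)) hm).trans ?_
    gcongr
    exact ENNReal.rpow_le_rpow (hθ.lintegral_mixture he hf θ.p.2.1 θ.p.2.2).2 (by positivity)

lemma acceptProb_threshold_le (hθ : θ.Noisy r) (γ' t t' : ℝ) (ht : |t - t'| ≤ θ.p)
    (X : Fin n → Sample d) (hS : MeasurableSet {w : Vec d | some w ∈ S}) (j : ℕ) (w : Vec d) :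
    acceptProb γ' t θ X S j w ≤
      roundFactor θ r ^ j * acceptProb γ' t' θ X S j w ^ (1 - 1 / (r : ℝ)) := by
  induction j generalizing w with
  | zero => exact indicator_le_mul_rpow _ _ (by simp)
  | succ j ih =>
    rw [acceptProb, acceptProb]
    refine sublistE_le_mul_rpow θ hθ _ _ fun L => ?_
    set m := mistakeCount γ' X (normalized w) L
    set u := mistakeSum γ' X (normalized w) L
    have hV := measurable_acceptProb γ' t θ X hS j
    have hV' := measurable_acceptProb γ' t' θ X hS j
    have hc : 1 ≤ roundFactor θ r ^ j := one_le_pow₀ (one_le_roundFactor θ r)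
    -- Changing the threshold amounts to translating the Laplace noise alone.
    have hshift : ∀ z : ℝ × (Fin d → ℝ), roundValue t (S.indicator 1 (some (normalized w)))
        (acceptProb γ' t θ X S j) w m u z = roundValue t' (S.indicator 1 (some (normalized w)))
          (acceptProb γ' t θ X S j) w m u (z.1 + (t' - t), z.2 + 0) := by
      intro z
      have : m + z.1 < t ↔ m + (z.1 + (t' - t)) < t' := by constructor <;> intro h <;> linarith
      simp only [roundValue, this, add_zero]
    have hm := measurable_roundValue_right t' (S.indicator 1 (some (normalized w))) hV w m u
    have hm' := measurable_roundValue_right t' (S.indicator 1 (some (normalized w))) hV' w m u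
    simp only [hshift]
    rw [lintegral_noiseLaw_add θ hθ.σ_ne_zero (t' - t) 0 hm]
    refine (lintegral_mono fun z => mul_le_mul_right
      (roundValue_le (indicator_le_mul_rpow _ _ hc) ih _ _ _ z) _).trans ?_
    simp only [mul_left_comm _ (roundFactor θ r ^ j)]
    rw [lintegral_const_mul _ (by fun_prop), pow_succ, mul_assoc]
    gcongr
    refine (lintegral_mul_rpow_le hθ.two_le (by fun_prop) hm').trans ?_
    gcongr
    exact ENNReal.rpow_le_rpow (hθ.lintegral_shift (by rwa [abs_sub_comm]) θ.p.2.2) (by positivity)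

/-- The DP Batch Perceptron is differentially private if its noise is large enough. -/
theorem isDP_dpBatchPerceptron (hθ : θ.Noisy r) {α γ' ε δ : ℝ} (hα0 : 0 ≤ α) (hα1 : α ≤ 1)
    (hT : (θ.T : ℝ) * (θ.p : ℝ) ^ 2 ≤ 1) (hε1 : ε ≤ 1) (hδ : 0 < δ)
    (hr : 1 + Real.log (1 / (δ / 3)) ≤ (r - 1) * (ε / 2)) :
    (dpBatchPerceptron d α γ' θ).IsDP ε δ := by
  intro n X i S hS
  have hp := θ.p.2.1
  -- The threshold contains the dataset size, so it differs between neighbours by 0.3 α p.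
  have hthr : |3 / 10 * α * (θ.p : ℝ) * ((n + 1 : ℕ) : ℝ) - 3 / 10 * α * θ.p * n| ≤ θ.p := by
    have e : 3 / 10 * α * (θ.p : ℝ) * ((n + 1 : ℕ) : ℝ) - 3 / 10 * α * θ.p * n =
        3 / 10 * α * θ.p := by push_cast; ring
    rw [e, abs_of_nonneg (by positivity)]
    nlinarith
  have conv : ∀ x y : ℝ≥0∞, x ≤ 1 → y ≤ 1 →
      x ≤ roundFactor θ r ^ θ.T * y ^ (1 - 1 / (r : ℝ)) →
      x ≤ ENNReal.ofReal (Real.exp (ε / 2)) * y + ENNReal.ofReal (δ / 3) := fun x y hx hy h =>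
    le_exp_mul_add_of_renyi hθ.two_le hx hy (by positivity) hr
      (h.trans (mul_le_mul_left (roundFactor_pow_le hθ.two_le hT) _))
  -- Two comparisons with parameters (ε/2, δ/3) compose to (ε, δ): as ε ≤ 1, the additive terms sum
  -- to at most (e^(1/2) + 1) δ/3 ≤ δ.
  have comb : ∀ x y z : ℝ≥0∞,
      x ≤ ENNReal.ofReal (Real.exp (ε / 2)) * y + ENNReal.ofReal (δ / 3) →
      y ≤ ENNReal.ofReal (Real.exp (ε / 2)) * z + ENNReal.ofReal (δ / 3) →
      x ≤ ENNReal.ofReal (Real.exp ε) * z + ENNReal.ofReal δ := by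
    intro x y z hx hy
    refine hx.trans ((add_le_add_left (mul_le_mul_right hy _) _).trans ?_)
    rw [mul_add, ← mul_assoc, ← ENNReal.ofReal_mul (Real.exp_nonneg _), ← Real.exp_add, add_halves,
      ← ENNReal.ofReal_mul (Real.exp_nonneg _), add_assoc, ← ENNReal.ofReal_add (by positivity)
      (by positivity)]
    gcongr
    have h1 : Real.exp (ε / 2) ≤ 2 := by
      refine (Real.exp_le_exp.2 (show ε / 2 ≤ 1 / 2 by linarith)).trans ?_
      have := (abs_le.1 (Real.abs_exp_sub_one_sub_id_le (x := 1 / 2) (by norm_num [abs_le]))).2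
      norm_num at this ⊢
      linarith
    nlinarith
  rw [outputProb_dpBatchPerceptron α γ' θ X hS,
    outputProb_dpBatchPerceptron α γ' θ (i.removeNth X) hS]
  set t := 3 / 10 * α * (θ.p : ℝ) * n
  set t' := 3 / 10 * α * (θ.p : ℝ) * ((n + 1 : ℕ) : ℝ)
  -- The intermediate run uses the smaller dataset with the threshold t' of the larger one, so each
  -- comparison changes only one of the two.
  exact ⟨comb _ (acceptProb γ' t' θ (i.removeNth X) S θ.T 0) _
      (conv _ _ (acceptProb_le_one ..) (acceptProb_le_one ..)
        (acceptProb_le_removeNth hθ γ' t' X i hS θ.T 0))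
      (conv _ _ (acceptProb_le_one ..) (acceptProb_le_one ..)
        (acceptProb_threshold_le hθ γ' t' t hthr _ hS θ.T 0)),
    comb _ (acceptProb γ' t' θ (i.removeNth X) S θ.T 0) _
      (conv _ _ (acceptProb_le_one ..) (acceptProb_le_one ..)
        (acceptProb_threshold_le hθ γ' t t' (by rwa [abs_sub_comm]) _ hS θ.T 0))
      (conv _ _ (acceptProb_le_one ..) (acceptProb_le_one ..)
        (acceptProb_removeNth_le hθ γ' t' X i hS θ.T 0))⟩

end Rounds

/-! ### Tails of the Laplace distribution -/

/-- Tilting the Laplace density of scale b by e^(|x|/(2b)) yields twice the Laplace density of scale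
2b. -/
lemma lintegral_exp_abs_laplace {b : ℝ} (hb : 0 < b) :
    ∫⁻ x, ENNReal.ofReal (Real.exp (|x| / (2 * b))) ∂laplace b = 2 := by
  have h := isProbabilityMeasure_laplace (b := 2 * b) (by linarith)
  have h1 : ∫⁻ x, ENNReal.ofReal (Real.exp (-|x| / (2 * b)) / (2 * (2 * b))) = 1 := by
    have := h.measure_univ
    rwa [laplace, withDensity_apply _ MeasurableSet.univ, Measure.restrict_univ] at this
  rw [laplace, lintegral_withDensity_eq_lintegral_mul _ (by fun_prop) (by fun_prop)]
  calc _ = ∫⁻ x, 2 * ENNReal.ofReal (Real.exp (-|x| / (2 * b)) / (2 * (2 * b))) := by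
        refine lintegral_congr fun x => ?_
        have e2 : (2 : ℝ≥0∞) = ENNReal.ofReal 2 := by simp
        rw [Pi.mul_apply, ← ENNReal.ofReal_mul (by positivity), e2,
          ← ENNReal.ofReal_mul (by positivity), div_mul_eq_mul_div, ← Real.exp_add]
        congr 1
        have : -|x| / b + |x| / (2 * b) = -|x| / (2 * b) := by field_simp; ring
        rw [this]
        field_simp
    _ = 2 := by rw [lintegral_const_mul _ (by fun_prop), h1, mul_one]

lemma lintegral_abs_laplace_le {b : ℝ} (hb : 0 < b) :
    ∫⁻ x, ENNReal.ofReal |x| ∂laplace b ≤ ENNReal.ofReal (4 * b) := by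
  calc ∫⁻ x, ENNReal.ofReal |x| ∂laplace b
      ≤ ∫⁻ x, ENNReal.ofReal (2 * b) * ENNReal.ofReal (Real.exp (|x| / (2 * b))) ∂laplace b := by
        refine lintegral_mono fun x => ?_
        rw [← ENNReal.ofReal_mul (by positivity)]
        refine ENNReal.ofReal_le_ofReal ?_
        have h := Real.add_one_le_exp (|x| / (2 * b))
        have h2 : |x| = 2 * b * (|x| / (2 * b)) := by field_simp
        calc |x| = 2 * b * (|x| / (2 * b)) := h2
          _ ≤ 2 * b * Real.exp (|x| / (2 * b)) := by gcongr; linarith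
    _ = ENNReal.ofReal (4 * b) := by
        have e2 : (2 : ℝ≥0∞) = ENNReal.ofReal 2 := by simp
        rw [lintegral_const_mul _ (by fun_prop), lintegral_exp_abs_laplace hb, e2,
          ← ENNReal.ofReal_mul (by positivity)]
        congr 1
        ring

/-! ### Mistakes and margins -/

section Margin

variable {d n : ℕ} {γ γ' : ℝ}

lemma inner_signed (v : Vec d) (e : Sample d) :
    inner ℝ v (signed e) = ((e.2 : ℤ) : ℝ) * inner ℝ v (e.1 : Vec d) := by
  rw [signed, inner_smul_right]

lemma inner_signed_le_of_isMistake {v : Vec d} {e : Sample d} (h : IsMistake γ' v e) :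
    inner ℝ v (signed e) ≤ γ' := by
  rw [inner_signed]
  rcases (isMistake_iff γ' v e).1 h with ⟨h1, h2⟩ | ⟨h1, h2⟩
  · simp [h1, h2.le]
  · simp only [h1, Units.val_neg, Units.val_one, Int.cast_neg, Int.cast_one]
    linarith

lemma isMistake_of_inner_signed_lt {v : Vec d} {e : Sample d} (h : inner ℝ v (signed e) < γ') :
    IsMistake γ' v e := by
  rw [inner_signed] at h
  rw [isMistake_iff]
  rcases int_units_cases e.2 with h1 | h1
  · exact .inl ⟨h1, by simpa [h1] using h⟩
  · refine .inr ⟨h1, ?_⟩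
    simp only [h1, Units.val_neg, Units.val_one, Int.cast_neg, Int.cast_one] at h
    linarith

variable (X : Fin n → Sample d) (v : Vec d) (L : List (Fin n))

lemma mistakeCount_nonneg : 0 ≤ mistakeCount γ' X v L := Nat.cast_nonneg _

lemma mistakeCount_le_length : mistakeCount γ' X v L ≤ L.length :=
  Nat.cast_le.2 (length_mistakeList_le γ' X v L)

lemma norm_mistakeSum_le : ‖mistakeSum γ' X v L‖ ≤ mistakeCount γ' X v L := by
  induction L with
  | nil => simp [mistakeSum, mistakeCount, mistakeList]
  | cons j L ih =>
    rw [mistakeSum_cons, mistakeCount_cons]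
    refine (norm_add_le _ _).trans (add_le_add ?_ ih)
    split_ifs
    · exact norm_signed_le _
    · simp

/-- This bound and `le_inner_mistakeSum` are the two perceptron inequalities: along v a mistake
contributes at most γ', along the separator at least γ. -/
lemma inner_mistakeSum_le : inner ℝ v (mistakeSum γ' X v L) ≤ γ' * mistakeCount γ' X v L := by
  induction L with
  | nil => simp [mistakeSum, mistakeCount, mistakeList]
  | cons j L ih =>
    rw [mistakeSum_cons, mistakeCount_cons, inner_add_right, mul_add]
    refine add_le_add ?_ ih
    split_ifs with h
    · simpa using inner_signed_le_of_isMistake h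
    · simp

lemma le_inner_mistakeSum {ws : Vec d} (hX : ∀ j, γ ≤ inner ℝ ws (signed (X j))) :
    γ * mistakeCount γ' X v L ≤ inner ℝ ws (mistakeSum γ' X v L) := by
  induction L with
  | nil => simp [mistakeSum, mistakeCount, mistakeList]
  | cons j L ih =>
    rw [mistakeSum_cons, mistakeCount_cons, inner_add_right, mul_add]
    refine add_le_add ?_ ih
    split_ifs
    · simpa using hX j
    · simp

end Margin

/-! ### The potential -/

section Potential

variable {d n : ℕ}

/-- The potential that decreases in every round that does not stop. -/
def potential (ws : Vec d) (A : ℝ) (w : Vec d) : ℝ := √(‖w‖ ^ 2 + A ^ 2) - inner ℝ ws w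

lemma potential_nonneg {ws : Vec d} (hws : ‖ws‖ = 1) (A : ℝ) (w : Vec d) :
    0 ≤ potential ws A w := by
  have h1 : inner ℝ ws w ≤ ‖w‖ := by
    have := real_inner_le_norm ws w
    rwa [hws, one_mul] at this
  have h2 : ‖w‖ ≤ √(‖w‖ ^ 2 + A ^ 2) := Real.le_sqrt_of_sq_le (by nlinarith [sq_nonneg A])
  unfold potential
  linarith

lemma potential_zero (ws : Vec d) {A : ℝ} (hA : 0 ≤ A) : potential ws A 0 = A := by
  simp [potential, Real.sqrt_sq hA]

/-- The concave square root lies below its tangent at N. -/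
lemma sqrt_add_le {N Δ : ℝ} (hN : 0 < N) (h : 0 ≤ N + Δ) : √(N + Δ) ≤ √N + Δ / (2 * √N) := by
  have hs : 0 < √N := Real.sqrt_pos.2 hN
  have h1 : √N ^ 2 = N := Real.sq_sqrt hN.le
  have h2 : √(N + Δ) ^ 2 = N + Δ := Real.sq_sqrt h
  have h3 : √N + Δ / (2 * √N) = (2 * √N ^ 2 + Δ) / (2 * √N) := by field_simp
  rw [h3, le_div_iff₀ (by positivity)]
  nlinarith [sq_nonneg (√(N + Δ) - √N)]

/-- The gradient of √(‖w‖² + A²) is ‖w‖/√(‖w‖² + A²) ≤ 1 times the direction v, so the mistakes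
raise the root by at most 0.95 γ m to first order while ⟨w*, w⟩ gains at least γ m. The smoothing by
A keeps the root at least A, which damps the second-order terms even near w = 0. The term linear in
g is kept exactly because it averages to zero. -/
lemma potential_add_le {γ : ℝ} (hγ : 0 ≤ γ) (X : Fin n → Sample d) (ws : Vec d)
    (hX : ∀ j, γ ≤ inner ℝ ws (signed (X j))) {A : ℝ} (hA : 0 < A) (w : Vec d)
    (L : List (Fin n)) (g : Vec d) :
    potential ws A (w + mistakeSum (0.95 * γ) X (normalized w) L + g) ≤
      potential ws A w - 0.05 * γ * mistakeCount (0.95 * γ) X (normalized w) L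
        + (L.length : ℝ) ^ 2 / A
        + inner ℝ ((√(‖w‖ ^ 2 + A ^ 2))⁻¹ • w - ws) g + ‖g‖ ^ 2 / A := by
  set v := normalized w
  set m := mistakeCount (0.95 * γ) X v L
  set u := mistakeSum (0.95 * γ) X v L
  set ψ := √(‖w‖ ^ 2 + A ^ 2) with hψ
  have hN : 0 < ‖w‖ ^ 2 + A ^ 2 := by positivity
  have hψ0 : 0 < ψ := Real.sqrt_pos.2 hN
  have hAψ : A ≤ ψ := Real.le_sqrt_of_sq_le (by nlinarith [sq_nonneg ‖w‖])
  have hwψ : ‖w‖ ≤ ψ := Real.le_sqrt_of_sq_le (by nlinarith [sq_nonneg A])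
  have hm0 : 0 ≤ m := mistakeCount_nonneg X v L
  have hmL : m ≤ L.length := mistakeCount_le_length X v L
  have hu : ‖u‖ ≤ m := norm_mistakeSum_le X v L
  have hvu : inner ℝ v u ≤ 0.95 * γ * m := inner_mistakeSum_le X v L
  have hwsu : γ * m ≤ inner ℝ ws u := le_inner_mistakeSum X v L hX
  have hwu : inner ℝ w u ≤ ψ * (0.95 * γ * m) := by
    have e : inner ℝ w u = ‖w‖ * inner ℝ v u := by
      rw [← real_inner_smul_left, norm_smul_normalized]
    rw [e]
    have : 0 ≤ 0.95 * γ * m := by positivity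
    calc ‖w‖ * inner ℝ v u ≤ ‖w‖ * (0.95 * γ * m) := by gcongr
      _ ≤ ψ * (0.95 * γ * m) := by gcongr
  have hexp : ‖w + u + g‖ ^ 2 + A ^ 2 =
      (‖w‖ ^ 2 + A ^ 2) + (2 * inner ℝ w u + 2 * inner ℝ w g + ‖u + g‖ ^ 2) := by
    rw [add_assoc w u g, norm_add_sq_real, inner_add_right]; ring
  have h1 : √(‖w + u + g‖ ^ 2 + A ^ 2) ≤
      ψ + (2 * inner ℝ w u + 2 * inner ℝ w g + ‖u + g‖ ^ 2) / (2 * ψ) := by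
    rw [hexp]
    exact sqrt_add_le hN (by rw [← hexp]; positivity)
  have h2 : (2 * inner ℝ w u + 2 * inner ℝ w g + ‖u + g‖ ^ 2) / (2 * ψ) =
      inner ℝ w u / ψ + ψ⁻¹ * inner ℝ w g + ‖u + g‖ ^ 2 / (2 * ψ) := by
    field_simp
  have h3 : inner ℝ w u / ψ ≤ 0.95 * γ * m := by
    rw [div_le_iff₀ hψ0]; linarith
  have h4 : ‖u + g‖ ^ 2 / (2 * ψ) ≤ (L.length : ℝ) ^ 2 / A + ‖g‖ ^ 2 / A := by
    rw [← add_div]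
    have h5 : ‖u + g‖ ^ 2 ≤ 2 * ((L.length : ℝ) ^ 2 + ‖g‖ ^ 2) := by
      have h6 : ‖u + g‖ ≤ L.length + ‖g‖ :=
        (norm_add_le u g).trans (by linarith)
      nlinarith [norm_nonneg (u + g), sq_nonneg ((L.length : ℝ) - ‖g‖)]
    rw [div_le_div_iff₀ (by positivity) hA]
    have : 0 ≤ (L.length : ℝ) ^ 2 + ‖g‖ ^ 2 := by positivity
    nlinarith [mul_le_mul_of_nonneg_right h5 hA.le, mul_le_mul_of_nonneg_left hAψ this]
  have e5 : inner ℝ (ψ⁻¹ • w - ws) g = ψ⁻¹ * inner ℝ w g - inner ℝ ws g := by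
    rw [inner_sub_left, real_inner_smul_left]
  unfold potential
  rw [← hψ, e5, inner_add_right, inner_add_right]
  linarith

/-- The Gaussian noise has mean zero and covariance `v` times the identity. -/
lemma integral_pi_gaussian_quadratic (v : ℝ≥0) (B A : ℝ) (a : Vec d) :
    Integrable (fun g : Fin d → ℝ => B + inner ℝ a (WithLp.toLp 2 g : Vec d) +
        ‖(WithLp.toLp 2 g : Vec d)‖ ^ 2 / A) (Measure.pi fun _ => gaussianReal 0 v) ∧
      ∫ g : Fin d → ℝ, (B + inner ℝ a (WithLp.toLp 2 g : Vec d) +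
        ‖(WithLp.toLp 2 g : Vec d)‖ ^ 2 / A) ∂(Measure.pi fun _ => gaussianReal 0 v) =
      B + d * v / A := by
  have hid : MemLp id 2 (gaussianReal 0 v) := memLp_id_gaussianReal 2
  have i1 : Integrable (fun x : ℝ => x) (gaussianReal 0 v) := hid.integrable (by norm_num)
  have i2 : Integrable (fun x : ℝ => x ^ 2) (gaussianReal 0 v) := hid.integrable_sq
  have v2 : ∫ x, x ^ 2 ∂gaussianReal 0 v = v := by
    have h := variance_fun_id_gaussianReal (μ := 0) (v := v)
    rw [variance_eq_integral (by fun_prop)] at h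
    simpa using h
  have mp := fun k : Fin d => measurePreserving_eval (fun _ : Fin d => gaussianReal 0 v) k
  have j1 : ∀ k : Fin d, Integrable (fun g : Fin d → ℝ => a k * g k)
      (Measure.pi fun _ => gaussianReal 0 v) := fun k =>
    ((mp k).integrable_comp_of_integrable i1).const_mul (a k)
  have j2 : ∀ k : Fin d, Integrable (fun g : Fin d → ℝ => g k ^ 2)
      (Measure.pi fun _ => gaussianReal 0 v) := fun k =>
    (mp k).integrable_comp_of_integrable i2
  have e1 : ∀ k : Fin d, ∫ g : Fin d → ℝ, a k * g k ∂(Measure.pi fun _ => gaussianReal 0 v) = 0 := by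
    intro k
    rw [integral_const_mul]
    have h : ∫ g : Fin d → ℝ, g k ∂(Measure.pi fun _ => gaussianReal 0 v) =
        ∫ x, x ∂gaussianReal 0 v :=
      integral_comp_eval (μ := fun _ : Fin d => gaussianReal 0 v) (f := fun x => x)
        i1.aestronglyMeasurable
    rw [h, integral_id_gaussianReal, mul_zero]
  have e2 : ∀ k : Fin d, ∫ g : Fin d → ℝ, g k ^ 2 ∂(Measure.pi fun _ => gaussianReal 0 v) = v := by
    intro k
    have h : ∫ g : Fin d → ℝ, g k ^ 2 ∂(Measure.pi fun _ => gaussianReal 0 v) =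
        ∫ x, x ^ 2 ∂gaussianReal 0 v :=
      integral_comp_eval (μ := fun _ : Fin d => gaussianReal 0 v) (f := fun x => x ^ 2)
        i2.aestronglyMeasurable
    rw [h, v2]
  have e : (fun g : Fin d → ℝ => B + inner ℝ a (WithLp.toLp 2 g : Vec d) +
      ‖(WithLp.toLp 2 g : Vec d)‖ ^ 2 / A) =
      fun g => B + ∑ k, a k * g k + (∑ k, g k ^ 2) / A := by
    funext g
    rw [EuclideanSpace.norm_sq_eq, PiLp.inner_apply]
    simp [mul_comm]
  have k1 : Integrable (fun g : Fin d → ℝ => ∑ k, a k * g k)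
      (Measure.pi fun _ => gaussianReal 0 v) := integrable_finsetSum _ fun k _ => j1 k
  have k2 : Integrable (fun g : Fin d → ℝ => (∑ k, g k ^ 2) / A)
      (Measure.pi fun _ => gaussianReal 0 v) := (integrable_finsetSum _ fun k _ => j2 k).div_const A
  have k3 : Integrable (fun g : Fin d → ℝ => B + ∑ k, a k * g k)
      (Measure.pi fun _ => gaussianReal 0 v) := (integrable_const _).add k1
  rw [e]
  refine ⟨k3.add k2, ?_⟩
  rw [integral_add k3 k2, integral_add (integrable_const _) k1, integral_div,
    integral_finsetSum _ fun k _ => j1 k, integral_finsetSum _ fun k _ => j2 k]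
  simp [e1, e2]

end Potential

/-! ### The probability of FAIL -/

section Utility

variable {d n : ℕ} {θ : Params}

/-- A round that does not stop has m ≥ t - ν, so the mistakes lower the potential by at least 0.05 γ
(t - |ν|) = 2κ - 0.05 γ |ν|. The drop 2κ pays for the added L₀ + κ, and only the error terms remain;
a stopped round contributes 0. -/
lemma lintegral_roundValue_potential_le {γ t A κ L₀ : ℝ} (hγ : 0 ≤ γ) (X : Fin n → Sample d)
    {ws : Vec d} (hws : ‖ws‖ = 1) (hX : ∀ j, γ ≤ inner ℝ ws (signed (X j))) (hA : 0 < A)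
    (hκ : 0.05 * γ * t = 2 * κ) (hκ0 : 0 ≤ κ) (hL0 : 0 ≤ L₀) (hL : L₀ ≤ κ) (w : Vec d)
    (L : List (Fin n)) :
    ∫⁻ z, roundValue t 0 (fun w' => ENNReal.ofReal (potential ws A w' + L₀ + κ)) w
        (mistakeCount (0.95 * γ) X (normalized w) L) (mistakeSum (0.95 * γ) X (normalized w) L) z
        ∂noiseLaw d θ ≤
      ENNReal.ofReal (potential ws A w + d * (θ.σ : ℝ) ^ 2 / A) +
        ENNReal.ofReal (0.05 * γ * (4 * θ.b)) + ENNReal.ofReal (1 / A) * (L.length : ℝ≥0∞) ^ 2 := by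
  set m := mistakeCount (0.95 * γ) X (normalized w) L
  set u := mistakeSum (0.95 * γ) X (normalized w) L
  set Ψ := potential ws A w
  have hΨ : 0 ≤ Ψ := potential_nonneg hws A w
  have hpot : Measurable (potential ws A) := by
    unfold potential; fun_prop
  have hnu : ∀ ν : ℝ, ∫⁻ g, roundValue t 0
        (fun w' => ENNReal.ofReal (potential ws A w' + L₀ + κ)) w m u (ν, g)
        ∂(Measure.pi fun _ : Fin d => gaussianReal 0 (θ.σ ^ 2)) ≤
      ENNReal.ofReal (Ψ + d * (θ.σ : ℝ) ^ 2 / A) + ENNReal.ofReal (0.05 * γ) * ENNReal.ofReal |ν| +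
        ENNReal.ofReal (1 / A) * (L.length : ℝ≥0∞) ^ 2 := by
    intro ν
    unfold roundValue
    simp only
    split_ifs with hhalt
    · simp
    · set a := (√(‖w‖ ^ 2 + A ^ 2))⁻¹ • w - ws
      set B := Ψ - 0.05 * γ * m + (L.length : ℝ) ^ 2 / A + L₀ + κ
      have hle : ∀ g : Fin d → ℝ, potential ws A (w + u + WithLp.toLp 2 g) + L₀ + κ ≤
          B + inner ℝ a (WithLp.toLp 2 g : Vec d) + ‖(WithLp.toLp 2 g : Vec d)‖ ^ 2 / A := by
        intro g
        have : potential ws A (w + u + WithLp.toLp 2 g) ≤ Ψ - 0.05 * γ * m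
            + (L.length : ℝ) ^ 2 / A + inner ℝ a (WithLp.toLp 2 g : Vec d) +
            ‖(WithLp.toLp 2 g : Vec d)‖ ^ 2 / A :=
          potential_add_le hγ X ws hX hA w L (WithLp.toLp 2 g)
        simp only [B]
        linarith
      obtain ⟨hi, he⟩ := integral_pi_gaussian_quadratic (d := d) (θ.σ ^ 2) B A a
      calc _ ≤ ∫⁻ g : Fin d → ℝ, ENNReal.ofReal (B + inner ℝ a (WithLp.toLp 2 g : Vec d) +
              ‖(WithLp.toLp 2 g : Vec d)‖ ^ 2 / A)
              ∂(Measure.pi fun _ : Fin d => gaussianReal 0 (θ.σ ^ 2)) :=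
            lintegral_mono fun g => ENNReal.ofReal_le_ofReal (hle g)
        _ = ENNReal.ofReal (B + d * (θ.σ : ℝ) ^ 2 / A) := by
            rw [← ofReal_integral_eq_lintegral_ofReal hi, he, NNReal.coe_pow]
            refine Filter.Eventually.of_forall fun g => le_trans ?_ (hle g)
            have := potential_nonneg hws A (w + u + WithLp.toLp 2 g)
            simp only [Pi.zero_apply]
            linarith
        _ ≤ ENNReal.ofReal ((Ψ + d * (θ.σ : ℝ) ^ 2 / A) + 0.05 * γ * |ν| +
              1 / A * (L.length : ℝ) ^ 2) := by
            refine ENNReal.ofReal_le_ofReal ?_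
            have h1 : t - |ν| ≤ m := by linarith [le_abs_self ν, not_lt.1 hhalt]
            have h2 : 0.05 * γ * (t - |ν|) ≤ 0.05 * γ * m := by gcongr
            have h3 : 1 / A * (L.length : ℝ) ^ 2 = (L.length : ℝ) ^ 2 / A := by ring
            simp only [B]
            linarith
        _ = _ := by
            rw [ENNReal.ofReal_add (by positivity) (by positivity),
              ENNReal.ofReal_add (by positivity) (by positivity),
              ENNReal.ofReal_mul (p := 0.05 * γ) (by positivity),
              ENNReal.ofReal_mul (p := 1 / A) (by positivity), ENNReal.ofReal_pow (by positivity), ENNReal.ofReal_natCast]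
  have hm : Measurable (roundValue t 0
      (fun w' => ENNReal.ofReal (potential ws A w' + L₀ + κ)) w m u) :=
    measurable_roundValue_right _ _ (by fun_prop) _ _ _
  unfold noiseLaw
  rw [lintegral_prod _ hm.aemeasurable]
  refine (lintegral_mono hnu).trans ?_
  rw [lintegral_add_right _ measurable_const, lintegral_add_left measurable_const,
    lintegral_const_mul _ (by fun_prop)]
  simp only [lintegral_const, measure_univ, mul_one]
  refine add_le_add (add_le_add le_rfl ?_) le_rfl
  rw [ENNReal.ofReal_mul (p := 0.05 * γ) (by positivity)]
  exact mul_le_mul_right (lintegral_abs_laplace_le θ.b_pos) _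

/-- If no round stops, then the potential has decreased too often. -/
lemma acceptProb_none_le {γ t A κ L₀ : ℝ} (hγ : 0 ≤ γ) (X : Fin n → Sample d)
    {ws : Vec d} (hws : ‖ws‖ = 1) (hX : ∀ j, γ ≤ inner ℝ ws (signed (X j))) (hA : 0 < A)
    (hκ : 0.05 * γ * t = 2 * κ) (hκ0 : 0 ≤ κ) (hL : L₀ ≤ κ)
    (hL₀ : d * (θ.σ : ℝ) ^ 2 / A + 0.05 * γ * (4 * θ.b) +
      1 / A * (θ.p * n + (θ.p * n) ^ 2) ≤ L₀) (j : ℕ) (w : Vec d) :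
    ENNReal.ofReal (j * κ) * acceptProb (0.95 * γ) t θ X {none} j w ≤
      ENNReal.ofReal (potential ws A w + L₀) := by
  have hb := θ.b_pos
  have hp := θ.p.2.1
  have hL0 : 0 ≤ L₀ := le_trans (by positivity) hL₀
  induction j generalizing w with
  | zero => simp
  | succ j ih =>
    rw [acceptProb, ← sublistE_const_mul]
    have hind : ({none} : Set (Option (Vec d))).indicator (1 : Option (Vec d) → ℝ≥0∞) (some (normalized w)) = 0 := by
      simp
    rw [hind]
    have hS : MeasurableSet {w : Vec d | some w ∈ ({none} : Set (Option (Vec d)))} := by simp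
    calc _ ≤ sublistE (ENNReal.ofReal θ.p) (List.finRange n) fun L =>
          ENNReal.ofReal (potential ws A w + d * (θ.σ : ℝ) ^ 2 / A) +
            ENNReal.ofReal (0.05 * γ * (4 * θ.b)) +
            ENNReal.ofReal (1 / A) * (L.length : ℝ≥0∞) ^ 2 := by
          refine sublistE_mono _ fun L => ?_
          refine le_trans ?_ (lintegral_roundValue_potential_le hγ X hws hX hA hκ hκ0 hL0 hL w L)
          rw [← lintegral_const_mul _ (measurable_roundValue_right _ _
            (measurable_acceptProb _ _ _ _ hS _) _ _ _)]
          refine lintegral_mono fun z => ?_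
          unfold roundValue
          split_ifs
          · simp
          · set w' := w + mistakeSum (0.95 * γ) X (normalized w) L + WithLp.toLp 2 z.2
            have h1 := acceptProb_le_one (0.95 * γ) t θ X {none} j w'
            have h2 := ih w'
            have h3 := potential_nonneg hws A w'
            change _ ≤ ENNReal.ofReal (potential ws A w' + L₀ + κ)
            -- Of (j + 1) κ, the part j κ is covered by the induction hypothesis at the new vector,
            -- and the last κ is multiplied by a probability, hence by at most 1.
            rw [Nat.cast_succ, add_mul, one_mul, ENNReal.ofReal_add (by positivity) hκ0, add_mul,
              ENNReal.ofReal_add (by positivity) hκ0]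
            exact add_le_add h2 (mul_le_of_le_one_right' h1)
      _ ≤ ENNReal.ofReal (potential ws A w + d * (θ.σ : ℝ) ^ 2 / A) +
            ENNReal.ofReal (0.05 * γ * (4 * θ.b)) +
            ENNReal.ofReal (1 / A) * (ENNReal.ofReal θ.p * n + (ENNReal.ofReal θ.p * n) ^ 2) := by
          rw [sublistE_add, sublistE_const (ofReal_p_le_one θ), sublistE_const_mul]
          gcongr
          simpa using sublistE_length_sq_le (ofReal_p_le_one θ) (List.finRange n)
      _ = ENNReal.ofReal (potential ws A w + (d * (θ.σ : ℝ) ^ 2 / A + 0.05 * γ * (4 * θ.b) +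
            1 / A * (θ.p * n + (θ.p * n) ^ 2))) := by
          have h3 := potential_nonneg hws A w
          rw [← ENNReal.ofReal_natCast n, ← ENNReal.ofReal_mul hp,
            ← ENNReal.ofReal_pow (by positivity), ← ENNReal.ofReal_add (p := θ.p * n)
            (by positivity) (by positivity), ← ENNReal.ofReal_mul (by positivity),
            ← ENNReal.ofReal_add (by positivity) (by positivity),
            ← ENNReal.ofReal_add (by positivity) (by positivity)]
          congr 1
          ring
      _ ≤ ENNReal.ofReal (potential ws A w + L₀) := ENNReal.ofReal_le_ofReal (by linarith)

/-! ### Stopping too early -/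

lemma one_sub_exp_neg_ge {x : ℝ} (hx0 : 0 ≤ x) (hx : x ≤ 0.2) : 0.8 * x ≤ 1 - Real.exp (-x) := by
  have h := (abs_le.1 (Real.abs_exp_sub_one_sub_id_le (x := -x)
    (by rw [abs_neg, abs_of_nonneg hx0]; linarith))).2
  nlinarith

/-- The probability that a round stops although `v` makes many mistakes on the dataset. -/
lemma sublistE_stop_le {γ' K : ℝ} (hb : 2.5 ≤ θ.b) (X : Fin n → Sample d) (v : Vec d)
    (hK : K ≤ mistakeCount γ' X v (List.finRange n)) (t : ℝ) :
    sublistE (ENNReal.ofReal θ.p) (List.finRange n)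
        (fun L => ∫⁻ z, (if mistakeCount γ' X v L + z.1 < t then 1 else 0) ∂noiseLaw d θ) ≤
      2 * ENNReal.ofReal (Real.exp ((t - 0.8 * θ.p * K) / (2 * θ.b))) := by
  have hb0 := θ.b_pos
  have hp := θ.p.2.1
  -- The Chernoff parameter is half the rate of the Laplace tail, so the exponential moment of the
  -- noise is 2; b ≥ 2.5 makes x ≤ 0.2 and hence 1 - e^(-x) ≥ 0.8 x.
  set x : ℝ := 1 / (2 * θ.b)
  have hx0 : 0 ≤ x := by positivity
  have hx1 : x ≤ 0.2 := by
    simp only [x]; rw [div_le_iff₀ (by positivity)]; linarith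
  have hL : ∀ L : List (Fin n),
      ∫⁻ z, (if mistakeCount γ' X v L + z.1 < t then 1 else 0) ∂noiseLaw d θ ≤
        2 * ENNReal.ofReal (Real.exp (x * t)) *
          ENNReal.ofReal (Real.exp (-x)) ^ L.countP (fun j => IsMistake γ' v (X j)) := by
    intro L
    have hm : mistakeCount γ' X v L = L.countP (fun j => IsMistake γ' v (X j)) := by
      rw [mistakeCount, mistakeList, List.countP_eq_length_filter]
    calc ∫⁻ z, (if mistakeCount γ' X v L + z.1 < t then 1 else 0) ∂noiseLaw d θ
        ≤ ∫⁻ z, ENNReal.ofReal (Real.exp (x * (t - mistakeCount γ' X v L))) *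
            ENNReal.ofReal (Real.exp (|z.1| / (2 * θ.b))) ∂noiseLaw d θ := by
          refine lintegral_mono fun z => ?_
          simp only
          split_ifs with h
          · rw [← ENNReal.ofReal_mul (Real.exp_nonneg _), ← Real.exp_add, ENNReal.one_le_ofReal]
            refine Real.one_le_exp ?_
            have e : |z.1| / (2 * θ.b) = x * |z.1| := by simp only [x]; ring
            rw [e, ← mul_add]
            refine mul_nonneg hx0 ?_
            linarith [neg_abs_le z.1]
          · simp
      _ = ENNReal.ofReal (Real.exp (x * (t - mistakeCount γ' X v L))) * 2 := by
          rw [lintegral_const_mul _ (by fun_prop)]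
          congr 1
          unfold noiseLaw
          rw [lintegral_prod _ (by fun_prop)]
          simp only [lintegral_const, measure_univ, mul_one]
          exact lintegral_exp_abs_laplace hb0
      _ = _ := by
          rw [← ENNReal.ofReal_pow (Real.exp_nonneg _), ← Real.exp_nat_mul, mul_assoc,
            ← ENNReal.ofReal_mul (Real.exp_nonneg _), ← Real.exp_add, mul_comm, hm]
          congr 3
          ring
  refine (sublistE_mono _ hL).trans ?_
  rw [sublistE_const_mul, sublistE_pow_countP (ofReal_p_le_one θ), mul_assoc]
  gcongr
  set c := (List.finRange n).countP (fun j => IsMistake γ' v (X j))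
  have hc : K ≤ c := by
    rw [mistakeCount, mistakeList, ← List.countP_eq_length_filter] at hK
    exact hK
  have h1 : ENNReal.ofReal θ.p * ENNReal.ofReal (Real.exp (-x)) + (1 - ENNReal.ofReal θ.p) =
      ENNReal.ofReal (1 - θ.p * (1 - Real.exp (-x))) := by
    rw [← ENNReal.ofReal_one, ← ENNReal.ofReal_sub _ hp, ← ENNReal.ofReal_mul hp,
      ← ENNReal.ofReal_add (by positivity) (sub_nonneg.2 θ.p.2.2)]
    congr 1
    ring
  have h0 : 0 ≤ 1 - (θ.p : ℝ) * (1 - Real.exp (-x)) := by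
    have := θ.p.2.2
    nlinarith [Real.exp_pos (-x), mul_nonneg hp (Real.exp_nonneg (-x))]
  rw [h1, ← ENNReal.ofReal_pow h0, ← ENNReal.ofReal_mul (Real.exp_nonneg _)]
  refine ENNReal.ofReal_le_ofReal ?_
  have h2 : 1 - (θ.p : ℝ) * (1 - Real.exp (-x)) ≤ Real.exp (-(0.8 * θ.p * x)) := by
    have h3 := one_sub_exp_neg_ge hx0 hx1
    have h4 := Real.add_one_le_exp (-(0.8 * θ.p * x))
    nlinarith [mul_le_mul_of_nonneg_left h3 hp]
  calc Real.exp (x * t) * (1 - θ.p * (1 - Real.exp (-x))) ^ c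
      ≤ Real.exp (x * t) * Real.exp (-(0.8 * θ.p * x)) ^ c := by gcongr
    _ = Real.exp (x * t - 0.8 * θ.p * x * c) := by
        rw [← Real.exp_nat_mul, ← Real.exp_add]; congr 1; ring
    _ ≤ Real.exp ((t - 0.8 * θ.p * K) / (2 * θ.b)) := by
        refine Real.exp_le_exp.2 ?_
        have e : (t - 0.8 * θ.p * K) / (2 * θ.b) = x * t - 0.8 * θ.p * x * K := by
          simp only [x]; ring
        rw [e]
        gcongr

/-- A union bound over the rounds for stopping at a vector with many mistakes. -/
lemma acceptProb_bad_le {γ' K t : ℝ} (hb : 2.5 ≤ θ.b) (X : Fin n → Sample d) {S : Set (Vec d)}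
    (hS : MeasurableSet S) (hK : ∀ v ∈ S, ‖v‖ ≤ 1 → K ≤ mistakeCount γ' X v (List.finRange n))
    (j : ℕ) (w : Vec d) :
    acceptProb γ' t θ X (some '' S) j w ≤
      j * (2 * ENNReal.ofReal (Real.exp ((t - 0.8 * θ.p * K) / (2 * θ.b)))) := by
  have hS' : MeasurableSet {w : Vec d | some w ∈ (some '' S : Set (Option (Vec d)))} := by
    simpa using hS
  set η := 2 * ENNReal.ofReal (Real.exp ((t - 0.8 * θ.p * K) / (2 * θ.b)))
  induction j generalizing w with
  | zero => simp [acceptProb]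
  | succ j ih =>
    set v := normalized w
    rw [acceptProb, Nat.cast_succ, add_mul, one_mul, add_comm]
    set a := (some '' S : Set (Option (Vec d))).indicator (1 : Option (Vec d) → ℝ≥0∞) (some v) with ha
    -- Stopping now matters only if v lies in S (a = 1); otherwise the remaining rounds are bounded
    -- by the induction hypothesis.
    calc _ ≤ sublistE (ENNReal.ofReal θ.p) (List.finRange n) (fun L =>
          a * (∫⁻ z, (if mistakeCount γ' X v L + z.1 < t then 1 else 0) ∂noiseLaw d θ) + j * η) := by
          refine sublistE_mono _ fun L => ?_
          have hm : Measurable fun z : ℝ × (Fin d → ℝ) =>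
              (if mistakeCount γ' X v L + z.1 < t then 1 else 0 : ℝ≥0∞) :=
            Measurable.ite (measurableSet_lt (by fun_prop) measurable_const) measurable_const
              measurable_const
          rw [← lintegral_const_mul _ hm]
          refine le_trans (lintegral_mono (g := fun z => a *
            (if mistakeCount γ' X v L + z.1 < t then 1 else 0) + j * η) fun z => ?_) ?_
          · unfold roundValue
            simp only
            split_ifs
            · rw [mul_one]; exact le_self_add
            · simpa using ih _
          · rw [lintegral_add_right _ measurable_const]
            simp
      _ = a * sublistE (ENNReal.ofReal θ.p) (List.finRange n) (fun L =>
          ∫⁻ z, (if mistakeCount γ' X v L + z.1 < t then 1 else 0) ∂noiseLaw d θ) + j * η := by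
          rw [sublistE_add, sublistE_const_mul, sublistE_const (ofReal_p_le_one θ)]
      _ ≤ η + j * η := by
          gcongr
          by_cases hv : v ∈ S
          · have : a = 1 := by simp [ha, hv]
            rw [this, one_mul]
            exact sublistE_stop_le hb X v (hK v hv (norm_normalized_le w)) t
          · have : a = 0 := by simp [ha, hv]
            simp [this]

end Utility

/-! ### Generalization with a margin -/

section Generalization

lemma integrable_finset_sup' {Ω ι : Type*} [MeasurableSpace Ω] {μ : Measure Ω} {V : Finset ι}
    (hV : V.Nonempty) {f : ι → Ω → ℝ} (hf : ∀ v ∈ V, Integrable (f v) μ) :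
    Integrable (fun x => V.sup' hV fun v => f v x) μ := by
  have e : (fun x => V.sup' hV fun v => f v x) = V.sup' hV f := by
    funext x; rw [Finset.sup'_apply]
  rw [e]
  exact Finset.sup'_induction hV f (p := fun g => Integrable g μ) (fun _ h₁ _ h₂ => h₁.sup h₂) hf

lemma measurable_finset_sup' {Ω ι : Type*} [MeasurableSpace Ω] {V : Finset ι}
    (hV : V.Nonempty) {f : ι → Ω → ℝ} (hf : ∀ v ∈ V, Measurable (f v)) :
    Measurable (fun x => V.sup' hV fun v => f v x) := by
  have e : (fun x => V.sup' hV fun v => f v x) = V.sup' hV f := by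
    funext x; rw [Finset.sup'_apply]
  rw [e]
  exact Finset.sup'_induction hV f (fun _ h₁ _ h₂ => h₁.sup h₂) hf

/-- Symmetrization of a single summand. -/
lemma integral_sup'_symmetrize {Ω ι : Type*} [MeasurableSpace Ω] {μ : Measure Ω}
    [IsProbabilityMeasure μ] {V : Finset ι} (hV : V.Nonempty) (A : ι → ℝ) {f : ι → Ω → ℝ}
    (hf : ∀ v, Integrable (f v) μ) :
    ∫ x, V.sup' hV (fun v => A v + ((∫ y, f v y ∂μ) - f v x)) ∂μ ≤
      ∫ x, ((V.sup' hV fun v => A v + 2 * f v x) + V.sup' hV fun v => A v - 2 * f v x) / 2 ∂μ := by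
  set P : Ω → ℝ := fun x => V.sup' hV fun v => A v + 2 * f v x
  set Q : Ω → ℝ := fun x => V.sup' hV fun v => A v - 2 * f v x
  have hP : Integrable P μ :=
    integrable_finset_sup' hV fun v _ => (integrable_const _).add ((hf v).const_mul 2)
  have hQ : Integrable Q μ :=
    integrable_finset_sup' hV fun v _ => (integrable_const _).sub ((hf v).const_mul 2)
  -- With an independent copy y, the supremum splits into two halves with opposite signs of f; their
  -- average plays the role of a Rademacher sign.
  have key : ∀ x y, V.sup' hV (fun v => A v + (f v y - f v x)) ≤ (P y + Q x) / 2 := by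
    intro x y
    refine Finset.sup'_le hV _ fun v hv => ?_
    have h1 : A v + 2 * f v y ≤ P y := Finset.le_sup' (fun v => A v + 2 * f v y) hv
    have h2 : A v - 2 * f v x ≤ Q x := Finset.le_sup' (fun v => A v - 2 * f v x) hv
    linarith
  have hx : ∀ x, V.sup' hV (fun v => A v + ((∫ y, f v y ∂μ) - f v x)) ≤
      ((∫ y, P y ∂μ) + Q x) / 2 := by
    intro x
    refine Finset.sup'_le hV _ fun v hv => ?_
    have h1 : ∫ y, (A v + 2 * f v y) ∂μ ≤ ∫ y, P y ∂μ :=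
      integral_mono ((integrable_const _).add ((hf v).const_mul 2)) hP fun y =>
        Finset.le_sup' (fun v => A v + 2 * f v y) hv
    rw [integral_add (integrable_const _) ((hf v).const_mul 2), integral_const_mul] at h1
    simp only [integral_const, probReal_univ, one_smul] at h1
    have h2 : A v - 2 * f v x ≤ Q x := Finset.le_sup' (fun v => A v - 2 * f v x) hv
    linarith
  calc _ ≤ ∫ x, ((∫ y, P y ∂μ) + Q x) / 2 ∂μ := by
        refine integral_mono (integrable_finset_sup' hV fun v _ =>
          (integrable_const _).add ((integrable_const _).sub (hf v)))
          (((integrable_const _).add hQ).div_const 2) hx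
    _ = _ := by
        rw [integral_div, integral_div, integral_add (integrable_const _) hQ, integral_add hP hQ]
        simp

/-- Contraction: a `K`-Lipschitz function can be replaced by `K` times its argument. -/
lemma sup'_contraction {ι : Type*} {V : Finset ι} (hV : V.Nonempty) (A t : ι → ℝ) {φ : ℝ → ℝ}
    {K : ℝ} (hφ : ∀ x y, φ x - φ y ≤ K * |x - y|) :
    (V.sup' hV fun v => A v + 2 * φ (t v)) + (V.sup' hV fun v => A v - 2 * φ (t v)) ≤
      (V.sup' hV fun v => A v + 2 * K * t v) + V.sup' hV fun v => A v - 2 * K * t v := by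
  -- Let v and u maximize the two suprema on the left. On the right they serve in this order or
  -- interchanged, according to the sign of t v - t u.
  obtain ⟨v, hv, e1⟩ := Finset.exists_mem_eq_sup' hV fun v => A v + 2 * φ (t v)
  obtain ⟨u, hu, e2⟩ := Finset.exists_mem_eq_sup' hV fun v => A v - 2 * φ (t v)
  rw [e1, e2]
  have h := hφ (t v) (t u)
  have p1 := Finset.le_sup' (fun v => A v + 2 * K * t v) hv
  have p2 := Finset.le_sup' (fun v => A v + 2 * K * t v) hu
  have q1 := Finset.le_sup' (fun v => A v - 2 * K * t v) hv
  have q2 := Finset.le_sup' (fun v => A v - 2 * K * t v) hu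
  rcases abs_cases (t v - t u) with ⟨h', _⟩ | ⟨h', _⟩ <;> rw [h'] at h <;> linarith

lemma sqrt_add_sqrt_le {s c : ℝ} (h1 : 0 ≤ s + c) (h2 : 0 ≤ s - c) :
    (√(s + c) + √(s - c)) / 2 ≤ √s := by
  refine Real.le_sqrt_of_sq_le ?_
  nlinarith [Real.sq_sqrt h1, Real.sq_sqrt h2, sq_nonneg (√(s + c) - √(s - c))]

variable {d : ℕ} {Ω : Type*} [MeasurableSpace Ω]

/-- The deviation of the empirical from the expected loss of `v` on a dataset. -/
def deviation (D : Measure Ω) (x : Ω → Vec d) (φ : ℝ → ℝ) {k : ℕ} (ω : Fin k → Ω) (v : Vec d) : ℝ :=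
  ∑ j, ((∫ y, φ (inner ℝ v (x y)) ∂D) - φ (inner ℝ v (x (ω j))))

variable {D : Measure Ω} {x : Ω → Vec d} {φ : ℝ → ℝ} {K : ℝ}

lemma deviation_zero [IsProbabilityMeasure D] {k : ℕ} (ω : Fin k → Ω) : deviation D x φ ω 0 = 0 := by
  simp [deviation]

lemma deviation_cons {k : ℕ} (a : Ω) (ω : Fin k → Ω) (v : Vec d) :
    deviation D x φ (Fin.cons a ω : Fin (k + 1) → Ω) v =
      ((∫ y, φ (inner ℝ v (x y)) ∂D) - φ (inner ℝ v (x a))) + deviation D x φ ω v := by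
  rw [deviation, Fin.sum_univ_succ]
  simp only [Fin.cons_zero, Fin.cons_succ]
  rfl

lemma measurable_deviation (hx : Measurable x) (hφ : Measurable φ) {k : ℕ} (v : Vec d) :
    Measurable fun ω : Fin k → Ω => deviation D x φ ω v := by
  unfold deviation
  fun_prop

variable [IsProbabilityMeasure D]

/-- Symmetrization followed by contraction, for one sample. The vector 0 in V, where A vanishes,
makes all integrands nonnegative, so that truncation by `ENNReal.ofReal` loses nothing. -/
lemma lintegral_sup'_step (hx : Measurable x) (hφm : Measurable φ)
    (hφ0 : ∀ t, |φ t| ≤ 1) (hφ : ∀ s t, φ s - φ t ≤ K * |s - t|) (hxb : ∀ y, ‖x y‖ ≤ 1)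
    {V : Finset (Vec d)} (hV : V.Nonempty) (hV0 : (0 : Vec d) ∈ V) (A : Vec d → ℝ) (hA : A 0 = 0) :
    ∫⁻ y, ENNReal.ofReal (V.sup' hV fun v =>
        A v + ((∫ y, φ (inner ℝ v (x y)) ∂D) - φ (inner ℝ v (x y)))) ∂D ≤
      ∫⁻ y, ENNReal.ofReal (((V.sup' hV fun v => A v + 2 * K * inner ℝ v (x y)) +
        V.sup' hV fun v => A v - 2 * K * inner ℝ v (x y)) / 2) ∂D := by
  have hf : ∀ v : Vec d, Integrable (fun y => φ (inner ℝ v (x y))) D := fun v =>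
    Integrable.of_bound
      (by fun_prop : Measurable fun y => φ (inner ℝ v (x y))).aestronglyMeasurable 1 (Filter.Eventually.of_forall fun y => hφ0 _)
  have hin : ∀ v : Vec d, Integrable (fun y => inner ℝ v (x y)) D := fun v =>
    Integrable.of_bound (by fun_prop) ‖v‖ (Filter.Eventually.of_forall fun y =>
      (norm_inner_le_norm v (x y)).trans (mul_le_of_le_one_right (norm_nonneg v) (hxb y)))
  have hP : Integrable (fun y => V.sup' hV fun v => A v + 2 * K * inner ℝ v (x y)) D :=
    integrable_finset_sup' hV fun v _ => (integrable_const _).add ((hin v).const_mul _)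
  have hQ : Integrable (fun y => V.sup' hV fun v => A v - 2 * K * inner ℝ v (x y)) D :=
    integrable_finset_sup' hV fun v _ => (integrable_const _).sub ((hin v).const_mul _)
  have hP' : Integrable (fun y => V.sup' hV fun v => A v + 2 * φ (inner ℝ v (x y))) D :=
    integrable_finset_sup' hV fun v _ => (integrable_const _).add ((hf v).const_mul _)
  have hQ' : Integrable (fun y => V.sup' hV fun v => A v - 2 * φ (inner ℝ v (x y))) D :=
    integrable_finset_sup' hV fun v _ => (integrable_const _).sub ((hf v).const_mul _)
  rw [← ofReal_integral_eq_lintegral_ofReal, ← ofReal_integral_eq_lintegral_ofReal]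
  · refine ENNReal.ofReal_le_ofReal ((integral_sup'_symmetrize hV A hf).trans ?_)
    refine integral_mono ((hP'.add hQ').div_const 2) ((hP.add hQ).div_const 2) fun y => ?_
    have := sup'_contraction hV A (fun v => inner ℝ v (x y)) hφ
    linarith
  · exact (hP.add hQ).div_const 2
  · refine Filter.Eventually.of_forall fun y => ?_
    have h1 := Finset.le_sup' (fun v => A v + 2 * K * inner ℝ v (x y)) hV0
    have h2 := Finset.le_sup' (fun v => A v - 2 * K * inner ℝ v (x y)) hV0
    simp only [hA, inner_zero_left, mul_zero, add_zero, sub_zero] at h1 h2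
    simp only [Pi.zero_apply]
    linarith
  · exact integrable_finset_sup' hV fun v _ =>
      (integrable_const _).add ((integrable_const _).sub (hf v))
  · refine Filter.Eventually.of_forall fun y => ?_
    have h1 := Finset.le_sup' (fun v =>
        A v + ((∫ y, φ (inner ℝ v (x y)) ∂D) - φ (inner ℝ v (x y)))) hV0
    simp only [hA, inner_zero_left, integral_const, probReal_univ, one_smul, sub_self,
      add_zero] at h1
    exact h1

/-- The expected largest deviation over a finite set of vectors in the unit ball; the bound does
not depend on the dimension. -/
lemma lintegral_sup'_deviation_le (hx : Measurable x) (hφm : Measurable φ)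
    (hφ0 : ∀ t, |φ t| ≤ 1) (hφ : ∀ s t, φ s - φ t ≤ K * |s - t|) (hxb : ∀ y, ‖x y‖ ≤ 1)
    {V : Finset (Vec d)} (hV : V.Nonempty) (hV0 : (0 : Vec d) ∈ V) (hV1 : ∀ v ∈ V, ‖v‖ ≤ 1)
    (k : ℕ) (a : Vec d) :
    ∫⁻ ω, ENNReal.ofReal (V.sup' hV fun v => inner ℝ v a + deviation D x φ ω v)
        ∂(Measure.pi fun _ : Fin k => D) ≤
      ENNReal.ofReal (√(‖a‖ ^ 2 + (2 * K) ^ 2 * k)) := by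
  -- The vector a collects the terms ±2K x of the samples already processed, so it has to vary in
  -- the induction.
  induction k generalizing a with
  | zero =>
    calc _ ≤ ∫⁻ ω, ENNReal.ofReal ‖a‖ ∂(Measure.pi fun _ : Fin 0 => D) := by
          refine lintegral_mono fun ω => ENNReal.ofReal_le_ofReal ?_
          refine Finset.sup'_le hV _ fun v hv => ?_
          simp only [deviation, Finset.univ_eq_empty, Finset.sum_empty, add_zero]
          exact (real_inner_le_norm v a).trans (mul_le_of_le_one_left (norm_nonneg a) (hV1 v hv))
      _ = _ := by simp [Real.sqrt_sq]
  | succ k ih =>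
    have hdev := fun v : Vec d => measurable_deviation (D := D) hx hφm (k := k) v
    have hm1 : Measurable fun ω : Fin (k + 1) → Ω => ENNReal.ofReal
        (V.sup' hV fun v => inner ℝ v a + deviation D x φ ω v) :=
      (measurable_finset_sup' hV fun v _ =>
        measurable_const.add (measurable_deviation hx hφm v)).ennreal_ofReal
    have hm2 : Measurable fun q : Ω × (Fin k → Ω) => ENNReal.ofReal
        (V.sup' hV fun v => (inner ℝ v a + deviation D x φ q.2 v) +
          ((∫ y, φ (inner ℝ v (x y)) ∂D) - φ (inner ℝ v (x q.1)))) :=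
      (measurable_finset_sup' hV fun v _ => by have := hdev v; fun_prop).ennreal_ofReal
    have hp : Measurable fun q : Ω × (Fin k → Ω) => V.sup' hV fun v =>
        (inner ℝ v a + deviation D x φ q.2 v) + 2 * K * inner ℝ v (x q.1) :=
      measurable_finset_sup' hV fun v _ => by have := hdev v; fun_prop
    have hq : Measurable fun q : Ω × (Fin k → Ω) => V.sup' hV fun v =>
        (inner ℝ v a + deviation D x φ q.2 v) - 2 * K * inner ℝ v (x q.1) :=
      measurable_finset_sup' hV fun v _ => by have := hdev v; fun_prop
    have hp0 : ∀ (y : Ω) (ω : Fin k → Ω), 0 ≤ V.sup' hV fun v =>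
        (inner ℝ v a + deviation D x φ ω v) + 2 * K * inner ℝ v (x y) := fun y ω => by
      have := Finset.le_sup' (fun v =>
        (inner ℝ v a + deviation D x φ ω v) + 2 * K * inner ℝ v (x y)) hV0
      simp only [deviation_zero, inner_zero_left, mul_zero, add_zero] at this
      exact this
    have hq0 : ∀ (y : Ω) (ω : Fin k → Ω), 0 ≤ V.sup' hV fun v =>
        (inner ℝ v a + deviation D x φ ω v) - 2 * K * inner ℝ v (x y) := fun y ω => by
      have := Finset.le_sup' (fun v =>
        (inner ℝ v a + deviation D x φ ω v) - 2 * K * inner ℝ v (x y)) hV0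
      simp only [deviation_zero, inner_zero_left, mul_zero, add_zero, sub_zero] at this
      exact this
    have ep : ∀ (y : Ω) (ω : Fin k → Ω) (v : Vec d),
        (inner ℝ v a + deviation D x φ ω v) + 2 * K * inner ℝ v (x y) =
          inner ℝ v (a + (2 * K) • x y) + deviation D x φ ω v := fun y ω v => by
      rw [inner_add_right, inner_smul_right]; ring
    have eq : ∀ (y : Ω) (ω : Fin k → Ω) (v : Vec d),
        (inner ℝ v a + deviation D x φ ω v) - 2 * K * inner ℝ v (x y) =
          inner ℝ v (a - (2 * K) • x y) + deviation D x φ ω v := fun y ω v => by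
      rw [inner_sub_right, inner_smul_right]; ring
    rw [lintegral_pi_cons _ _ _ hm1]
    calc _ = ∫⁻ y, ∫⁻ ω, ENNReal.ofReal (V.sup' hV fun v => (inner ℝ v a + deviation D x φ ω v) +
            ((∫ y, φ (inner ℝ v (x y)) ∂D) - φ (inner ℝ v (x y))))
            ∂(Measure.pi fun _ : Fin k => D) ∂D := by
          refine lintegral_congr fun y => lintegral_congr fun ω => ?_
          congr 2
          funext v
          rw [deviation_cons]
          ring
      -- The new sample is averaged first, with the others held fixed; afterwards the order is
      -- restored for the induction hypothesis.
      _ = ∫⁻ ω, ∫⁻ y, ENNReal.ofReal (V.sup' hV fun v => (inner ℝ v a + deviation D x φ ω v) +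
            ((∫ y, φ (inner ℝ v (x y)) ∂D) - φ (inner ℝ v (x y)))) ∂D
            ∂(Measure.pi fun _ : Fin k => D) := lintegral_lintegral_swap hm2.aemeasurable
      _ ≤ ∫⁻ ω, ∫⁻ y, ENNReal.ofReal (((V.sup' hV fun v =>
            (inner ℝ v a + deviation D x φ ω v) + 2 * K * inner ℝ v (x y)) + V.sup' hV fun v =>
            (inner ℝ v a + deviation D x φ ω v) - 2 * K * inner ℝ v (x y)) / 2) ∂D
            ∂(Measure.pi fun _ : Fin k => D) := by
          refine lintegral_mono fun ω => ?_
          exact lintegral_sup'_step hx hφm hφ0 hφ hxb hV hV0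
            (fun v => inner ℝ v a + deviation D x φ ω v) (by simp [deviation_zero])
      _ = ∫⁻ y, ∫⁻ ω, ENNReal.ofReal (((V.sup' hV fun v =>
            (inner ℝ v a + deviation D x φ ω v) + 2 * K * inner ℝ v (x y)) + V.sup' hV fun v =>
            (inner ℝ v a + deviation D x φ ω v) - 2 * K * inner ℝ v (x y)) / 2)
            ∂(Measure.pi fun _ : Fin k => D) ∂D :=
          (lintegral_lintegral_swap (((hp.add hq).div_const 2).ennreal_ofReal.aemeasurable)).symm
      _ ≤ ∫⁻ y, ENNReal.ofReal (√(‖a‖ ^ 2 + (2 * K) ^ 2 * ((k + 1 : ℕ) : ℝ))) ∂D := by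
          refine lintegral_mono fun y => ?_
          have hsplit : ∀ ω : Fin k → Ω, ENNReal.ofReal (((V.sup' hV fun v =>
              (inner ℝ v a + deviation D x φ ω v) + 2 * K * inner ℝ v (x y)) + V.sup' hV fun v =>
              (inner ℝ v a + deviation D x φ ω v) - 2 * K * inner ℝ v (x y)) / 2) =
              ENNReal.ofReal (1 / 2) * (ENNReal.ofReal (V.sup' hV fun v =>
                inner ℝ v (a + (2 * K) • x y) + deviation D x φ ω v) +
              ENNReal.ofReal (V.sup' hV fun v =>
                inner ℝ v (a - (2 * K) • x y) + deviation D x φ ω v)) := fun ω => by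
            have h1 := hp0 y ω
            have h2 := hq0 y ω
            simp only [ep, eq] at h1 h2 ⊢
            rw [← ENNReal.ofReal_add h1 h2, ← ENNReal.ofReal_mul (by norm_num)]
            congr 1
            ring
          simp only [hsplit]
          have hma : ∀ c : Vec d, Measurable fun ω : Fin k → Ω => ENNReal.ofReal
              (V.sup' hV fun v => inner ℝ v c + deviation D x φ ω v) := fun c =>
            (measurable_finset_sup' hV fun v _ => measurable_const.add (hdev v)).ennreal_ofReal
          have hma2 : Measurable fun ω : Fin k → Ω => ENNReal.ofReal
              (V.sup' hV fun v => inner ℝ v (a + (2 * K) • x y) + deviation D x φ ω v) +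
              ENNReal.ofReal
              (V.sup' hV fun v => inner ℝ v (a - (2 * K) • x y) + deviation D x φ ω v) :=
            (hma _).add (hma _)
          rw [lintegral_const_mul _ hma2, lintegral_add_left (hma _)]
          refine (mul_le_mul_right (add_le_add (ih _) (ih _)) _).trans ?_
          rw [← ENNReal.ofReal_add (Real.sqrt_nonneg _) (Real.sqrt_nonneg _),
            ← ENNReal.ofReal_mul (by norm_num)]
          refine ENNReal.ofReal_le_ofReal ?_
          -- The cross terms ±c of ‖a ± 2K x‖² cancel by concavity of the square root, so each
          -- sample adds at most (2K)² under the root.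
          set s := ‖a‖ ^ 2 + ‖(2 * K) • x y‖ ^ 2 + (2 * K) ^ 2 * k
          set c := 2 * inner ℝ a ((2 * K) • x y)
          have e1 : ‖a + (2 * K) • x y‖ ^ 2 + (2 * K) ^ 2 * k = s + c := by
            rw [norm_add_sq_real]; simp only [s, c]; ring
          have e2 : ‖a - (2 * K) • x y‖ ^ 2 + (2 * K) ^ 2 * k = s - c := by
            rw [norm_sub_sq_real]; simp only [s, c]; ring
          have h3 := sqrt_add_sqrt_le (s := s) (c := c) (by rw [← e1]; positivity)
            (by rw [← e2]; positivity)
          rw [e1, e2]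
          refine le_trans (le_of_eq (by ring)) (h3.trans (Real.sqrt_le_sqrt ?_))
          have h4 : ‖(2 * K) • x y‖ ^ 2 ≤ (2 * K) ^ 2 := by
            rw [norm_smul, mul_pow, Real.norm_eq_abs, sq_abs]
            exact mul_le_of_le_one_right (sq_nonneg _) (pow_le_one₀ (norm_nonneg _) (hxb y))
          simp only [s]
          push_cast
          linarith
      _ = _ := by simp

lemma measure_sup'_deviation_le (hx : Measurable x) (hφm : Measurable φ)
    (hφ0 : ∀ t, |φ t| ≤ 1) (hφ : ∀ s t, φ s - φ t ≤ K * |s - t|) (hK : 0 ≤ K)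
    (hxb : ∀ y, ‖x y‖ ≤ 1) {V : Finset (Vec d)} (hV : V.Nonempty) (hV0 : (0 : Vec d) ∈ V)
    (hV1 : ∀ v ∈ V, ‖v‖ ≤ 1) (k : ℕ) {c : ℝ} (hc : 0 < c) :
    (Measure.pi fun _ : Fin k => D) {ω | ∃ v ∈ V, c < deviation D x φ ω v} ≤
      ENNReal.ofReal (2 * K * √k / c) := by
  have h := lintegral_sup'_deviation_le (D := D) hx hφm hφ0 hφ hxb hV hV0 hV1 k 0
  simp only [inner_zero_right, zero_add, norm_zero, ne_eq, OfNat.ofNat_ne_zero, not_false_eq_true,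
    zero_pow] at h
  rw [Real.sqrt_mul (by positivity), Real.sqrt_sq (by positivity)] at h
  have hm : Measurable fun ω : Fin k → Ω => ENNReal.ofReal
      (V.sup' hV fun v => deviation D x φ ω v) :=
    (measurable_finset_sup' hV fun v _ => measurable_deviation hx hφm v).ennreal_ofReal
  have hmar := mul_meas_ge_le_lintegral (μ := Measure.pi fun _ : Fin k => D) hm (ENNReal.ofReal c)
  rw [ENNReal.ofReal_div_of_pos hc,
    ENNReal.le_div_iff_mul_le (.inl (by simpa using hc)) (.inl ENNReal.ofReal_ne_top), mul_comm]
  refine le_trans ?_ (hmar.trans h)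
  refine mul_le_mul_right (measure_mono ?_) _
  rintro ω ⟨v, hv, hcv⟩
  exact ENNReal.ofReal_le_ofReal (hcv.le.trans (Finset.le_sup' (fun v => deviation D x φ ω v) hv))

lemma continuous_deviation (hx : Measurable x) (hφc : Continuous φ)
    (hφ0 : ∀ t, |φ t| ≤ 1) {k : ℕ} (ω : Fin k → Ω) :
    Continuous fun v => deviation D x φ ω v := by
  have h1 : Continuous fun v : Vec d => ∫ y, φ (inner ℝ v (x y)) ∂D := by
    refine continuous_of_dominated (bound := fun _ => 1) (fun v => ?_) (fun v => ?_)
      (integrable_const _) (Filter.Eventually.of_forall fun y => ?_)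
    · have := hφc.measurable
      fun_prop
    · exact Filter.Eventually.of_forall fun y => hφ0 _
    · fun_prop
  unfold deviation
  fun_prop

/-- The probability of a large deviation for some vector of the unit ball. -/
lemma measure_deviation_le (hx : Measurable x) (hφc : Continuous φ)
    (hφ0 : ∀ t, |φ t| ≤ 1) (hφ : ∀ s t, φ s - φ t ≤ K * |s - t|) (hK : 0 ≤ K)
    (hxb : ∀ y, ‖x y‖ ≤ 1) (k : ℕ) {c : ℝ} (hc : 0 < c) :
    (Measure.pi fun _ : Fin k => D) {ω | ∃ v : Vec d, ‖v‖ ≤ 1 ∧ c < deviation D x φ ω v} ≤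
      ENNReal.ofReal (2 * K * √k / c) := by
  have : Nonempty (Ball d) := ⟨⟨0, by simp⟩⟩
  -- Finite initial pieces of a dense sequence exhaust the event: the deviation is continuous in v,
  -- so a strict excess at some v also occurs at a point of the sequence.
  let V : ℕ → Finset (Vec d) := fun N =>
    insert 0 ((Finset.range N).image fun i => (TopologicalSpace.denseSeq (Ball d) i : Vec d))
  have hV0 : ∀ N, (0 : Vec d) ∈ V N := fun N => Finset.mem_insert_self _ _
  have hV1 : ∀ N, ∀ v ∈ V N, ‖v‖ ≤ 1 := by
    intro N v hv
    rcases Finset.mem_insert.1 hv with rfl | hv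
    · simp
    · obtain ⟨i, _, rfl⟩ := Finset.mem_image.1 hv
      exact mem_closedBall_zero_iff.1 (TopologicalSpace.denseSeq (Ball d) i).2
  have hmono : Monotone fun N => {ω : Fin k → Ω | ∃ v ∈ V N, c < deviation D x φ ω v} := by
    intro N N' h ω ⟨v, hv, hcv⟩
    exact ⟨v, Finset.insert_subset_insert _
      (Finset.image_subset_image (Finset.range_subset_range.2 h)) hv, hcv⟩
  refine le_trans (measure_mono (t := ⋃ N, {ω | ∃ v ∈ V N, c < deviation D x φ ω v}) ?_) ?_
  · rintro ω ⟨v, hv, hcv⟩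
    have hopen : IsOpen {u : Ball d | c < deviation D x φ ω (u : Vec d)} :=
      isOpen_lt continuous_const
        ((continuous_deviation hx hφc hφ0 ω).comp continuous_subtype_val)
    obtain ⟨u, hu, i, rfl⟩ := (TopologicalSpace.denseRange_denseSeq (Ball d)).exists_mem_open hopen
      ⟨⟨v, mem_closedBall_zero_iff.2 hv⟩, hcv⟩ |> fun ⟨i, hi⟩ =>
        (⟨_, hi, i, rfl⟩ : ∃ u : Ball d, c < deviation D x φ ω (u : Vec d) ∧
          ∃ i, TopologicalSpace.denseSeq (Ball d) i = u)
    refine Set.mem_iUnion.2 ⟨i + 1, _, Finset.mem_insert_of_mem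
      (Finset.mem_image_of_mem _ (Finset.self_mem_range_succ i)), hu⟩
  · rw [hmono.measure_iUnion]
    exact iSup_le fun N =>
      measure_sup'_deviation_le hx hφc.measurable hφ0 hφ hK hxb ⟨0, hV0 N⟩ (hV0 N) (hV1 N) k hc

end Generalization

/-! ### Robust learning -/

section Learning

variable {d n : ℕ} {γ α : ℝ}

/-- The ramp loss between the margins `0.9 γ` and `0.95 γ`. -/
def ramp (γ t : ℝ) : ℝ := max 0 (min 1 (19 - 20 / γ * t))

lemma continuous_ramp (γ : ℝ) : Continuous (ramp γ) := by
  unfold ramp; fun_prop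

lemma ramp_nonneg (γ t : ℝ) : 0 ≤ ramp γ t := le_max_left _ _

lemma ramp_le_one (γ t : ℝ) : ramp γ t ≤ 1 := max_le zero_le_one (min_le_left _ _)

lemma ramp_sub_le (hγ : 0 < γ) (s t : ℝ) : ramp γ s - ramp γ t ≤ 20 / γ * |s - t| := by
  have hK : 0 < 20 / γ := by positivity
  have h : 20 / γ * t - 20 / γ * s ≤ 20 / γ * |s - t| := by
    rw [← mul_sub]
    exact mul_le_mul_of_nonneg_left ((le_abs_self _).trans (abs_sub_comm t s).le) hK.le
  have h0 : 0 ≤ 20 / γ * |s - t| := by positivity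
  unfold ramp
  rw [sub_le_iff_le_add]
  refine max_le ?_ ?_
  · have := le_max_left 0 (min 1 (19 - 20 / γ * t))
    linarith
  · have h1 := le_max_right 0 (min 1 (19 - 20 / γ * t))
    rcases min_cases 1 (19 - 20 / γ * t) with ⟨e, -⟩ | ⟨e, -⟩ <;> rw [e] at h1 ⊢
    · linarith [min_le_left 1 (19 - 20 / γ * s)]
    · linarith [min_le_right 1 (19 - 20 / γ * s)]

lemma ramp_eq_one (hγ : 0 < γ) {t : ℝ} (ht : t ≤ 0.9 * γ) : ramp γ t = 1 := by
  have h : 20 / γ * t ≤ 18 := by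
    rw [div_mul_eq_mul_div, div_le_iff₀ hγ]; linarith
  rw [ramp, min_eq_left (by linarith), max_eq_right zero_le_one]

lemma ramp_eq_zero (hγ : 0 < γ) {t : ℝ} (ht : 0.95 * γ ≤ t) : ramp γ t = 0 := by
  have h : 19 ≤ 20 / γ * t := by
    rw [div_mul_eq_mul_div, le_div_iff₀ hγ]; linarith
  exact max_eq_left ((min_le_right _ _).trans (by linarith))

lemma sum_ramp_le_mistakeCount (hγ : 0 < γ) (X : Fin n → Sample d) (v : Vec d) :
    ∑ j, ramp γ (inner ℝ v (signed (X j))) ≤ mistakeCount (0.95 * γ) X v (List.finRange n) := by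
  have key : ∀ L : List (Fin n), (L.map fun j => ramp γ (inner ℝ v (signed (X j)))).sum ≤
      mistakeCount (0.95 * γ) X v L := by
    intro L
    induction L with
    | nil => simp [mistakeCount, mistakeList]
    | cons j L ih =>
      rw [List.map_cons, List.sum_cons, mistakeCount_cons]
      refine add_le_add ?_ ih
      split_ifs with h
      · exact ramp_le_one _ _
      · exact (ramp_eq_zero hγ (not_lt.1 fun h' => h (isMistake_of_inner_signed_lt h'))).le
  rw [← List.sum_ofFn, List.ofFn_eq_map]
  exact key _

/-- Samples on which some vector of the unit ball makes few mistakes but has a large loss are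
unlikely. -/
lemma measure_generalization_le (D : Measure (Sample d)) [IsProbabilityMeasure D] (hγ : 0 < γ)
    (hα : 0 < α) (hn : 0 < n) :
    (Measure.pi fun _ : Fin n => D) {X | ∃ v : Vec d, ‖v‖ ≤ 1 ∧
        ENNReal.ofReal α < D {e | inner ℝ v (signed e) ≤ 0.9 * γ} ∧
        mistakeCount (0.95 * γ) X v (List.finRange n) < α * n / 2} ≤
      ENNReal.ofReal (80 / (γ * α * √n)) := by
  have hn' : (0 : ℝ) < n := Nat.cast_pos.2 hn
  have h := measure_deviation_le (D := D) measurable_signed (continuous_ramp γ)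
    (fun t => by rw [abs_of_nonneg (ramp_nonneg γ t)]; exact ramp_le_one γ t) (ramp_sub_le hγ)
    (by positivity) norm_signed_le n (c := α * n / 2) (by positivity)
  refine (measure_mono ?_).trans (h.trans (ENNReal.ofReal_le_ofReal (le_of_eq ?_)))
  · rintro X ⟨v, hv, hD, hc⟩
    refine ⟨v, hv, ?_⟩
    have hms : MeasurableSet {e : Sample d | inner ℝ v (signed e) ≤ 0.9 * γ} :=
      measurableSet_le (by fun_prop) measurable_const
    have hr : Measurable fun e : Sample d => ramp γ (inner ℝ v (signed e)) :=
      (continuous_ramp γ).measurable.comp (by fun_prop)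
    have hint : Integrable (fun e : Sample d => ramp γ (inner ℝ v (signed e))) D :=
      Integrable.of_bound hr.aestronglyMeasurable 1 (Filter.Eventually.of_forall fun e => by
        rw [Real.norm_eq_abs, abs_of_nonneg (ramp_nonneg _ _)]; exact ramp_le_one _ _)
    have h1 : α < D.real {e | inner ℝ v (signed e) ≤ 0.9 * γ} :=
      (ENNReal.ofReal_lt_iff_lt_toReal hα.le (measure_ne_top _ _)).1 hD
    have h2 : D.real {e | inner ℝ v (signed e) ≤ 0.9 * γ} ≤
        ∫ e, ramp γ (inner ℝ v (signed e)) ∂D := by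
      rw [← integral_indicator_one hms]
      refine integral_mono ((integrable_const _).indicator hms) hint fun e => ?_
      by_cases he : inner ℝ v (signed e) ≤ 0.9 * γ
      · rw [Set.indicator_of_mem (by exact he), ramp_eq_one hγ he, Pi.one_apply]
      · rw [Set.indicator_of_notMem (by exact he)]
        exact ramp_nonneg _ _
    have h3 := sum_ramp_le_mistakeCount hγ X v
    rw [deviation, Finset.sum_sub_distrib, Finset.sum_const, Finset.card_univ, Fintype.card_fin,
      nsmul_eq_mul]
    have h4 : (n : ℝ) * α ≤ n * ∫ e, ramp γ (inner ℝ v (signed e)) ∂D :=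
      mul_le_mul_of_nonneg_left (h1.le.trans h2) hn'.le
    linarith
  · have := Real.mul_self_sqrt hn'.le
    have h0 : 0 < √(n : ℝ) := Real.sqrt_pos.2 hn'
    field_simp
    nlinarith

lemma sgn_ne_of_mul_neg {t : ℝ} {y : ℤˣ} (h : ((y : ℤ) : ℝ) * t < 0) : sgn t ≠ y := by
  unfold sgn
  rcases int_units_cases y with rfl | rfl
  · simp only [Units.val_one, Int.cast_one, one_mul] at h
    rw [if_neg (not_le.2 h)]; decide
  · simp only [Units.val_neg, Units.val_one, Int.cast_neg, Int.cast_one, neg_mul, one_mul,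
      neg_lt_zero] at h
    rw [if_pos h.le]; decide

lemma mul_nonpos_of_sgn_ne {t : ℝ} {y : ℤˣ} (h : sgn t ≠ y) : ((y : ℤ) : ℝ) * t ≤ 0 := by
  unfold sgn at h
  rcases int_units_cases y with rfl | rfl
  · simp only [Units.val_one, Int.cast_one, one_mul]
    by_contra hc
    exact h (if_pos (not_le.1 hc).le)
  · simp only [Units.val_neg, Units.val_one, Int.cast_neg, Int.cast_one, neg_mul, one_mul]
    by_contra hc
    exact h (if_neg (by linarith))

lemma label_mul_self (y : ℤˣ) : ((y : ℤ) : ℝ) * ((y : ℤ) : ℝ) = 1 := by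
  rcases int_units_cases y with rfl | rfl <;> simp

lemma norm_label_smul (y : ℤˣ) (v : Vec d) : ‖((y : ℤ) : ℝ) • v‖ = ‖v‖ := by
  rcases int_units_cases y with rfl | rfl <;> simp

/-- A point of the unit ball with margin less than `γ` can be moved across the hyperplane within
the ball. -/
lemma exists_inner_neg_of_inner_lt {ws u : Vec d} (hws : ‖ws‖ = 1) (hu : ‖u‖ ≤ 1) (hγ : 0 ≤ γ)
    (hγ1 : γ ≤ 1) (h : inner ℝ ws u < γ) :
    ∃ z : Vec d, ‖z‖ ≤ 1 ∧ ‖z - u‖ ≤ γ ∧ inner ℝ ws z < 0 := by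
  rcases lt_or_ge (inner ℝ ws u) 0 with hc | hc
  · exact ⟨u, hu, by simpa using hγ, hc⟩
  set c := inner ℝ ws u
  -- Shrinking the part of u orthogonal to ws by 1 - s makes room for a component -s along ws inside
  -- the ball. The displacement is at most s + (s + c) = γ.
  set s := (γ - c) / 2 with hs
  have hs0 : 0 < s := by linarith
  have hs1 : s ≤ 1 := by linarith
  have hws2 : inner ℝ ws ws = 1 := by rw [real_inner_self_eq_norm_sq, hws, one_pow]
  have hr : ‖u - c • ws‖ ≤ 1 := by
    have h1 : ‖u - c • ws‖ ^ 2 = ‖u‖ ^ 2 - c ^ 2 := by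
      rw [norm_sub_sq_real, inner_smul_right, norm_smul, hws, mul_one, Real.norm_eq_abs, sq_abs,
        real_inner_comm]
      ring
    nlinarith [norm_nonneg u, norm_nonneg (u - c • ws), sq_nonneg c]
  refine ⟨(1 - s) • (u - c • ws) - s • ws, ?_, ?_, ?_⟩
  · refine (norm_sub_le _ _).trans ?_
    rw [norm_smul, norm_smul, hws, Real.norm_of_nonneg (by linarith), Real.norm_of_nonneg hs0.le]
    nlinarith [norm_nonneg (u - c • ws)]
  · have e : (1 - s) • (u - c • ws) - s • ws - u = -(s • (u - c • ws) + (s + c) • ws) := by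
      module
    rw [e, norm_neg]
    refine (norm_add_le _ _).trans ?_
    rw [norm_smul, norm_smul, hws, Real.norm_of_nonneg hs0.le, Real.norm_of_nonneg (by linarith)]
    nlinarith [norm_nonneg (u - c • ws)]
  · rw [inner_sub_right, inner_smul_right, inner_sub_right, inner_smul_right, inner_smul_right,
      hws2]
    simp only [mul_one]
    change (1 - s) * (c - c) - s < 0
    linarith

/-- An example with smaller margin could be pushed across the hyperplane within the ball, and would
then belong to the event of probability zero. -/
lemma Realizable.exists_margin {D : Measure (Sample d)} (hD : Realizable γ D) (hγ : 0 ≤ γ)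
    (hγ1 : γ ≤ 1) : ∃ ws : Vec d, ‖ws‖ = 1 ∧ ∀ᵐ e ∂D, γ ≤ inner ℝ ws (signed e) := by
  obtain ⟨w, hw, h0⟩ := hD
  have hw' : 0 < ‖w‖ := norm_pos_iff.2 hw
  have hws : ‖normalized w‖ = 1 := by
    rw [normalized, norm_smul, norm_inv, norm_norm, inv_mul_cancel₀ hw'.ne']
  refine ⟨normalized w, hws, measure_mono_null (fun e he => ?_) h0⟩
  obtain ⟨z, hz1, hzd, hz⟩ :=
    exists_inner_neg_of_inner_lt hws (norm_signed_le e) hγ hγ1 (not_le.1 he)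
  refine ⟨⟨((e.2 : ℤ) : ℝ) • z, mem_closedBall_zero_iff.2 (by rwa [norm_label_smul])⟩, ?_, ?_⟩
  · rw [← norm_label_smul e.2, smul_sub, smul_smul, label_mul_self, one_smul]
    exact hzd
  · refine sgn_ne_of_mul_neg ?_
    rw [inner_smul_right, ← mul_assoc, label_mul_self, one_mul, ← norm_smul_normalized w,
      inner_smul_left]
    exact mul_neg_of_pos_of_neg (by simpa using hw') hz

/-- For ‖w‖ ≤ 1 a perturbation of size γ' changes the signed margin by at most γ', by
Cauchy–Schwarz. -/
lemma robustRisk_le {γ' : ℝ} {w : Vec d} (hw : ‖w‖ ≤ 1) (D : Measure (Sample d)) :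
    robustRisk γ' (halfspace w) D ≤ D {e | inner ℝ w (signed e) ≤ γ'} := by
  refine measure_mono ?_
  rintro e ⟨z, hz, hne⟩
  have h1 := mul_nonpos_of_sgn_ne hne
  have h2 : inner ℝ w (((e.2 : ℤ) : ℝ) • ((e.1 : Vec d) - z)) ≤ γ' := by
    refine (real_inner_le_norm _ _).trans ?_
    rw [norm_label_smul, norm_sub_rev]
    exact (mul_le_of_le_one_left (norm_nonneg _) hw).trans hz
  rw [inner_smul_right, inner_sub_right, mul_sub] at h2
  change inner ℝ w (signed e) ≤ γ'
  rw [inner_signed]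
  linarith

/-- The algorithm learns robustly if it rarely fails on separable data and rarely stops at a vector
that makes many mistakes. -/
lemma isRobustLearner_dpBatchPerceptron {θ : Params} {ξ : ℝ} {η₁ η₂ η₃ : ℝ≥0∞} (hγ : 0 < γ)
    (hγ1 : γ ≤ 1) (hα : 0 < α) (hn : 0 < n)
    (h₁ : ENNReal.ofReal (80 / (γ * α * √n)) ≤ η₁)
    (h₂ : ∀ (X : Fin n → Sample d) (ws : Vec d), ‖ws‖ = 1 →
      (∀ j, γ ≤ inner ℝ ws (signed (X j))) →
        acceptProb (0.95 * γ) (3 / 10 * α * θ.p * n) θ X {none} θ.T 0 ≤ η₂)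
    (h₃ : ∀ (X : Fin n → Sample d) (S : Set (Vec d)), MeasurableSet S →
      (∀ v ∈ S, ‖v‖ ≤ 1 → α * n / 2 ≤ mistakeCount (0.95 * γ) X v (List.finRange n)) →
        acceptProb (0.95 * γ) (3 / 10 * α * θ.p * n) θ X (some '' S) θ.T 0 ≤ η₃)
    (hη : η₁ + η₂ + η₃ ≤ ENNReal.ofReal ξ) :
    (dpBatchPerceptron d α (0.95 * γ) θ).IsRobustLearner γ (0.9 * γ) α ξ n := by
  intro D _ hD
  obtain ⟨ws, hws, hmargin⟩ := hD.exists_margin hγ.le hγ1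
  set A := dpBatchPerceptron d α (0.95 * γ) θ with hA
  -- The implication places all vectors of norm above 1 in B as well, so an output outside B has
  -- norm at most 1 and small risk.
  set B : Set (Vec d) :=
    {v | ‖v‖ ≤ 1 → ENNReal.ofReal α < D {e | inner ℝ v (signed e) ≤ 0.9 * γ}} with hB
  have hBm : MeasurableSet B := by
    have h1 : Measurable fun v : Vec d => D {e | inner ℝ v (signed e) ≤ 0.9 * γ} := by
      have : MeasurableSet {q : Vec d × Sample d | inner ℝ q.1 (signed q.2) ≤ 0.9 * γ} :=
        measurableSet_le (by fun_prop) measurable_const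
      exact measurable_measure_prodMk_left this
    have e : B = {v | ‖v‖ ≤ 1}ᶜ ∪
        {v | ENNReal.ofReal α < D {e | inner ℝ v (signed e) ≤ 0.9 * γ}} := by
      ext v; exact imp_iff_not_or
    rw [e]
    exact (measurableSet_le measurable_norm measurable_const).compl.union
      (measurableSet_lt measurable_const h1)
  set S : Set (Option (Vec d)) := {none} ∪ some '' B with hS
  have hs1 : MeasurableSet {w : Vec d | some w ∈ ({none} : Set (Option (Vec d)))} := by simp
  have hs2 : MeasurableSet {w : Vec d | some w ∈ some '' B} := by simpa using hBm
  have hSm : MeasurableSet {w : Vec d | some w ∈ S} := by simpa [hS] using hBm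
  set G : Set (Fin n → Sample d) := {X | ∃ v : Vec d, ‖v‖ ≤ 1 ∧
        ENNReal.ofReal α < D {e | inner ℝ v (signed e) ≤ 0.9 * γ} ∧
        mistakeCount (0.95 * γ) X v (List.finRange n) < α * n / 2} with hG
  set μ := Measure.pi fun _ : Fin n => D with hμ
  have hae : ∀ᵐ X ∂μ, ∀ j, γ ≤ inner ℝ ws (signed (X j)) :=
    Filter.eventually_all.2 fun j =>
      (measurePreserving_eval (fun _ : Fin n => D) j).quasiMeasurePreserving.ae hmargin
  calc (μ.prod (A.law n)) {q | ¬ ∃ w : Vec d, (A.run q.1 q.2).val = some w ∧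
          robustRisk (0.9 * γ) (halfspace w) D ≤ ENNReal.ofReal α}
      ≤ (μ.prod (A.law n)) {q | (A.run q.1 q.2).val ∈ S} := by
        refine measure_mono fun q hq => ?_
        by_contra hc
        refine hq ?_
        cases hv : (A.run q.1 q.2).val with
        | none => exact absurd (show (A.run q.1 q.2).val ∈ S by rw [hv]; exact .inl rfl) hc
        | some w =>
          refine ⟨w, rfl, ?_⟩
          have hw : w ∉ B := fun h => hc (show (A.run q.1 q.2).val ∈ S by
            rw [hv]; exact .inr ⟨w, h, rfl⟩)
          obtain ⟨hw1, hw2⟩ := Classical.not_imp.1 hw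
          exact (robustRisk_le hw1 D).trans (not_lt.1 hw2)
    _ = ∫⁻ X, A.outputProb X S ∂μ :=
        Measure.prod_apply (measurableSet_dpBatchPerceptron α (0.95 * γ) θ hSm)
    -- G is defined by an uncountable union over v; its measurable hull has the same measure and
    -- avoids showing that G is measurable.
    _ ≤ ∫⁻ X, ((toMeasurable μ G).indicator 1 X + (η₂ + η₃)) ∂μ := by
        refine lintegral_mono_ae ?_
        filter_upwards [hae] with X hX
        by_cases hXG : X ∈ toMeasurable μ G
        · rw [Set.indicator_of_mem hXG]
          exact le_add_right prob_le_one
        · have hle : A.outputProb X S ≤ A.outputProb X {none} + A.outputProb X (some '' B) :=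
            (measure_mono fun ω hω => hω).trans (measure_union_le _ _)
          rw [Set.indicator_of_notMem hXG, zero_add]
          refine hle.trans (add_le_add ?_ ?_)
          · rw [hA, outputProb_dpBatchPerceptron _ _ _ _ hs1]
            exact h₂ X ws hws hX
          · rw [hA, outputProb_dpBatchPerceptron _ _ _ _ hs2]
            refine h₃ X B hBm fun v hv hv1 => not_lt.1 fun hlt => ?_
            exact hXG (subset_toMeasurable μ G ⟨v, hv1, hv hv1, hlt⟩)
    _ = μ G + (η₂ + η₃) := by
        rw [lintegral_add_right _ measurable_const, lintegral_indicator_one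
          (measurableSet_toMeasurable μ G), measure_toMeasurable]
        simp
    _ ≤ ENNReal.ofReal ξ := by
        refine le_trans ?_ hη
        rw [add_assoc]
        exact add_le_add ((measure_generalization_le D hγ hα hn).trans h₁) le_rfl

end Learning

/-! ### Running time -/

section RunningTime

variable {d n : ℕ}

lemma measurable_length_roundBatch :
    Measurable fun ω : RoundCoins d n => ((roundBatch ω.1).length : ℝ≥0∞) :=
  (measurable_of_countable fun g : Fin (n + 1) → ℕ => ((roundBatch g).length : ℝ≥0∞)).comp
    measurable_fst

lemma lintegral_roundLaw_length (d : ℕ) (θ : Params) :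
    ∫⁻ ω, ((roundBatch ω.1).length : ℝ≥0∞) ∂(roundLaw d n θ) = ENNReal.ofReal (θ.p * n) := by
  have := isProbabilityMeasure_laplace θ.b_pos
  rw [roundLaw, measurePreserving_fst.lintegral_comp (f := fun g : Fin (n + 1) → ℕ =>
    ((roundBatch g).length : ℝ≥0∞)) (measurable_of_countable _), lintegral_roundBatch θ.p θ.p_pos n
    (fun L => (L.length : ℝ≥0∞)), sublistE_length (ofReal_p_le_one θ), List.length_finRange,
    ENNReal.ofReal_mul θ.p.2.1, ENNReal.ofReal_natCast]

/-- The expected running time is dominated by the work on the batches. -/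
lemma expectedTime_dpBatchPerceptron_le (α γ' : ℝ) (θ : Params) (hd : 1 ≤ d)
    (X : Fin n → Sample d) :
    (dpBatchPerceptron d α γ' θ).expectedTime X ≤
      ENNReal.ofReal (d + θ.T * (20 * d * (1 + θ.p * n))) := by
  have hp := θ.p.2.1
  set f : RoundCoins d n → ℝ≥0∞ := fun ω => 20 * d * (1 + (roundBatch ω.1).length) with hf
  have hm : Measurable fun ω : RoundCoins d n => (1 : ℝ≥0∞) + (roundBatch ω.1).length :=
    measurable_const.add measurable_length_roundBatch
  have hfm : Measurable f := hm.const_mul _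
  have hfi : ∫⁻ ω, f ω ∂(roundLaw d n θ) = ENNReal.ofReal (20 * d * (1 + θ.p * n)) := by
    rw [lintegral_const_mul _ hm,
      lintegral_add_left measurable_const, lintegral_roundLaw_length,
      ENNReal.ofReal_mul (p := 20 * (d : ℝ)) (by positivity), ENNReal.ofReal_add zero_le_one (by positivity)]
    simp [ENNReal.ofReal_mul]
  calc (dpBatchPerceptron d α γ' θ).expectedTime X
      ≤ ∫⁻ ω, ((d : ℝ≥0∞) + ∑ i, f (ω i)) ∂(Measure.pi fun _ : Fin θ.T => roundLaw d n θ) := by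
        refine lintegral_mono fun (ω : Fin θ.T → RoundCoins d n) => ?_
        simp only [dpBatchPerceptron, Timed.steps_bind, zeroVec_steps, Nat.cast_add]
        refine add_le_add le_rfl ((Nat.cast_le.2 (rounds_cons_steps_le α γ' θ X hd _ _)).trans ?_)
        rw [List.map_ofFn, List.sum_ofFn]
        simp [hf]
    _ = _ := by
        rw [lintegral_add_left measurable_const, lintegral_finsetSum]
        · simp only [(measurePreserving_eval (fun _ : Fin θ.T => roundLaw d n θ) _).lintegral_comp
            hfm, hfi]
          rw [ENNReal.ofReal_add (by positivity) (by positivity), ENNReal.ofReal_mul (by positivity)]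
          simp
        · exact fun i _ => hfm.comp (measurable_pi_apply i)

end RunningTime

/-! ### The choice of the parameters -/

lemma Learner.IsDP.mono {d : ℕ} {A : Learner d} {ε ε' δ : ℝ} (h : A.IsDP ε δ) (hε : ε ≤ ε') :
    A.IsDP ε' δ := by
  have he : ENNReal.ofReal (Real.exp ε) ≤ ENNReal.ofReal (Real.exp ε') :=
    ENNReal.ofReal_le_ofReal (Real.exp_le_exp.2 hε)
  intro n X i S hS
  obtain ⟨h1, h2⟩ := h n X i S hS
  exact ⟨h1.trans (add_le_add (mul_le_mul_left he _) le_rfl),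
    h2.trans (add_le_add (mul_le_mul_left he _) le_rfl)⟩

/-- Conditions on the parameters that make the algorithm a robust learner. -/
lemma isRobustLearner_of_le {d n : ℕ} {γ α ξ : ℝ} {θ : Params} (hγ : 0 < γ) (hγ1 : γ ≤ 1)
    (hα : 0 < α) (hξ : 0 < ξ) (hα1 : α ≤ 1)
    (hn : 0 < n) (hb : 2.5 ≤ θ.b) (hP : 1 ≤ θ.p * (n : ℝ))
    (hσ : d * (θ.σ : ℝ) ^ 2 ≤ (θ.p * n) ^ 2) (hbP : 54 * θ.b ≤ α * (θ.p * n))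
    (hT : 400000 ≤ ξ * (θ.T * (α * γ) ^ 2)) (hgen : 240 ≤ ξ * (γ * α * √n))
    (hhalt : 6 * θ.T * Real.exp (-(α * (θ.p * n) / (20 * θ.b))) ≤ ξ) :
    (dpBatchPerceptron d α (0.95 * γ) θ).IsRobustLearner γ (0.9 * γ) α ξ n := by
  have hξ3 : 0 ≤ ξ / 3 := by positivity
  have hn' : (0 : ℝ) < n := Nat.cast_pos.2 hn
  have hsn : 0 < √(n : ℝ) := Real.sqrt_pos.2 hn'
  refine isRobustLearner_dpBatchPerceptron (η₁ := ENNReal.ofReal (ξ / 3))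
    (η₂ := ENNReal.ofReal (ξ / 3)) (η₃ := ENNReal.ofReal (ξ / 3)) hγ hγ1 hα hn ?_ ?_ ?_ ?_
  · refine ENNReal.ofReal_le_ofReal ?_
    rw [div_le_iff₀ (by positivity)]
    linarith
  · intro X ws hws hX
    set P : ℝ := θ.p * n with hPdef
    have hP0 : 0 < P := by linarith
    -- κ is half of 0.05 γ times the threshold 0.3 αP. A is chosen so that Aκ = 6P², whence the
    -- errors dσ² + P + P² ≤ 3P², divided by A, are at most κ/2.
    set κ := 0.0075 * (α * γ) * P with hκ
    have hκ0 : 0 < κ := by positivity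
    set A := 800 * P / (α * γ) with hA
    have hA0 : 0 < A := by positivity
    have hAκ : A * κ = 6 * P ^ 2 := by
      rw [hA, hκ]; field_simp; norm_num
    have h1 : d * (θ.σ : ℝ) ^ 2 / A + 1 / A * (P + P ^ 2) ≤ κ / 2 := by
      rw [one_div_mul_eq_div, ← add_div, div_le_iff₀ hA0]
      nlinarith
    -- This requires αP ≥ (160/3) b, the source of the constant 54.
    have h2 : 0.05 * γ * (4 * θ.b) ≤ κ / 2 := by
      have := mul_le_mul_of_nonneg_left hbP hγ.le
      rw [hκ]
      nlinarith
    have h := acceptProb_none_le (θ := θ) (t := 3 / 10 * α * θ.p * n) (A := A) (κ := κ) (L₀ := κ)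
      hγ.le X hws hX hA0 (by rw [hκ, hPdef]; ring) hκ0.le le_rfl (by linarith) θ.T 0
    rw [potential_zero ws hA0.le] at h
    have hTpos : (0 : ℝ) < θ.T := by
      by_contra hc
      have : (θ.T : ℝ) = 0 := le_antisymm (not_lt.1 hc) (Nat.cast_nonneg _)
      rw [this] at hT
      norm_num at hT
    have hTκ : 0 < θ.T * κ := by positivity
    refine (ENNReal.mul_le_mul_iff_right (a := ENNReal.ofReal (θ.T * κ)) (ENNReal.ofReal_pos.2 hTκ).ne'
      ENNReal.ofReal_ne_top).1 (h.trans ?_)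
    rw [← ENNReal.ofReal_mul hTκ.le]
    refine ENNReal.ofReal_le_ofReal ?_
    have e : A = κ * (800 / 0.0075 / (α * γ) ^ 2) := by
      rw [hA, hκ]; field_simp
    have h3 : 400000 / (α * γ) ^ 2 ≤ ξ * θ.T := by
      rw [div_le_iff₀ (by positivity)]; linarith
    have h4 : (1 : ℝ) ≤ 1 / (α * γ) ^ 2 := by
      rw [le_div_iff₀ (by positivity), one_mul]
      exact pow_le_one₀ (by positivity) (mul_le_one₀ hα1 hγ.le hγ1)
    -- This is A/κ + 1 ≤ ξT/3; the left side is below 400000/3 divided by (αγ)².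
    have h5 : 800 / 0.0075 / (α * γ) ^ 2 + 1 ≤ ξ / 3 * θ.T := by
      rw [div_eq_mul_one_div] at h3 ⊢
      linarith
    calc A + κ = κ * (800 / 0.0075 / (α * γ) ^ 2 + 1) := by rw [mul_add, ← e, mul_one]
      _ ≤ κ * (ξ / 3 * θ.T) := mul_le_mul_of_nonneg_left h5 hκ0.le
      _ = _ := by ring
  · intro X S hS hK
    refine (acceptProb_bad_le hb X hS hK θ.T 0).trans ?_
    -- The threshold 0.3 stays below 0.8 · 0.5 = 0.4; the gap 0.1 divided by 2b gives 1/(20b).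
    have e : (3 / 10 * α * θ.p * n - 0.8 * θ.p * (α * n / 2)) / (2 * θ.b) =
        -(α * (θ.p * n) / (20 * θ.b)) := by
      have := θ.b_pos
      field_simp; ring
    rw [e, ← ENNReal.ofReal_natCast, ← ENNReal.ofReal_ofNat 2, ← ENNReal.ofReal_mul (by norm_num),
      ← ENNReal.ofReal_mul (by positivity)]
    refine ENNReal.ofReal_le_ofReal ?_
    linarith
  · rw [← ENNReal.ofReal_add hξ3 hξ3, ← ENNReal.ofReal_add (by positivity) hξ3]
    exact ENNReal.ofReal_le_ofReal (by linarith)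

/-- The order of the moments used in the privacy analysis. -/
lemma exists_order {ε δ ℓ : ℝ} (hε : 0 < ε) (hε1 : ε ≤ 1) (hδ : 0 < δ) (hℓ : 1 ≤ ℓ)
    (hδℓ : Real.log (1 / δ) ≤ ℓ - 1) :
    ∃ r : ℕ, 2 ≤ r ∧ 1 + Real.log (1 / (δ / 3)) ≤ (r - 1) * (ε / 2) ∧ (r : ℝ) * ε ≤ 8 * ℓ := by
  have hx : 0 < 6 * ℓ / ε := by positivity
  -- Then (r - 1) ε/2 ≥ 3ℓ, which covers 1 + log 3 + log(1/δ) ≤ ℓ + 2.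
  refine ⟨⌈6 * ℓ / ε⌉₊ + 1, ?_, ?_, ?_⟩
  · have := Nat.ceil_pos.2 hx
    omega
  · have h3 : Real.log 3 ≤ 2 := (Real.log_le_sub_one_of_pos (by norm_num)).trans (by norm_num)
    have e : Real.log (1 / (δ / 3)) = Real.log 3 + Real.log (1 / δ) := by
      rw [← Real.log_mul (by norm_num) (by positivity)]
      congr 1
      field_simp
    have h := (div_le_iff₀ hε).1 (Nat.le_ceil (6 * ℓ / ε))
    rw [e]
    push_cast
    linarith
  · have h := (Nat.ceil_lt_add_one hx.le).le
    have h' : (⌈6 * ℓ / ε⌉₊ : ℝ) * ε ≤ 6 * ℓ + ε := by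
      refine (mul_le_mul_of_nonneg_right h hε.le).trans (le_of_eq ?_)
      field_simp
    push_cast
    linarith

lemma natCeil_le_two_mul {x : ℝ} (hx : 1 ≤ x) : (⌈x⌉₊ : ℝ) ≤ 2 * x := by
  have := (Nat.ceil_lt_add_one (zero_le_one.trans hx)).le
  linarith

/-- The exponential beats the number of rounds. -/
lemma mul_exp_neg_le {a ℓ c M ξ y : ℝ} (ha : 0 < a) (hξ : 0 < ξ) (hℓ : 1 ≤ ℓ)
    (haℓ : 1 / a ≤ Real.exp ℓ) (hM : c / ξ + 3 ≤ M) (hy : M * ℓ ≤ y) :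
    c / a ^ 2 * Real.exp (-y) ≤ ξ := by
  rcases le_or_gt c 0 with hc | hc
  · refine le_trans (mul_nonpos_of_nonpos_of_nonneg ?_ (Real.exp_pos _).le) hξ.le
    exact div_nonpos_of_nonpos_of_nonneg hc (by positivity)
  have h0 : 0 < c / ξ := by positivity
  have h1 : (1 / a) ^ 2 ≤ Real.exp (2 * ℓ) := by
    have e : Real.exp (2 * ℓ) = Real.exp ℓ ^ 2 := by rw [← Real.exp_nat_mul]; norm_num
    rw [e]
    exact pow_le_pow_left₀ (by positivity) haℓ 2
  -- Of the exponent Mℓ, the part 2ℓ pays for 1/a² and the rest for c/ξ.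
  have h2 : c ≤ ξ * Real.exp ((M - 2) * ℓ) := by
    have h3 : c / ξ ≤ Real.exp ((M - 2) * ℓ) := by
      have := Real.add_one_le_exp ((M - 2) * ℓ)
      nlinarith
    rwa [div_le_iff₀' hξ] at h3
  rw [Real.exp_neg, ← div_eq_mul_inv, div_le_iff₀ (Real.exp_pos _)]
  calc c / a ^ 2 = c * (1 / a) ^ 2 := by ring
    _ ≤ ξ * Real.exp ((M - 2) * ℓ) * Real.exp (2 * ℓ) := by
        refine mul_le_mul h2 h1 (by positivity) (by positivity)
    _ = ξ * Real.exp (M * ℓ) := by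
        rw [mul_assoc, ← Real.exp_add]; ring_nf
    _ ≤ ξ * Real.exp y := by gcongr

/-- The number of rounds is of order `c / (α γ)²`, the sampling rate is `1 / √T`, both noises have
level `4 r`. -/
def params (T : ℕ) (hT : 0 < T) (r : ℕ) (hr : 0 < r) : Params where
  T := T
  p := ⟨1 / √T, by positivity, by
    rw [div_le_one (by positivity)]
    exact Real.one_le_sqrt.2 (by exact_mod_cast hT)⟩
  p_pos := by
    rw [← Subtype.coe_lt_coe]
    change 0 < 1 / √(T : ℝ)
    positivity
  b := 4 * r
  b_pos := by positivity
  σ := 4 * r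

/-- The noise level satisfies 4r ≤ 32ℓ/ε. Here P is the expected batch size; one lower bound on it
makes the batch nontrivial, controls early stopping and dominates the Gaussian noise. The constant
is 1280 = 2 · 20 · 32. -/
lemma batch_size_bounds {α ε ℓ M P q r D : ℝ} (hα : 0 < α) (hα1 : α < 1) (hε : 0 < ε)
    (hε1 : ε ≤ 1) (hℓ : 1 ≤ ℓ) (hM : 3 ≤ M) (hP : 0 < P) (hq : 1 ≤ q) (hD : √D ≤ q) (hr : 0 ≤ r)
    (hrε : r * ε ≤ 8 * ℓ) (h : 1280 * M * ℓ ^ 2 * q ≤ P * (ε * α)) :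
    1 ≤ P ∧ 20 * M * ℓ * (4 * r) ≤ α * P / 2 ∧ √D * (4 * r) ≤ P := by
  have hM0 : 0 < M := by linarith
  have hℓ0 : 0 < ℓ := by linarith
  have hℓ2 : ℓ ≤ ℓ ^ 2 := le_self_pow₀ hℓ two_ne_zero
  have hB : 4 * r * ε ≤ 32 * ℓ := by linarith
  have hQ : 1280 * M * ℓ ^ 2 ≤ P * (ε * α) :=
    le_trans (le_mul_of_one_le_right (by positivity) hq) h
  have hMℓ : 3 * ℓ ≤ M * ℓ ^ 2 := mul_le_mul hM hℓ2 hℓ0.le hM0.le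
  have hεα : P * (ε * α) ≤ P :=
    mul_le_of_le_one_right hP.le (mul_le_one₀ hε1 hα.le hα1.le)
  refine ⟨by linarith, le_of_mul_le_mul_right ?_ hε, le_of_mul_le_mul_right ?_ hε⟩
  · have h1 : 20 * M * ℓ * (4 * r * ε) ≤ 20 * M * ℓ * (32 * ℓ) :=
      mul_le_mul_of_nonneg_left hB (by positivity)
    linarith
  · have h1 : √D * (4 * r * ε) ≤ q * (32 * ℓ) :=
      mul_le_mul hD hB (by positivity) (by positivity)
    have h2 : P * ε * α ≤ P * ε := mul_le_of_le_one_right (by positivity) hα1.le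
    have h3 : 32 * ℓ * q ≤ 1280 * M * ℓ ^ 2 * q :=
      mul_le_mul_of_nonneg_right (by linarith) (by linarith)
    linarith

/-- The sample size and the noise levels that suffice, in terms of abstract bounds. -/
lemma params_spec {d n r T : ℕ} {γ α ε δ ξ ℓ c s M K m : ℝ} (hd : 1 ≤ d) (hγ : 0 < γ) (hγ1 : γ < 1)
    (hα : 0 < α) (hα1 : α < 1) (hε : 0 < ε) (hε1 : ε ≤ 1) (hδ : 0 < δ) (hξ : 0 < ξ)
    (hℓ : 1 ≤ ℓ) (hexp : 1 / (α * γ) ≤ Real.exp ℓ)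
    (hc : c = 400000 / ξ) (hs : 0 < s) (hM : M = 12 * c / ξ + 3)
    (hK : K = 1280 * s * M + (240 / ξ) ^ 2)
    (hm1 : 1 ≤ m * γ ^ 2) (hm2 : √d ≤ m * γ)
    (hr2 : 2 ≤ r) (hrδ : 1 + Real.log (1 / (δ / 3)) ≤ (r - 1) * (ε / 2)) (hr8 : (r : ℝ) * ε ≤ 8 * ℓ)
    (hT0 : 0 < T) (hT1 : c / (α * γ) ^ 2 ≤ T) (hT2 : (T : ℝ) ≤ 2 * c / (α * γ) ^ 2)
    (hTs : √T ≤ s / (α * γ)) (hn : K * ℓ ^ 2 * m / (ε * α ^ 2) ≤ n) :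
    let θ := params T hT0 r (by omega)
    (dpBatchPerceptron d α (0.95 * γ) θ).IsDP ε δ ∧
      (dpBatchPerceptron d α (0.95 * γ) θ).IsRobustLearner γ (0.9 * γ) α ξ n ∧
      ∀ X : Fin n → Sample d, (dpBatchPerceptron d α (0.95 * γ) θ).expectedTime X ≤
        ENNReal.ofReal (41 * s * (n * d / γ) / α) := by
  intro θ
  have hc0 : 0 < c := by rw [hc]; positivity
  have hM3 : 3 ≤ M := by rw [hM]; linarith [show 0 ≤ 12 * c / ξ by positivity]
  have hM0 : 0 < M := by linarith
  have hK1 : 1280 * s * M ≤ K := by rw [hK]; linarith [sq_nonneg (240 / ξ)]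
  have hK2 : (240 / ξ) ^ 2 ≤ K := by
    rw [hK]; linarith [show 0 ≤ 1280 * s * M by positivity]
  have hK0 : 0 < K := lt_of_lt_of_le (by positivity) hK1
  have hm0 : 0 < m := pos_of_mul_pos_left (by linarith) (sq_nonneg γ)
  have hmγ : 1 ≤ m * γ := hm1.trans
    (mul_le_mul_of_nonneg_left (pow_le_of_le_one hγ.le hγ1.le two_ne_zero) hm0.le)
  have hTr : (1 : ℝ) ≤ T := by exact_mod_cast hT0
  have hsT : 1 ≤ √(T : ℝ) := Real.one_le_sqrt.2 hTr
  have hsT2 : √(T : ℝ) ^ 2 = T := Real.sq_sqrt (by linarith)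
  have hrr : (2 : ℝ) ≤ r := by exact_mod_cast hr2
  have hn0 : 0 < n := Nat.cast_pos.1 (lt_of_lt_of_le (by positivity) hn)
  have hn0' : (0 : ℝ) < n := Nat.cast_pos.2 hn0
  have hn1 : (1 : ℝ) ≤ n := by exact_mod_cast hn0
  have hd1 : (1 : ℝ) ≤ d := by exact_mod_cast hd
  have hp : (θ.p : ℝ) = 1 / √T := rfl
  have hb : θ.b = 4 * r := rfl
  have hσ : (θ.σ : ℝ) = 4 * r := by
    change ((4 * (r : ℝ≥0) : ℝ≥0) : ℝ) = 4 * r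
    push_cast; ring
  have hθT : θ.T = T := rfl
  have hP : (θ.p : ℝ) * n = n / √T := by rw [hp]; ring
  -- Dividing n by √T ≤ s/(αγ) loses one factor 1/α and turns m into mγ, which dominates √d.
  have hPε : 1280 * M * ℓ ^ 2 * (m * γ) ≤ n / √T * (ε * α) := by
    rw [div_mul_eq_mul_div, le_div_iff₀ (by linarith)]
    have h1 : K * ℓ ^ 2 * m ≤ n * (ε * α ^ 2) := (div_le_iff₀ (by positivity)).1 hn
    have h2 : 1280 * s * M * (ℓ ^ 2 * m) ≤ K * (ℓ ^ 2 * m) :=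
      mul_le_mul_of_nonneg_right hK1 (by positivity)
    calc 1280 * M * ℓ ^ 2 * (m * γ) * √T
        ≤ 1280 * M * ℓ ^ 2 * (m * γ) * (s / (α * γ)) := by gcongr
      _ = 1280 * s * M * (ℓ ^ 2 * m) / α := by field_simp
      _ ≤ n * (ε * α) := by
          rw [div_le_iff₀ hα]
          linarith
  set P : ℝ := n / √T with hPdef
  have hP0 : 0 < P := by positivity
  have hℓsq : 1 ≤ ℓ ^ 2 := one_le_pow₀ hℓ
  obtain ⟨hP1, hbP, hdσ⟩ := batch_size_bounds hα hα1 hε hε1 hℓ hM3 hP0 hmγ hm2 (Nat.cast_nonneg r)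
    hr8 hPε
  refine ⟨?_, ?_, ?_⟩
  · refine isDP_dpBatchPerceptron (r := r) ⟨hr2, hb.ge, hσ.ge⟩ hα.le hα1.le ?_ hε1 hδ hrδ
    rw [hp, hθT, div_pow, hsT2, one_pow, mul_one_div, div_self (by linarith)]
  · refine isRobustLearner_of_le hγ hγ1.le hα hξ hα1.le hn0 ?_ ?_ ?_ ?_ ?_ ?_ ?_
    · rw [hb]; linarith
    · rw [hP]; exact hP1
    · rw [hP, hσ]
      calc (d : ℝ) * (4 * r) ^ 2 = (√d * (4 * r)) ^ 2 := by
            rw [mul_pow (√(d : ℝ)), Real.sq_sqrt (Nat.cast_nonneg d)]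
        _ ≤ P ^ 2 := pow_le_pow_left₀ (by positivity) hdσ 2
    · rw [hP, hb]
      have : 60 * (4 * r : ℝ) ≤ 20 * M * ℓ * (4 * r) := by
        refine mul_le_mul_of_nonneg_right ?_ (by positivity)
        linarith [mul_le_mul hM3 hℓ zero_le_one hM0.le]
      linarith [show 0 < α * P by positivity]
    · rw [hθT]
      have h1 := (div_le_iff₀ (by positivity : 0 < (α * γ) ^ 2)).1 hT1
      rw [hc, div_le_iff₀ hξ] at h1
      linarith
    · have h1 : 240 / ξ / (γ * α) ≤ √n := by
        refine Real.le_sqrt_of_sq_le (le_trans ?_ hn)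
        rw [div_pow, div_le_div_iff₀ (by positivity) (by positivity)]
        have h2 : (240 / ξ) ^ 2 * ε ≤ K * ℓ ^ 2 :=
          mul_le_mul hK2 (hε1.trans hℓsq) hε.le hK0.le
        calc (240 / ξ) ^ 2 * (ε * α ^ 2) = (240 / ξ) ^ 2 * ε * α ^ 2 := by ring
          _ ≤ K * ℓ ^ 2 * α ^ 2 * (m * γ ^ 2) :=
              (mul_le_mul_of_nonneg_right h2 (sq_nonneg α)).trans
                (le_mul_of_one_le_right (by positivity) hm1)
          _ = _ := by ring
      rw [div_div, div_le_iff₀ (by positivity)] at h1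
      linarith
    · rw [hP, hb, hθT]
      have h1 : M * ℓ ≤ α * P / (20 * (4 * r)) := by
        rw [le_div_iff₀ (by positivity)]
        linarith [show 0 < α * P by positivity]
      refine le_trans ?_ (mul_exp_neg_le (a := α * γ) (c := 12 * c) (by positivity) hξ hℓ hexp
        hM.ge h1)
      refine mul_le_mul_of_nonneg_right ?_ (Real.exp_pos _).le
      rw [mul_div_assoc] at hT2 ⊢
      linarith
  · intro X
    refine (expectedTime_dpBatchPerceptron_le α _ θ hd X).trans (ENNReal.ofReal_le_ofReal ?_)
    rw [hP, hθT]
    -- The total expected batch size is T p n = √T n, which is why the running time is of order 1/γ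
    -- and not 1/γ².
    have h1 : T * P = √T * n := by
      have h0 : √(T : ℝ) ^ 2 * (n / √T) = √T * n := by field_simp
      rwa [hsT2] at h0
    have h2 : (T : ℝ) ≤ √T * n := by rw [← h1]; exact le_mul_of_one_le_right (by linarith) hP1
    have h3 : 1 ≤ √T * n := one_le_mul_of_one_le_of_one_le hsT hn1
    calc (d : ℝ) + T * (20 * d * (1 + P)) = d * (1 + 20 * T + 20 * (T * P)) := by ring
      _ ≤ d * (41 * (√T * n)) := by
          refine mul_le_mul_of_nonneg_left ?_ (by linarith)
          rw [h1]; linarith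
      _ ≤ d * (41 * (s / (α * γ) * n)) := by gcongr
      _ = _ := by field_simp

lemma exists_params {ξ ε₀ : ℝ} (hξ : 0 < ξ) (hξ1 : ξ < 1) (hε₀ : 0 < ε₀) :
    ∃ C : ℝ, ∀ (d : ℕ) (γ α ε δ : ℝ), 1 ≤ d → 0 < γ → γ < 1 → 0 < α → α < 1 →
        0 < ε → ε ≤ ε₀ → 0 < δ → δ < 1 →
        ∃ (θ : Params) (n : ℕ),
          (n : ℝ) ≤ C * (1 / α) ^ 2 * (1 + Real.log (1 / (α * γ * δ))) ^ 2 *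
            (1 / ε * max (Real.sqrt d / γ) (1 / γ ^ 2)) ∧
          (θ.T : ℝ) ≤ C * (1 / α) ^ 2 * (1 / γ ^ 2) ∧
          (dpBatchPerceptron d α (0.95 * γ) θ).IsDP ε δ ∧
          (dpBatchPerceptron d α (0.95 * γ) θ).IsRobustLearner γ (0.9 * γ) α ξ n ∧
          ∀ X : Fin n → Sample d,
            (dpBatchPerceptron d α (0.95 * γ) θ).expectedTime X ≤
              ENNReal.ofReal (C * (1 / α) ^ 2 * (1 + Real.log (1 / (α * γ * δ))) ^ 2 *
                (n * d / γ)) := by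
  obtain ⟨c, hc⟩ : ∃ c, c = 400000 / ξ := ⟨_, rfl⟩
  have hc1 : 1 ≤ c := by rw [hc, le_div_iff₀ hξ]; linarith
  obtain ⟨s, hs⟩ : ∃ s, s = √(2 * c) := ⟨_, rfl⟩
  have hs0 : 0 < s := by rw [hs]; exact Real.sqrt_pos.2 (by linarith)
  obtain ⟨M, hM⟩ : ∃ M, M = 12 * c / ξ + 3 := ⟨_, rfl⟩
  have hM0 : 0 < M := by rw [hM]; positivity
  obtain ⟨K, hK⟩ : ∃ K, K = 1280 * s * M + (240 / ξ) ^ 2 := ⟨_, rfl⟩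
  have hK1 : 1 ≤ K := by
    have h1 : 1 ≤ 240 / ξ := by rw [le_div_iff₀ hξ]; linarith
    have h2 : 0 < 1280 * s * M := by positivity
    rw [hK]
    nlinarith
  refine ⟨2 * K * (1 + ε₀) + 2 * c + 41 * s, ?_⟩
  intro d γ α ε δ hd hγ hγ1 hα hα1 hε hεε₀ hδ hδ1
  obtain ⟨ℓ, hℓ⟩ : ∃ ℓ, ℓ = 1 + Real.log (1 / (α * γ * δ)) := ⟨_, rfl⟩
  obtain ⟨m, hm⟩ : ∃ m, m = max (Real.sqrt d / γ) (1 / γ ^ 2) := ⟨_, rfl⟩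
  obtain ⟨C, hC⟩ : ∃ C, C = 2 * K * (1 + ε₀) + 2 * c + 41 * s := ⟨_, rfl⟩
  rw [← hℓ, ← hm, ← hC]
  have hu0 : 0 < α * γ := by positivity
  have hu1 : α * γ ≤ 1 := mul_le_one₀ hα1.le hγ.le hγ1.le
  have huδ : 0 < α * γ * δ := by positivity
  have hexp1 : 1 / (α * γ) ≤ 1 / (α * γ * δ) :=
    one_div_le_one_div_of_le huδ (mul_le_of_le_one_right hu0.le hδ1.le)
  have hδ2 : 1 / δ ≤ 1 / (α * γ * δ) :=
    one_div_le_one_div_of_le huδ (mul_le_of_le_one_left hδ.le hu1)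
  have hδℓ : Real.log (1 / δ) ≤ ℓ - 1 := by
    rw [hℓ, add_sub_cancel_left]
    exact Real.log_le_log (by positivity) hδ2
  have hℓ1 : 1 ≤ ℓ := by
    have : 0 ≤ Real.log (1 / δ) := Real.log_nonneg (by rw [le_div_iff₀ hδ]; linarith)
    linarith
  have hexp : 1 / (α * γ) ≤ Real.exp ℓ := by
    refine hexp1.trans ?_
    rw [← Real.exp_log (show 0 < 1 / (α * γ * δ) by positivity)]
    exact Real.exp_le_exp.2 (by linarith)
  have hm1 : 1 ≤ m * γ ^ 2 := by
    rw [← div_le_iff₀ (by positivity), hm]; exact le_max_right _ _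
  have hm2 : √d ≤ m * γ := by rw [← div_le_iff₀ hγ, hm]; exact le_max_left _ _
  have hm0 : 1 ≤ m := by nlinarith [pow_le_one₀ (n := 2) hγ.le hγ1.le, sq_nonneg γ]
  -- The privacy analysis needs ε ≤ 1. Passing to min ε 1 only strengthens privacy and enlarges n by
  -- at most the factor 1 + ε₀, whence C depends on ε₀.
  obtain ⟨ε', hε'⟩ : ∃ ε', ε' = min ε 1 := ⟨_, rfl⟩
  have hε'0 : 0 < ε' := by rw [hε']; exact lt_min hε one_pos
  have hε'1 : ε' ≤ 1 := by rw [hε']; exact min_le_right _ _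
  have hε'ε : ε' ≤ ε := by rw [hε']; exact min_le_left _ _
  have hinv : 1 / ε' ≤ (1 + ε₀) * (1 / ε) := by
    rw [mul_one_div, div_le_div_iff₀ hε'0 hε, hε']
    rcases min_cases ε 1 with ⟨e, -⟩ | ⟨e, -⟩ <;> rw [e] <;> nlinarith
  obtain ⟨r, hr2, hrδ, hr8⟩ := exists_order hε'0 hε'1 hδ hℓ1 hδℓ
  obtain ⟨T, hT⟩ : ∃ T, T = ⌈c / (α * γ) ^ 2⌉₊ := ⟨_, rfl⟩
  have hx1 : 1 ≤ c / (α * γ) ^ 2 := by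
    rw [le_div_iff₀ (by positivity), one_mul]
    exact (pow_le_one₀ hu0.le hu1).trans hc1
  have hT1 : c / (α * γ) ^ 2 ≤ T := by rw [hT]; exact Nat.le_ceil _
  have hT2 : (T : ℝ) ≤ 2 * c / (α * γ) ^ 2 := by
    rw [hT, mul_div_assoc]; exact natCeil_le_two_mul hx1
  have hT0 : 0 < T := Nat.cast_pos.1 (lt_of_lt_of_le (by linarith) hT1)
  have hTs : √T ≤ s / (α * γ) := by
    rw [hs, ← Real.sqrt_sq hu0.le, ← Real.sqrt_div (by linarith)]
    exact Real.sqrt_le_sqrt hT2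
  have hN : 1 ≤ K * ℓ ^ 2 * m / (ε' * α ^ 2) := by
    rw [le_div_iff₀ (by positivity), one_mul]
    calc ε' * α ^ 2 ≤ 1 := mul_le_one₀ hε'1 (sq_nonneg α) (pow_le_one₀ hα.le hα1.le)
      _ ≤ K * ℓ ^ 2 * m :=
        one_le_mul_of_one_le_of_one_le (one_le_mul_of_one_le_of_one_le hK1 (one_le_pow₀ hℓ1)) hm0
  obtain ⟨n, hn⟩ : ∃ n, n = ⌈K * ℓ ^ 2 * m / (ε' * α ^ 2)⌉₊ := ⟨_, rfl⟩
  obtain ⟨hdp, hlearn, htime⟩ := params_spec (d := d) (n := n) hd hγ hγ1 hα hα1 hε'0 hε'1 hδ hξ hℓ1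
    hexp hc hs0 hM hK hm1 hm2 hr2 hrδ hr8 hT0 hT1 hT2 hTs (by rw [hn]; exact Nat.le_ceil _)
  have hC1 : 2 * K * (1 + ε₀) ≤ C := by rw [hC]; linarith
  have hC2 : 2 * c ≤ C := by
    rw [hC]; linarith [show 0 ≤ 2 * K * (1 + ε₀) by positivity]
  have hC3 : 41 * s ≤ C := by
    rw [hC]; linarith [show 0 ≤ 2 * K * (1 + ε₀) by positivity]
  have hC0 : 0 ≤ C := le_trans (by positivity) hC3
  refine ⟨_, n, ?_, ?_, hdp.mono hε'ε, hlearn, fun X => (htime X).trans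
    (ENNReal.ofReal_le_ofReal ?_)⟩
  · calc (n : ℝ) ≤ 2 * (K * ℓ ^ 2 * m / (ε' * α ^ 2)) := by rw [hn]; exact natCeil_le_two_mul hN
      _ = 2 * K * (1 / ε') * ((1 / α) ^ 2 * ℓ ^ 2 * m) := by field_simp
      _ ≤ 2 * K * ((1 + ε₀) * (1 / ε)) * ((1 / α) ^ 2 * ℓ ^ 2 * m) := by gcongr
      _ = 2 * K * (1 + ε₀) * ((1 / ε) * ((1 / α) ^ 2 * ℓ ^ 2 * m)) := by ring
      _ ≤ C * ((1 / ε) * ((1 / α) ^ 2 * ℓ ^ 2 * m)) := by gcongr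
      _ = _ := by ring
  · calc (T : ℝ) ≤ 2 * c / (α * γ) ^ 2 := hT2
      _ = 2 * c * ((1 / α) ^ 2 * (1 / γ ^ 2)) := by field_simp
      _ ≤ C * ((1 / α) ^ 2 * (1 / γ ^ 2)) := by gcongr
      _ = _ := by ring
  · have hα' : 1 ≤ 1 / α := by rw [le_div_iff₀ hα]; linarith
    have h1 : 1 / α ≤ (1 / α) ^ 2 * ℓ ^ 2 :=
      (le_self_pow₀ hα' two_ne_zero).trans
        (le_mul_of_one_le_right (by positivity) (one_le_pow₀ hℓ1))
    calc 41 * s * (n * d / γ) / α = 41 * s * (1 / α) * (n * d / γ) := by ring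
      _ ≤ C * ((1 / α) ^ 2 * ℓ ^ 2) * (n * d / γ) := by gcongr
      _ = _ := by ring

end

end PrivateHalfspaces

theorem theorem5 :
    ∃ k : ℕ, ∀ ξ ε₀ : ℝ, 0 < ξ → ξ < 1 → 0 < ε₀ → ∃ C : ℝ,
      ∀ (d : ℕ) (γ α ε δ : ℝ), 1 ≤ d → 0 < γ → γ < 1 → 0 < α → α < 1 →
        0 < ε → ε ≤ ε₀ → 0 < δ → δ < 1 →
        ∃ (θ : PrivateHalfspaces.Params) (n : ℕ),
          (n : ℝ) ≤ C * (1 / α) ^ k * (1 + Real.log (1 / (α * γ * δ))) ^ k *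
            (1 / ε * max (Real.sqrt d / γ) (1 / γ ^ 2)) ∧
          (θ.T : ℝ) ≤ C * (1 / α) ^ k * (1 / γ ^ 2) ∧
          (PrivateHalfspaces.dpBatchPerceptron d α (0.95 * γ) θ).IsDP ε δ ∧
          (PrivateHalfspaces.dpBatchPerceptron d α (0.95 * γ) θ).IsRobustLearner
            γ (0.9 * γ) α ξ n ∧
          ∀ X : Fin n → PrivateHalfspaces.Sample d,
            (PrivateHalfspaces.dpBatchPerceptron d α (0.95 * γ) θ).expectedTime X ≤
              ENNReal.ofReal (C * (1 / α) ^ k * (1 + Real.log (1 / (α * γ * δ))) ^ k *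
                (n * d / γ)) := by
  refine ⟨2, fun ξ ε₀ hξ hξ1 hε₀ => ?_⟩
  obtain ⟨C, hC⟩ := PrivateHalfspaces.exists_params hξ hξ1 hε₀
  refine ⟨C, fun d γ α ε δ hd hγ hγ1 hα hα1 hε hεε₀ hδ hδ1 => ?_⟩
  exact hC d γ α ε δ hd hγ hγ1 hα hα1 hε hεε₀ hδ hδ1
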